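/- Let $AP$ be a finite set of propositions and $\Gamma=2^{AP}\setminus\{\emptyset\}$. A timed word is a sequence $\rho=(\sigma_1,\tau_1)\dots(\sigma_n,\tau_n)$ with $n\ge 1$, $\sigma_i\in\Gamma$ and $0=\tau_1\le\tau_2\le\dots\le\tau_n$ real. Intervals are open, half-open or closed, with end points in $\mathbb N\cup\{\infty\}$. **Logic.** Formulae of $\mathsf{RatMTL}$ are given by $\varphi::=a\in AP\mid \mathit{true}\mid\varphi\wedge\varphi\mid\neg\varphi\mid\mathsf{Rat}_I\,\mathsf{re}\mid\varphi\,\mathsf{URat}_{I,\mathsf{re}}\,\varphi$, where $I$ is an interval and $\mathsf{re}::=\epsilon\mid\varphi\mid\mathsf{re}\cdot\mathsf{re}\mid\mathsf{re}+\mathsf{re}\mid\mathsf{re}^*$ is a rational expression whose letters are formulae; $L(\mathsf{re})$ is its language over the set $S$ of its letters. The marking of a position $k$ of $\rho$ is $\{\psi\in S:\rho,k\models\psi\}$. For a word $u=u_1\dots u_m$ over $2^S$ let $u^{\mathsf{single}}=\{w_1\dots w_m: w_l\in u_l\}$. Boolean cases are as usual, and $\rho,i\models a$ iff $a\in\sigma_i$.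 Moreover, $\rho,i\models\mathsf{Rat}_I\,\mathsf{re}$ iff $u^{\mathsf{single}}\cap L(\mathsf{re})\ne\emptyset$ for the word $u$ of markings of all positions $k$ with $\tau_k-\tau_i\in I$; and $\rho,i\models\varphi_1\,\mathsf{URat}_{I,\mathsf{re}}\,\varphi_2$ iff there is $j>i$ with $\rho,j\models\varphi_2$, $\tau_j-\tau_i\in I$, $\rho,k\models\varphi_1$ for all $i<k<j$, and $u^{\mathsf{single}}\cap L(\mathsf{re})\neq\emptyset$ for the word $u$ of markings of the positions $k$ with $i<k<j$. (So $\mathsf{FRat}_{I,\mathsf{re}}\varphi$ is $\mathit{true}\,\mathsf{URat}_{I,\mathsf{re}}\,\varphi$, and $\varphi_1\mathsf U_I\varphi_2$ is $\varphi_1\,\mathsf{URat}_{I,\mathit{true}^*}\,\varphi_2$.) The language of $\varphi$ is $\{\rho:\rho,1\models\varphi\}$. $\mathsf{SfrMTL}$ is the set of formulae all of whose rational expressions $\mathsf{re}$ (at any nesting depth) have an equivalent star-free expression: there is a star-free expression $e$ (built from $\emptyset,\epsilon$, letters, union, concatenation and complement) over markings such that, for the word $u$ of markings of any block of consecutive positions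 of any timed word, $u\in L(e)$ iff $u^{\mathsf{single}}\cap L(\mathsf{re})\ne\emptyset$. **Automata.** A 1-clock alternating timed automaton (1-ATA) has a finite set of locations, an initial location, a set of final locations, and a transition function $\delta$ that maps a location and a letter of $\Gamma$ to a formula $\varphi::=\top\mid\bot\mid\varphi\wedge\varphi\mid\varphi\vee\varphi\mid s\mid x\in I\mid x.\varphi$, where $s$ is a location, $x$ is the clock and $x.\varphi$ resets $x$ to $0$. A configuration is a set of pairs of a location and a clock value. A run on $\rho$ starts in $\{(s_0,0)\}$, where $s_0$ is the initial location, and for each position lets the time since the previous position (or since time $0$) elapse and then replaces each pair $(s,\nu)$ by the pairs demanded by some clause, all of whose clock constraints hold at $\nu$, of the disjunctive normal form of $\delta(s,a)$, where $a$ is the letter read (clock constraints in the scope of a reset are evaluated at $0$). It accepts if all locations of the last configuration are final. A 1-ATA is in normal form if its locations are partitioned into islands, each with exactly one header, such that $s_0$ is a header, every location that occurs in the scope of a reset is a header, and every location that occurs in $\delta(s,a)$ outside of resets is a non-header of the island of $s$. It has loop-free resets (1-ATA-$\mathsf{lfr}$) if it is in normal form and there is a partial order on the headers such that, whenever $q$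 occurs in the scope of a reset in $\delta(s,a)$, $q$ is strictly below the header of the island of $s$. A 1-ATA is partially ordered (PO-1-ATA) if there is a partial order on its locations such that each location occurring in $\delta(s,a)$ is $s$ or strictly below $s$, and $s$ does not occur in the scope of a reset in $\delta(s,a)$. **Theorem.** (1) A set of timed words over $AP$ is the language of a 1-ATA-$\mathsf{lfr}$ if and only if it is the language of a $\mathsf{RatMTL}$ formula. (2) A set of timed words over $AP$ is the language of a PO-1-ATA if and only if it is the language of an $\mathsf{SfrMTL}$ formula. -/

import Mathlib

universe u

/-- Time intervals: open, half-open or closed, with end points in `ℕ ∪ {∞}`. -/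
inductive TimeInterval : Type
  | icc (a b : ℕ)
  | ico (a b : ℕ)
  | ioc (a b : ℕ)
  | ioo (a b : ℕ)
  | ici (a : ℕ)
  | ioi (a : ℕ)

/-- The set of real numbers described by a time interval. -/
def TimeInterval.toSet : TimeInterval → Set ℝ
  | .icc a b => Set.Icc (a : ℝ) b
  | .ico a b => Set.Ico (a : ℝ) b
  | .ioc a b => Set.Ioc (a : ℝ) b
  | .ioo a b => Set.Ioo (a : ℝ) b
  | .ici a => Set.Ici (a : ℝ)
  | .ioi a => Set.Ioi (a : ℝ)

/-- The alphabet `Γ = 2^AP \ {∅}` over a set `AP` of propositions. -/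
abbrev Letter (AP : Type*) := {A : Set AP // A.Nonempty}

/-- Finite (non-empty, weakly monotonic) timed words over `AP`. The positions `1, …, n` of the
word are represented by the elements of `Fin (len + 1)`, so `n = len + 1` and the first position
is `0`; its time stamp is `0`. -/
structure TimedWord (AP : Type*) where
  len : ℕ
  letter : Fin (len + 1) → Letter AP
  time : Fin (len + 1) → ℝ
  time_mono : Monotone time
  time_zero : time 0 = 0

/-- The positions of a timed word. -/
abbrev TimedWord.Pos {AP : Type*} (ρ : TimedWord AP) := Fin (ρ.len + 1)

open Classical in
/-- The increasing list of all positions of `ρ` that satisfy `p`. -/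
noncomputable def TimedWord.positions {AP : Type*} (ρ : TimedWord AP) (p : ρ.Pos → Prop) :
    List ρ.Pos :=
  (List.finRange (ρ.len + 1)).filter (fun k => decide (p k))

/-- `single u`, for a word `u = u₁ … uₙ` of sets, is the set of words `w₁ … wₙ` with
`wᵢ ∈ uᵢ` for all `i`. -/
def single {α : Type*} (u : List (Set α)) : Set (List α) :=
  {w | List.Forall₂ (fun x A => x ∈ A) w u}

/-! ### The logic RatMTL -/

mutual
  /-- Formulae of `RatMTL`. `rat I re` is `Rat_I re`, and `urat φ I re ψ` is
  `φ URat_{I,re} ψ`. -/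
  inductive RatMTL (AP : Type u)
    | atom (a : AP)
    | top
    | and (φ ψ : RatMTL AP)
    | neg (φ : RatMTL AP)
    | rat (I : TimeInterval) (re : RatExp AP)
    | urat (φ : RatMTL AP) (I : TimeInterval) (re : RatExp AP) (ψ : RatMTL AP)
  /-- Rational expressions whose letters are formulae of `RatMTL`. -/
  inductive RatExp (AP : Type u)
    | eps
    | letter (φ : RatMTL AP)
    | comp (r s : RatExp AP)
    | plus (r s : RatExp AP)
    | star (r : RatExp AP)
end

/-- The language of a rational expression: a set of words whose letters are formulae. -/
def RatExp.lang {AP : Type*} : RatExp AP → Language (RatMTL AP)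
  | .eps => 1
  | .letter φ => {[φ]}
  | .comp r s => r.lang * s.lang
  | .plus r s => r.lang + s.lang
  | .star r => KStar.kstar r.lang

mutual
  /-- `φ.Sat ρ i` is `ρ, i ⊨ φ`. In the last two cases the word `TSeg(S, I, i)`, respectively
  `Seg(S, i, j)`, is the word of markings of the positions `k` with `τ k - τ i ∈ I`,
  respectively `i < k < j`, where `S` is the set of letters of `re`. -/
  def RatMTL.Sat {AP : Type u} (ρ : TimedWord AP) : RatMTL AP → ρ.Pos → Prop
    | .atom a, i => a ∈ (ρ.letter i).1
    | .top, _ => True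
    | .and φ ψ, i => RatMTL.Sat ρ φ i ∧ RatMTL.Sat ρ ψ i
    | .neg φ, i => ¬ RatMTL.Sat ρ φ i
    | .rat I re, i =>
        (single ((ρ.positions fun k => ρ.time k - ρ.time i ∈ I.toSet).map fun k => {ψ | RatExp.Marked ρ re k ψ})
          ∩ re.lang).Nonempty
    | .urat φ I re ψ, i => ∃ j, i < j ∧ RatMTL.Sat ρ ψ j ∧ ρ.time j - ρ.time i ∈ I.toSet ∧
        (∀ k, i < k → k < j → RatMTL.Sat ρ φ k) ∧
        (single ((ρ.positions fun k => i < k ∧ k < j).map fun k => {ψ | RatExp.Marked ρ re k ψ})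
          ∩ re.lang).Nonempty
  /-- `re.Marked ρ k ψ`: the formula `ψ` is a letter of the expression and `ρ, k ⊨ ψ`. -/
  def RatExp.Marked {AP : Type u} (ρ : TimedWord AP) :
      RatExp AP → ρ.Pos → RatMTL AP → Prop
    | .eps, _, _ => False
    | .letter φ, k, ψ => ψ = φ ∧ RatMTL.Sat ρ φ k
    | .comp r s, k, ψ => RatExp.Marked ρ r k ψ ∨ RatExp.Marked ρ s k ψ
    | .plus r s, k, ψ => RatExp.Marked ρ r k ψ ∨ RatExp.Marked ρ s k ψ
    | .star r, k, ψ => RatExp.Marked ρ r k ψ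
end

/-- The marking of position `k`: the set of those letters `ψ` of the expression with
`ρ, k ⊨ ψ`. -/
def RatExp.marks {AP : Type u} (ρ : TimedWord AP) (re : RatExp AP) (k : ρ.Pos) :
    Set (RatMTL AP) :=
  {ψ | re.Marked ρ k ψ}

/-- The timed language of a formula. -/
def RatMTL.language {AP : Type*} (φ : RatMTL AP) : Set (TimedWord AP) :=
  {ρ | φ.Sat ρ 0}

/-! ### The star-free fragment -/

/-- Star-free expressions over an alphabet `α`. -/
inductive StarFreeExp (α : Type*)
  | empty
  | eps
  | letter (a : α)
  | plus (e f : StarFreeExp α)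
  | comp (e f : StarFreeExp α)
  | compl (e : StarFreeExp α)

/-- The language of a star-free expression. -/
def StarFreeExp.lang {α : Type*} : StarFreeExp α → Language α
  | .empty => 0
  | .eps => 1
  | .letter a => {[a]}
  | .plus e f => e.lang + f.lang
  | .comp e f => e.lang * f.lang
  | .compl e => {w | w ∉ e.lang}

/-- The rational expression `re` over a set `S` of formulae has an equivalent star-free expression
`e` over the alphabet `2^S` of markings: on the word `u` of markings of any block of consecutive
positions of any timed word, `u` belongs to the language of `e` if and only if
`single u` meets the language of `re`. -/
def RatExp.HasStarFree {AP : Type*} (re : RatExp AP) : Prop :=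
  ∃ e : StarFreeExp (Set (RatMTL AP)), ∀ (ρ : TimedWord AP) (i j : ρ.Pos),
    (ρ.positions fun k => i ≤ k ∧ k ≤ j).map (re.marks ρ) ∈ e.lang ↔
      (single ((ρ.positions fun k => i ≤ k ∧ k ≤ j).map (re.marks ρ)) ∩ re.lang).Nonempty

mutual
  /-- The formulae of `SfrMTL`: all rational expressions that occur in the formula, at any
  nesting depth, have an equivalent star-free expression. -/
  def RatMTL.IsSfr {AP : Type*} : RatMTL AP → Prop
    | .atom _ => True
    | .top => True
    | .and φ ψ => φ.IsSfr ∧ ψ.IsSfr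
    | .neg φ => φ.IsSfr
    | .rat _ re => re.HasStarFree ∧ re.LettersSfr
    | .urat φ _ re ψ => φ.IsSfr ∧ ψ.IsSfr ∧ re.HasStarFree ∧ re.LettersSfr
  /-- All letters of the expression are formulae of `SfrMTL`. -/
  def RatExp.LettersSfr {AP : Type*} : RatExp AP → Prop
    | .eps => True
    | .letter φ => φ.IsSfr
    | .comp r s => r.LettersSfr ∧ s.LettersSfr
    | .plus r s => r.LettersSfr ∧ s.LettersSfr
    | .star r => r.LettersSfr
end

/-! ### One-clock alternating timed automata -/

/-- Transition formulae over a set `S` of locations and one clock `x`: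
`⊤`, `⊥`, `φ ∧ ψ`, `φ ∨ ψ`, `s`, `x ∈ I` and `x.φ`. -/
inductive TransFormula (S : Type)
  | top
  | bot
  | and (φ ψ : TransFormula S)
  | or (φ ψ : TransFormula S)
  | loc (s : S)
  | guard (I : TimeInterval)
  | reset (φ : TransFormula S)

/-- The locations that occur outside the scope of every reset. -/
def TransFormula.freeLocs {S : Type} : TransFormula S → Set S
  | .top => ∅
  | .bot => ∅
  | .and φ ψ => φ.freeLocs ∪ ψ.freeLocs
  | .or φ ψ => φ.freeLocs ∪ ψ.freeLocs
  | .loc s => {s}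
  | .guard _ => ∅
  | .reset _ => ∅

/-- The locations that occur in the scope of some reset, that is, the locations `s` for which
`x.s` occurs in the disjunctive normal form computed by distributing resets, conjunctions and
disjunctions (without dropping clauses). -/
def TransFormula.boundLocs {S : Type} : TransFormula S → Set S
  | .top => ∅
  | .bot => ∅
  | .and φ ψ => φ.boundLocs ∪ ψ.boundLocs
  | .or φ ψ => φ.boundLocs ∪ ψ.boundLocs
  | .loc _ => ∅
  | .guard _ => ∅
  | .reset φ => φ.freeLocs ∪ φ.boundLocs

/-- The configurations obtained by applying a transition formula at clock value `v`: choose one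
clause of the disjunctive normal form all of whose clock constraints hold, and take its locations
with clock value `v`, or `0` if they are reset. -/
def TransFormula.outcomes {S : Type} : TransFormula S → ℝ → Set (Set (S × ℝ))
  | .top, _ => {∅}
  | .bot, _ => ∅
  | .and φ ψ, v => {M | ∃ M₁ ∈ φ.outcomes v, ∃ M₂ ∈ ψ.outcomes v, M = M₁ ∪ M₂}
  | .or φ ψ, v => φ.outcomes v ∪ ψ.outcomes v
  | .loc s, v => {{(s, v)}}
  | .guard I, v => {M | v ∈ I.toSet ∧ M = ∅}
  | .reset φ, _ => φ.outcomes 0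

/-- One-clock alternating timed automata (1-ATA) over the alphabet `2^AP \ {∅}`. -/
structure OneATA (AP : Type*) where
  Loc : Type
  finite_loc : Finite Loc
  init : Loc
  final : Set Loc
  δ : Loc → Letter AP → TransFormula Loc

namespace OneATA

variable {AP : Type*}

/-- Configurations: sets of locations with clock valuations. -/
abbrev Config (A : OneATA AP) := Set (A.Loc × ℝ)

/-- Time elapse. -/
def elapse (A : OneATA AP) (C : A.Config) (t : ℝ) : A.Config :=
  (fun c => (c.1, c.2 + t)) '' C

/-- Discrete transitions: the transition function is applied to each member of `C`. -/
def Step (A : OneATA AP) (C : A.Config) (a : Letter AP) (C' : A.Config) : Prop :=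
  ∃ M : A.Loc × ℝ → A.Config,
    (∀ c ∈ C, M c ∈ (A.δ c.1 a).outcomes c.2) ∧ C' = ⋃ c ∈ C, M c

/-- The time that elapses before position `k` is read: `τ k - τ (k - 1)`, and `τ 0 - 0` for the
first position. -/
def delay (ρ : TimedWord AP) (k : ρ.Pos) : ℝ :=
  ρ.time k - (Fin.cons 0 ρ.time : Fin (ρ.len + 2) → ℝ) k.castSucc

/-- `A` has a run over `ρ` from the initial configuration to a configuration all of whose
locations are final. -/
def Accepts (A : OneATA AP) (ρ : TimedWord AP) : Prop :=
  ∃ C : Fin (ρ.len + 2) → A.Config,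
    C 0 = {(A.init, 0)} ∧
    (∀ k : ρ.Pos, A.Step (A.elapse (C k.castSucc) (delay ρ k)) (ρ.letter k) (C k.succ)) ∧
    ∀ c ∈ C (Fin.last (ρ.len + 1)), c.1 ∈ A.final

/-- The timed language of a 1-ATA. -/
def language (A : OneATA AP) : Set (TimedWord AP) :=
  {ρ | A.Accepts ρ}

/-- `A` is in normal form. The partition of the locations into islands with one header each is
given by the map `header` that sends each location to the header of its island: the islands are
the fibres of this map, the reset locations `S_r` are the fixed points, that is, the headers, and
`S_nr` is the set of all other locations. Only headers are entered by a reset, and an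
occurrence without reset leads to a location of the same island that is not its header. -/
structure NormalForm (A : OneATA AP) where
  header : A.Loc → A.Loc
  header_header : ∀ s, header (header s) = header s
  header_init : header A.init = A.init
  bound_header : ∀ s a, ∀ q ∈ (A.δ s a).boundLocs, header q = q
  free_island : ∀ s a, ∀ p ∈ (A.δ s a).freeLocs, header p = header s ∧ p ≠ header s

/-- `A` is a 1-ATA with loop-free resets (1-ATA-lfr): it is in normal form, and there is a partial
order on the reset locations such that every reset that occurs in a transition from an island leads
to a header that is strictly below the header of this island. -/
def IsLFR (A : OneATA AP) : Prop :=
  ∃ (N : A.NormalForm) (o : PartialOrder {s : A.Loc // N.header s = s}),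
    ∀ p a q, ∀ hq : q ∈ (A.δ p a).boundLocs,
      o.lt ⟨q, N.bound_header p a q hq⟩ ⟨N.header p, N.header_header p⟩

/-- `A` is a partially ordered 1-ATA (PO-1-ATA): for some partial order on the locations, every
location that occurs in `δ s a` is `s` or strictly below `s`, and `s` is not reset in `δ s a`. -/
def IsPO (A : OneATA AP) : Prop :=
  ∃ o : PartialOrder A.Loc, ∀ s a,
    (∀ p ∈ (A.δ s a).freeLocs ∪ (A.δ s a).boundLocs, p = s ∨ o.lt p s) ∧
    s ∉ (A.δ s a).boundLocs

end OneATA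

/-- `F₁ ⊆ₑ F₂`: each language of a member of `F₁` is the language of a member of `F₂`. -/
def ExprIncluded {W X Y : Type*} (F₁ : Set X) (L₁ : X → Set W) (F₂ : Set Y) (L₂ : Y → Set W) :
    Prop :=
  ∀ x ∈ F₁, ∃ y ∈ F₂, L₁ x = L₂ y

/-- `F₁ ≡ₑ F₂`: expressive equivalence of two classes of automata or formulae. -/
def ExprEquiv {W X Y : Type*} (F₁ : Set X) (L₁ : X → Set W) (F₂ : Set Y) (L₂ : Y → Set W) :
    Prop :=
  ExprIncluded F₁ L₁ F₂ L₂ ∧ ExprIncluded F₂ L₂ F₁ L₁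

-- Both equivalences are proved at once: the flag `sf` selects regular (`false`) or star-free
-- (`true`) word languages, and automata and formulae are compared through the class `Definable`. A
-- definable property of a position `k` is built from letters and Boolean operations by asking that
-- the word of observations after `k` belongs to a language of the selected class. An observation at
-- `j` records which simpler properties hold at `j` and which intervals contain the time elapsed
-- since `k`.
--
-- From automata to definable properties (`OneATA.exists_definable`): acceptance is evaluated
-- backwards from the end of the word (`OneATA.accepts_iff`). After a reset at `k`, the locations
-- under a further reset have smaller rank, so their acceptance is a simpler property that can be
-- observed. What remains is an alternating automaton on words of observations. Its language is
-- regular; if the automaton is partially ordered, each state satisfies a fixed point equation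
-- solved by an until, so the language is star-free (`BAut.acc_ltLang`).
--
-- From definable properties to automata (`Definable.exists_rankedATA`): a regular language has a
-- deterministic automaton. A star-free language is recognized by a finite aperiodic monoid
-- (Schützenberger products), hence definable in temporal logic (induction on local divisors,
-- `ltLang_of_aperiodic`), hence accepted by a partially ordered alternating automaton. The word
-- automaton becomes a new island above automata for the simpler properties and their negations.
--
-- From definable properties to formulae (`Definable.expressible`): seen from `k`, the elapsed time
-- runs monotonically through finitely many regions. `Cls.split` cuts the language at the region
-- boundaries; a positive region is described by `Rat`, distance zero by `URat`.
--
-- From formulae to definable properties (`RatMTL.definable`): the one obstacle is that `Rat_I` with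
-- `0 ∈ I` also sees earlier positions with the time stamp of `k`. So `Definable sf True` may jump
-- to the first of the simultaneous positions. The jump is then removed: by
-- `Definable.exists_context` the past matters only through finitely many bits fixed at the start of
-- the block, and a Mealy machine with star-free behaviour carries these bits along. At the first
-- position of the word the jump is the identity (`Definable.eliminate_start`).

/-! ### Regular and star-free languages -/

/-- Languages recognized by finite deterministic automata. -/
def RegLang {α : Type*} (L : List α → Prop) : Prop :=
  ∃ (S : Type) (_ : Finite S) (s : S) (f : S → α → S) (F : S → Prop),
    ∀ w, L w ↔ F (w.foldl f s)

/-- Languages described by star-free expressions. -/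
def SfLang {α : Type*} (L : List α → Prop) : Prop :=
  ∃ e : StarFreeExp α, ∀ w, w ∈ e.lang ↔ L w

/-- Star-free languages if `sf = true`, regular languages otherwise. -/
def Cls {α : Type*} : Bool → (List α → Prop) → Prop
  | true, L => SfLang L
  | false, L => RegLang L

/-- The output of a Mealy machine. -/
def mealyRun {S σ τ : Type*} (f : S → σ → S) (o : S → σ → τ) : S → List σ → List τ
  | _, [] => []
  | s, x :: w => o s x :: mealyRun f o (f s x) w

theorem mealyRun_append {S σ τ : Type*} (f : S → σ → S) (o : S → σ → τ) (s : S)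
    (u v : List σ) :
    mealyRun f o s (u ++ v) = mealyRun f o s u ++ mealyRun f o (u.foldl f s) v := by
  induction u generalizing s with
  | nil => rfl
  | cons x u ih => simp [mealyRun, ih]

theorem mealyRun_length {S σ τ : Type*} (f : S → σ → S) (o : S → σ → τ) (s : S)
    (u : List σ) : (mealyRun f o s u).length = u.length := by
  induction u generalizing s with
  | nil => rfl
  | cons x u ih => simp [mealyRun, ih]

theorem mealyRun_eq_append {S σ τ : Type*} {f : S → σ → S} {o : S → σ → τ} {s : S}
    {w : List σ} {x y : List τ} (h : mealyRun f o s w = x ++ y) :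
    ∃ u v, w = u ++ v ∧ mealyRun f o s u = x ∧ mealyRun f o (u.foldl f s) v = y := by
  have hl : w.length = x.length + y.length := by
    rw [← mealyRun_length f o s, h, List.length_append]
  refine ⟨w.take x.length, w.drop x.length, (List.take_append_drop _ _).symm, ?_⟩
  rw [← List.take_append_drop x.length w, mealyRun_append] at h
  exact List.append_inj h (by rw [mealyRun_length, List.length_take]; omega)

-- Closure properties of regular and star-free languages

section closure
variable {α β : Type*}

theorem Cls.congr {sf : Bool} {L K : List α → Prop} (hL : Cls sf L) (h : ∀ w, K w ↔ L w) :
    Cls sf K := by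
  have : K = L := funext fun w => propext (h w)
  rwa [this]

theorem StarFreeExp.mem_comp (e f : StarFreeExp α) (w : List α) :
    w ∈ (StarFreeExp.comp e f).lang ↔ ∃ u v, w = u ++ v ∧ u ∈ e.lang ∧ v ∈ f.lang := by
  simp only [StarFreeExp.lang, Language.mem_mul]
  constructor
  · rintro ⟨u, hu, v, hv, rfl⟩
    exact ⟨u, v, rfl, hu, hv⟩
  · rintro ⟨u, v, rfl, hu, hv⟩
    exact ⟨u, hu, v, hv, rfl⟩

theorem StarFreeExp.mem_plus (e f : StarFreeExp α) (w : List α) :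
    w ∈ (StarFreeExp.plus e f).lang ↔ w ∈ e.lang ∨ w ∈ f.lang := Iff.rfl

theorem StarFreeExp.mem_compl (e : StarFreeExp α) (w : List α) :
    w ∈ (StarFreeExp.compl e).lang ↔ w ∉ e.lang := Iff.rfl

theorem StarFreeExp.mem_letter (a : α) (w : List α) :
    w ∈ (StarFreeExp.letter a).lang ↔ w = [a] := Iff.rfl

theorem StarFreeExp.mem_eps (w : List α) :
    w ∈ (StarFreeExp.eps : StarFreeExp α).lang ↔ w = [] := Iff.rfl

theorem StarFreeExp.mem_empty (w : List α) :
    w ∈ (StarFreeExp.empty : StarFreeExp α).lang ↔ False := Iff.rfl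

theorem Cls.not {sf : Bool} {L : List α → Prop} (hL : Cls sf L) : Cls sf fun w => ¬ L w := by
  cases sf
  · obtain ⟨S, hS, s, f, F, h⟩ := hL
    exact ⟨S, hS, s, f, fun s => ¬ F s, fun w => by beta_reduce; rw [h]⟩
  · obtain ⟨e, he⟩ := hL
    exact ⟨.compl e, fun w => by rw [StarFreeExp.mem_compl, he]⟩

theorem Cls.or {sf : Bool} {L K : List α → Prop} (hL : Cls sf L) (hK : Cls sf K) :
    Cls sf fun w => L w ∨ K w := by
  cases sf
  · obtain ⟨S, hS, s, f, F, h⟩ := hL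
    obtain ⟨S', hS', s', f', F', h'⟩ := hK
    refine ⟨S × S', inferInstance, (s, s'), fun p a => (f p.1 a, f' p.2 a),
      fun p => F p.1 ∨ F' p.2, fun w => ?_⟩
    have : ∀ (w : List α) (s : S) (s' : S'),
        w.foldl (fun (p : S × S') a => (f p.1 a, f' p.2 a)) (s, s') =
          (w.foldl f s, w.foldl f' s') := by
      intro w
      induction w with
      | nil => intros; rfl
      | cons a w ih => intro s s'; simp [ih]
    beta_reduce
    rw [this, h, h']
  · obtain ⟨e, he⟩ := hL
    obtain ⟨e', he'⟩ := hK
    exact ⟨.plus e e', fun w => by rw [StarFreeExp.mem_plus, he, he']⟩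

theorem Cls.and {sf : Bool} {L K : List α → Prop} (hL : Cls sf L) (hK : Cls sf K) :
    Cls sf fun w => L w ∧ K w :=
  (hL.not.or hK.not).not.congr fun w => by tauto

theorem Cls.const {sf : Bool} (p : Prop) : Cls sf fun _ : List α => p := by
  cases sf
  · exact ⟨Unit, inferInstance, (), fun s _ => s, fun _ => p, fun w => Iff.rfl⟩
  · by_cases hp : p
    · exact ⟨.compl .empty, fun w => by simp [StarFreeExp.mem_compl, StarFreeExp.mem_empty, hp]⟩
    · exact ⟨.empty, fun w => by simp [StarFreeExp.mem_empty, hp]⟩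

theorem Cls.nil {sf : Bool} : Cls sf fun w : List α => w = [] := by
  cases sf
  · refine ⟨Bool, inferInstance, true, fun _ _ => false, fun b => b = true, fun w => ?_⟩
    cases w with
    | nil => simp
    | cons a w =>
      have : ∀ w : List α, w.foldl (fun (_ : Bool) _ => false) false = false := by
        intro w; induction w with
        | nil => rfl
        | cons a w ih => simp [ih]
      simp [this]
  · exact ⟨.eps, fun w => Iff.rfl⟩

theorem Cls.exists {sf : Bool} {ι : Type*} [Finite ι] {L : ι → List α → Prop}
    (hL : ∀ i, Cls sf (L i)) : Cls sf fun w => ∃ i, L i w := by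
  have key : ∀ s : Finset ι, Cls sf fun w => ∃ i ∈ s, L i w := by
    classical
    intro s
    induction s using Finset.induction_on with
    | empty => exact (Cls.const False).congr fun w => by simp
    | insert a s _ ih => exact ((hL a).or ih).congr fun w => by simp
  cases nonempty_fintype ι
  exact (key Finset.univ).congr fun w => by simp

theorem Cls.forall {sf : Bool} {ι : Type*} [Finite ι] {L : ι → List α → Prop}
    (hL : ∀ i, Cls sf (L i)) : Cls sf fun w => ∀ i, L i w :=
  (Cls.exists fun i => (hL i).not).not.congr fun w => by push Not; rfl

theorem Cls.letter {sf : Bool} [Finite α] (p : α → Prop) :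
    Cls sf fun w : List α => ∃ x, w = [x] ∧ p x := by
  cases sf
  · classical
    refine ⟨Fin 3, inferInstance, 0, fun s x => if s = 0 ∧ p x then 1 else 2, fun s => s = 1,
      fun w => ?_⟩
    have : ∀ w : List α, w.foldl (fun (s : Fin 3) x => if s = 0 ∧ p x then 1 else 2) 2 = 2 := by
      intro w; induction w with
      | nil => rfl
      | cons a w ih => simpa using ih
    match w with
    | [] => simp
    | [x] => by_cases hx : p x <;> simp [hx]
    | x :: y :: w =>
      by_cases hx : p x <;> simp [hx, this]
  · have : Cls true fun w : List α => ∃ x : {x // p x}, w = [x.1] :=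
      Cls.exists fun x => ⟨.letter x.1, fun w => Iff.rfl⟩
    exact this.congr fun w => by simp only [Subtype.exists, exists_prop]; tauto

/-- Subset construction for concatenation: the second component collects the states of a second
automaton launched after every prefix that the first one accepts. -/
theorem foldl_pairSet {S S' : Type*} (f : S → α → S) (f' : S' → α → S') (G : S → Prop)
    (s : S) (s' : S') (w : List α) :
    w.foldl (fun (p : S × Set S') a =>
      (f p.1 a, {t | (∃ q ∈ p.2, t = f' q a) ∨ (G (f p.1 a) ∧ t = s')}))
        (s, {t | G s ∧ t = s'}) =
      (w.foldl f s, {t | ∃ u v, w = u ++ v ∧ G (u.foldl f s) ∧ t = v.foldl f' s'}) := by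
  induction w using List.reverseRecOn with
  | nil =>
    ext t <;> simp
  | append_singleton w a ih =>
    rw [List.foldl_append, ih]
    simp only [List.foldl_cons, List.foldl_nil, List.foldl_append, Prod.mk.injEq, true_and]
    ext t
    simp only [Set.mem_ofPred_eq]
    constructor
    · rintro (⟨q, ⟨u, v, rfl, hu, rfl⟩, rfl⟩ | ⟨hG, rfl⟩)
      · exact ⟨u, v ++ [a], by simp, hu, by simp⟩
      · exact ⟨w ++ [a], [], by simp, by simpa using hG, rfl⟩
    · rintro ⟨u, v, h, hu, rfl⟩
      rcases List.eq_nil_or_concat v with rfl | ⟨v, b, rfl⟩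
      · right
        rw [List.append_nil] at h
        subst h
        exact ⟨by simpa using hu, rfl⟩
      · left
        rw [List.concat_eq_append, ← List.append_assoc] at h
        obtain ⟨rfl, h⟩ := List.append_inj' h rfl
        obtain rfl : a = b := by simpa using h
        exact ⟨_, ⟨u, v, rfl, hu, rfl⟩, by simp⟩

theorem Cls.concat {sf : Bool} {L K : List α → Prop} (hL : Cls sf L) (hK : Cls sf K) :
    Cls sf fun w => ∃ u v, w = u ++ v ∧ L u ∧ K v := by
  cases sf
  · obtain ⟨S, hS, s, f, F, h⟩ := hL
    obtain ⟨S', hS', s', f', F', h'⟩ := hK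
    refine ⟨S × Set S', inferInstance, (s, {t | F s ∧ t = s'}), fun (p : S × Set S') a =>
        (f p.1 a, {t | (∃ q ∈ p.2, t = f' q a) ∨ (F (f p.1 a) ∧ t = s')}),
        fun p => ∃ t ∈ p.2, F' t, fun w => ?_⟩
    · rw [foldl_pairSet f f' F]
      simp only [Set.mem_ofPred_eq, h, h']
      constructor
      · rintro ⟨u, v, rfl, hu, hv⟩
        exact ⟨_, ⟨u, v, rfl, hu, rfl⟩, hv⟩
      · rintro ⟨_, ⟨u, v, rfl, hu, rfl⟩, hv⟩
        exact ⟨u, v, rfl, hu, hv⟩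
  · obtain ⟨e, he⟩ := hL
    obtain ⟨e', he'⟩ := hK
    exact ⟨.comp e e', fun w => by simp only [StarFreeExp.mem_comp, he, he']⟩

theorem Cls.all {sf : Bool} [Finite α] (p : α → Prop) :
    Cls sf fun w : List α => ∀ x ∈ w, p x := by
  have h := (Cls.concat (Cls.const (sf := sf) (α := α) True)
    ((Cls.letter (sf := sf) fun x : α => ¬ p x).concat (Cls.const True))).not
  refine h.congr fun w => ?_
  constructor
  · rintro h ⟨u, _, rfl, -, _, v, rfl, ⟨x, rfl, hx⟩, -⟩
    exact hx (h x (by simp))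
  · intro h x hx
    by_contra hp
    obtain ⟨u, v, rfl⟩ := List.append_of_mem hx
    exact h ⟨u, x :: v, rfl, trivial, [x], v, rfl, ⟨x, rfl, hp⟩, trivial⟩

theorem filterMap_eq_singleton {g : α → Option β} {w : List α} {b : β} :
    w.filterMap g = [b] ↔ ∃ u x v, w = u ++ x :: v ∧ (∀ y ∈ u, g y = none) ∧ g x = some b ∧
      ∀ y ∈ v, g y = none := by
  rw [List.filterMap_eq_cons_iff]
  simp only [List.filterMap_eq_nil_iff]

/-- An automaton ignores the erased letters. For star-free expressions, inverse images commute with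
Boolean operations and, since factorizations of the image lift, with concatenation; a single letter
gets padded on both sides by erased letters, which form a star-free language. -/
theorem Cls.filterMap {sf : Bool} [Finite α] (g : α → Option β) {L : List β → Prop}
    (hL : Cls sf L) : Cls sf fun w => L (w.filterMap g) := by
  cases sf
  · obtain ⟨S, hS, s, f, F, h⟩ := hL
    refine ⟨S, hS, s, fun s a => (g a).elim s (f s), F, fun w => ?_⟩
    beta_reduce
    rw [h]
    have : ∀ s, (w.filterMap g).foldl f s = w.foldl (fun s a => (g a).elim s (f s)) s := by
      induction w with
      | nil => intro s; rfl
      | cons a w ih =>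
        intro s
        rcases hg : g a with _ | b
        · simp [hg, ih]
        · simp [hg, ih]
    rw [this]
  · obtain ⟨e, he⟩ := hL
    obtain rfl : (fun w => w ∈ e.lang) = L := funext fun w => propext (he w)
    clear he
    change Cls true fun w : List α => w.filterMap g ∈ e.lang
    induction e with
    | empty => exact (Cls.const False).congr fun w => Iff.rfl
    | eps =>
      exact (Cls.all fun x => g x = none).congr fun w => by
        rw [StarFreeExp.mem_eps, List.filterMap_eq_nil_iff]
    | letter b =>
      have hN : Cls true fun w : List α => ∀ x ∈ w, g x = none := Cls.all _
      refine (hN.concat ((Cls.letter fun x => g x = some b).concat hN)).congr fun w => ?_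
      rw [StarFreeExp.mem_letter, filterMap_eq_singleton]
      constructor
      · rintro ⟨u, x, v, rfl, h1, h2, h3⟩
        exact ⟨u, x :: v, rfl, h1, [x], v, rfl, ⟨x, rfl, h2⟩, h3⟩
      · rintro ⟨u, _, rfl, h1, _, v, rfl, ⟨x, rfl, h2⟩, h3⟩
        exact ⟨u, x, v, rfl, h1, h2, h3⟩
    | plus e f he hf => exact he.or hf
    | compl e he => exact he.not
    | comp e f he hf =>
      refine (he.concat hf).congr fun w => ?_
      rw [StarFreeExp.mem_comp]
      constructor
      · rintro ⟨x, y, h, hx, hy⟩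
        obtain ⟨u, v, rfl, rfl, rfl⟩ := List.filterMap_eq_append_iff.1 h
        exact ⟨u, v, rfl, hx, hy⟩
      · rintro ⟨u, v, rfl, hx, hy⟩
        exact ⟨_, _, List.filterMap_append, hx, hy⟩

theorem Cls.map {sf : Bool} [Finite α] (g : α → β) {L : List β → Prop}
    (hL : Cls sf L) : Cls sf fun w => L (w.map g) :=
  (hL.filterMap fun a => some (g a)).congr fun w => by
    rw [← List.filterMap_eq_map]; rfl

/-- In the star-free case a concatenation is cut at the state reached after the first factor. The
languages leading to that state must then be star-free themselves, which is the role of `hS`. -/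
theorem Cls.mealy {sf : Bool} [Finite α] {S : Type} [Finite S] (f : S → α → S) (o : S → α → β)
    (hS : ∀ s t, Cls sf fun w : List α => w.foldl f s = t)
    {L : List β → Prop} (hL : Cls sf L) (s : S) : Cls sf fun w => L (mealyRun f o s w) := by
  cases sf
  · obtain ⟨S', hS', s', f', F, h⟩ := hL
    refine ⟨S × S', inferInstance, (s, s'), fun p a => (f p.1 a, f' p.2 (o p.1 a)),
      fun p => F p.2, fun w => ?_⟩
    beta_reduce
    rw [h]
    have : ∀ s s', (w.foldl (fun (p : S × S') a => (f p.1 a, f' p.2 (o p.1 a))) (s, s')).2 =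
        (mealyRun f o s w).foldl f' s' := by
      induction w with
      | nil => intros; rfl
      | cons a w ih => intro s s'; simp [mealyRun, ih]
    rw [this]
  · obtain ⟨e, he⟩ := hL
    obtain rfl : (fun w => w ∈ e.lang) = L := funext fun w => propext (he w)
    clear he
    change Cls true fun w : List α => mealyRun f o s w ∈ e.lang
    induction e generalizing s with
    | empty => exact (Cls.const False).congr fun w => Iff.rfl
    | eps =>
      refine Cls.nil.congr fun w => ?_
      cases w <;> simp [StarFreeExp.mem_eps, mealyRun]
    | letter b =>
      refine (Cls.letter fun x => o s x = b).congr fun w => ?_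
      rw [StarFreeExp.mem_letter]
      match w with
      | [] => simp [mealyRun]
      | [x] => simp [mealyRun]
      | x :: y :: w => simp [mealyRun]
    | plus e f he hf => exact (he s).or (hf s)
    | compl e he => exact (he s).not
    | comp e f' he hf =>
      refine (Cls.exists fun t => ((he s).and (hS s t)).concat (hf t)).congr fun w => ?_
      rw [StarFreeExp.mem_comp]
      constructor
      · rintro ⟨x, y, h, hx, hy⟩
        obtain ⟨u, v, rfl, rfl, rfl⟩ := mealyRun_eq_append h
        exact ⟨_, u, v, rfl, ⟨hx, rfl⟩, hy⟩
      · rintro ⟨_, u, v, rfl, ⟨hx, rfl⟩, hy⟩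
        exact ⟨_, _, mealyRun_append .., hx, hy⟩

/-- A language of the class splits, along every factorization of a word, into finitely many
pairs of languages of the class. -/
theorem Cls.split {sf : Bool} {L : List α → Prop} (hL : Cls sf L) :
    ∃ (ι : Type) (_ : Finite ι) (U V : ι → List α → Prop), (∀ i, Cls sf (U i)) ∧
      (∀ i, Cls sf (V i)) ∧ ∀ u v, L (u ++ v) ↔ ∃ i, U i u ∧ V i v := by
  cases sf
  · obtain ⟨S, hS, s, f, F, h⟩ := hL
    -- The index is the state of the automaton at the cut.
    refine ⟨S, hS, fun t u => u.foldl f s = t, fun t v => F (v.foldl f t),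
      fun t => ⟨S, hS, s, f, fun r => r = t, fun w => Iff.rfl⟩,
      fun t => ⟨S, hS, t, f, F, fun w => Iff.rfl⟩, fun u v => ?_⟩
    rw [h, List.foldl_append]
    simp
  · obtain ⟨e, he⟩ := hL
    obtain rfl : (fun w => w ∈ e.lang) = L := funext fun w => propext (he w)
    clear he
    induction e with
    | empty =>
      exact ⟨Empty, inferInstance, nofun, nofun, nofun, nofun, fun u v => by
        simp [StarFreeExp.mem_empty]⟩
    | eps =>
      refine ⟨Unit, inferInstance, fun _ u => u = [], fun _ u => u = [], fun _ => Cls.nil,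
        fun _ => Cls.nil, fun u v => by simp [StarFreeExp.mem_eps]⟩
    | letter a =>
      have hA : Cls true fun w : List α => w = [a] := ⟨.letter a, fun w => Iff.rfl⟩
      refine ⟨Bool, inferInstance, fun b u => if b then u = [a] else u = [],
        fun b u => if b then u = [] else u = [a], fun b => ?_, fun b => ?_, fun u v => ?_⟩
      · cases b
        · exact Cls.nil
        · exact hA
      · cases b
        · exact hA
        · exact Cls.nil
      · simp [StarFreeExp.mem_letter, List.append_eq_singleton_iff]
    | plus e f he hf =>
      obtain ⟨ι, _, U, V, hU, hV, h⟩ := he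
      obtain ⟨ι', _, U', V', hU', hV', h'⟩ := hf
      refine ⟨ι ⊕ ι', inferInstance, Sum.elim U U', Sum.elim V V', ?_, ?_, fun u v => ?_⟩
      · rintro (i | i)
        exacts [hU i, hU' i]
      · rintro (i | i)
        exacts [hV i, hV' i]
      · beta_reduce at *
        rw [StarFreeExp.mem_plus, h, h']
        simp
    | compl e he =>
      obtain ⟨ι, _, U, V, hU, hV, h⟩ := he
      -- The index `J` bounds the set of `i` with `U i u`; the second word must avoid `V i` for all
      -- `i` in this bound.
      refine ⟨Set ι, inferInstance, fun J u => ∀ i, U i u → i ∈ J,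
        fun J v => ∀ i, i ∈ J → ¬ V i v, fun J => ?_, fun J => ?_, fun u v => ?_⟩
      · exact Cls.forall fun i => ((hU i).not.or (Cls.const (i ∈ J))).congr fun w => by tauto
      · exact Cls.forall fun i => ((hV i).not.or (Cls.const (i ∉ J))).congr fun w => by tauto
      · beta_reduce at *
        rw [StarFreeExp.mem_compl, h]
        constructor
        · intro hn
          exact ⟨{i | U i u}, fun i hi => hi, fun i hi hv => hn ⟨i, hi, hv⟩⟩
        · rintro ⟨J, h1, h2⟩ ⟨i, hu, hv⟩
          exact h2 i (h1 i hu) hv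
    | comp e f he hf =>
      have hce : Cls true fun w => w ∈ e.lang := ⟨e, fun w => Iff.rfl⟩
      have hcf : Cls true fun w => w ∈ f.lang := ⟨f, fun w => Iff.rfl⟩
      obtain ⟨ι, _, U, V, hU, hV, h⟩ := he
      obtain ⟨ι', _, U', V', hU', hV', h'⟩ := hf
      -- The given cut falls either inside the factor from `e` or inside the factor from `f`.
      refine ⟨ι ⊕ ι', inferInstance,
        Sum.elim U fun i w => ∃ u v, w = u ++ v ∧ u ∈ e.lang ∧ U' i v,
        Sum.elim (fun i w => ∃ u v, w = u ++ v ∧ V i u ∧ v ∈ f.lang) V', ?_, ?_, fun u v => ?_⟩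
      · rintro (i | i)
        exacts [hU i, hce.concat (hU' i)]
      · rintro (i | i)
        exacts [(hV i).concat hcf, hV' i]
      · beta_reduce at *
        rw [StarFreeExp.mem_comp]
        constructor
        · rintro ⟨x, y, hxy, hx, hy⟩
          rcases List.append_eq_append_iff.1 hxy with ⟨z, rfl, rfl⟩ | ⟨z, rfl, rfl⟩
          · obtain ⟨i, h1, h2⟩ := (h u z).1 hx
            exact ⟨.inl i, h1, z, y, rfl, h2, hy⟩
          · obtain ⟨i, h1, h2⟩ := (h' z v).1 hy
            exact ⟨.inr i, ⟨x, z, rfl, hx, h1⟩, h2⟩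
        · rintro ⟨i | i, h1, h2⟩
          · obtain ⟨z, y, rfl, hz, hy⟩ := h2
            exact ⟨u ++ z, y, by simp, (h u z).2 ⟨i, h1, hz⟩, hy⟩
          · obtain ⟨x, z, rfl, hx, hz⟩ := h1
            exact ⟨x, z ++ v, by simp, hx, (h' z v).2 ⟨i, hz, h2⟩⟩

theorem Cls.leftQuotient {sf : Bool} {L : List α → Prop} (hL : Cls sf L) (u : List α) :
    Cls sf fun v => L (u ++ v) := by
  obtain ⟨ι, _, U, V, hU, hV, h⟩ := hL.split
  exact (Cls.exists fun i => (Cls.const (U i u)).and (hV i)).congr fun v => h u v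

theorem Cls.rightQuotient {sf : Bool} {L : List α → Prop} (hL : Cls sf L) (v : List α) :
    Cls sf fun u => L (u ++ v) := by
  obtain ⟨ι, _, U, V, hU, hV, h⟩ := hL.split
  exact (Cls.exists fun i => (hU i).and (Cls.const (V i v))).congr fun u => h u v

theorem Cls.cons {sf : Bool} [Finite α] {p : α → Prop} {L : List α → Prop} (hL : Cls sf L) :
    Cls sf fun w => ∃ x v, w = x :: v ∧ p x ∧ L v := by
  refine ((Cls.letter p).concat hL).congr fun w => ?_
  constructor
  · rintro ⟨x, v, rfl, hx, hv⟩
    exact ⟨[x], v, rfl, ⟨x, rfl, hx⟩, hv⟩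
  · rintro ⟨_, v, rfl, ⟨x, rfl, hx⟩, hv⟩
    exact ⟨x, v, rfl, hx, hv⟩

theorem Cls.star {L : List α → Prop} (hL : Cls false L) :
    Cls false fun w => ∃ ws : List (List α), w = ws.flatten ∧ ∀ y ∈ ws, L y := by
  obtain ⟨S, hS, s, f, F, h⟩ := hL
  set K : List α → Prop := fun w => ∃ ws : List (List α), w = ws.flatten ∧ ∀ y ∈ ws, L y
  have K0 : K [] := ⟨[], rfl, by simp⟩
  -- The last nonempty block is singled out; empty blocks after it are dropped.
  have K1 : ∀ w a, K (w ++ [a]) ↔ ∃ u v, w = u ++ v ∧ K u ∧ L (v ++ [a]) := by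
    intro w a
    constructor
    · rintro ⟨ws, h1, h2⟩
      induction ws using List.reverseRecOn with
      | nil => simp at h1
      | append_singleton ws y ih =>
        rcases List.eq_nil_or_concat y with rfl | ⟨v, b, rfl⟩
        · exact ih (by simpa using h1) fun y hy => h2 y (by simp [hy])
        · rw [List.flatten_append, List.concat_eq_append] at h1
          simp only [List.flatten_cons, List.flatten_nil, List.append_nil] at h1
          rw [← List.append_assoc] at h1
          obtain ⟨rfl, h3⟩ := List.append_inj' h1 rfl
          obtain rfl : a = b := by simpa using h3
          exact ⟨_, v, rfl, ⟨ws, rfl, fun y hy => h2 y (by simp [hy])⟩, h2 _ (by simp)⟩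
    · rintro ⟨u, v, rfl, ⟨ws, rfl, hu⟩, hv⟩
      exact ⟨ws ++ [v ++ [a]], by simp, by
        simp only [List.mem_append, List.mem_singleton]
        rintro y (hy | rfl)
        exacts [hu y hy, hv]⟩
  -- A state holds all possible states of the automaton inside the unfinished block, and whether the
  -- word read so far is already in the star; in that case a new block may start.
  let step : Set S × Prop → α → Set S × Prop := fun p a =>
    ({t | (∃ q ∈ p.1, t = f q a) ∨ ((∃ q ∈ p.1, F (f q a)) ∧ t = s)}, ∃ q ∈ p.1, F (f q a))
  have key : ∀ w : List α, w.foldl step ({s}, True) =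
      ({t | ∃ u v, w = u ++ v ∧ K u ∧ t = v.foldl f s}, K w) := by
    intro w
    induction w using List.reverseRecOn with
    | nil =>
      ext t
      · simp only [List.foldl_nil, Set.mem_singleton_iff, Set.mem_ofPred_eq, List.nil_eq_append_iff]
        constructor
        · rintro rfl
          exact ⟨[], [], ⟨rfl, rfl⟩, K0, rfl⟩
        · rintro ⟨u, v, ⟨rfl, rfl⟩, -, rfl⟩
          rfl
      · simp [K0]
    | append_singleton w a ih =>
      have hK : (∃ q ∈ {t | ∃ u v, w = u ++ v ∧ K u ∧ t = v.foldl f s}, F (f q a)) ↔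
          K (w ++ [a]) := by
        rw [K1]
        constructor
        · rintro ⟨_, ⟨u, v, rfl, hu, rfl⟩, hF⟩
          exact ⟨u, v, rfl, hu, (h _).2 (by simpa using hF)⟩
        · rintro ⟨u, v, rfl, hu, hv⟩
          exact ⟨_, ⟨u, v, rfl, hu, rfl⟩, by simpa using (h _).1 hv⟩
      rw [List.foldl_append, ih, List.foldl_cons, List.foldl_nil]
      ext t
      · simp only [step, hK]
        simp only [Set.mem_ofPred_eq]
        constructor
        · rintro (⟨q, ⟨u, v, rfl, hu, rfl⟩, rfl⟩ | ⟨hG, rfl⟩)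
          · exact ⟨u, v ++ [a], by simp, hu, by simp⟩
          · exact ⟨w ++ [a], [], by simp, hG, rfl⟩
        · rintro ⟨u, v, h, hu, rfl⟩
          rcases List.eq_nil_or_concat v with rfl | ⟨v, b, rfl⟩
          · right
            rw [List.append_nil] at h
            subst h
            exact ⟨hu, rfl⟩
          · left
            rw [List.concat_eq_append, ← List.append_assoc] at h
            obtain ⟨rfl, h⟩ := List.append_inj' h rfl
            obtain rfl : a = b := by simpa using h
            exact ⟨_, ⟨u, v, rfl, hu, rfl⟩, by simp⟩
      · simp only [step, hK]
  exact ⟨Set S × Prop, inferInstance, ({s}, True), step, fun p => p.2, fun w => by rw [key]⟩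

end closure

/-! ### Linear temporal logic on words -/

/-- The words whose first letter is `a` and whose tail belongs to `L`. -/
def ConsLang {α : Type*} (a : α) (L : List α → Prop) : List α → Prop
  | [] => False
  | b :: w => b = a ∧ L w

/-- The words with a suffix in `L` such that all longer suffixes belong to `K`. -/
def UntilLang {α : Type*} (K L : List α → Prop) : List α → Prop
  | [] => L []
  | a :: w => L (a :: w) ∨ (K (a :: w) ∧ UntilLang K L w)

/-- Languages definable in linear temporal logic. -/
inductive LTLang {α : Type*} : (List α → Prop) → Prop
  | empty : LTLang fun _ => False
  | not {L} : LTLang L → LTLang fun w => ¬ L w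
  | and {L K} : LTLang L → LTLang K → LTLang fun w => L w ∧ K w
  | cons (a : α) {L} : LTLang L → LTLang (ConsLang a L)
  | untl {K L} : LTLang K → LTLang L → LTLang (UntilLang K L)

theorem UntilLang.of_right {α : Type*} {K L : List α → Prop} {w : List α} (h : L w) :
    UntilLang K L w := by
  cases w
  exacts [h, Or.inl h]

theorem untilLang_iff {α : Type*} {K L : List α → Prop} {w : List α} :
    UntilLang K L w ↔ ∃ u v, w = u ++ v ∧ (∀ x y, u = x ++ y → y ≠ [] → K (y ++ v)) ∧ L v := by
  induction w with
  | nil =>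
    constructor
    · intro h
      exact ⟨[], [], rfl, fun x y hxy hy => absurd (List.nil_eq_append_iff.1 hxy).2 hy, h⟩
    · rintro ⟨u, v, h, -, hv⟩
      obtain ⟨rfl, rfl⟩ := List.nil_eq_append_iff.1 h
      exact hv
  | cons a w ih =>
    rw [UntilLang, ih]
    constructor
    · rintro (h | ⟨h, u, v, rfl, h1, h2⟩)
      · exact ⟨[], _, rfl, fun x y hxy hy => absurd (List.nil_eq_append_iff.1 hxy).2 hy, h⟩
      · refine ⟨a :: u, v, rfl, fun x y hxy hy => ?_, h2⟩
        rcases List.cons_eq_append_iff.1 hxy with ⟨rfl, rfl⟩ | ⟨z, rfl, rfl⟩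
        · exact h
        · exact h1 z y rfl hy
    · rintro ⟨u, v, h, h1, h2⟩
      rcases List.cons_eq_append_iff.1 h with ⟨rfl, rfl⟩ | ⟨z, rfl, rfl⟩
      · exact Or.inl h2
      · exact Or.inr ⟨h1 [] (a :: z) rfl (by simp), z, v, rfl,
          fun x y hxy hy => h1 (a :: x) y (by rw [hxy]; rfl) hy, h2⟩

/-- The condition on `K` concerns suffixes `y ++ v` that straddle the cut. `Cls.split` separates
them: guess a set `J` of indices with `V i v`, and require of `u` alone that each nonempty suffix
lies in some `U i` with `i ∈ J`. -/
theorem UntilLang.cls {α : Type*} {sf : Bool} {K L : List α → Prop} (hK : Cls sf K)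
    (hL : Cls sf L) : Cls sf (UntilLang K L) := by
  obtain ⟨ι, _, U, V, hU, hV, h⟩ := hK.split
  have h1 : ∀ J : Set ι, Cls sf fun u => ¬ ∃ x y, u = x ++ y ∧ True ∧
      (¬ y = [] ∧ ∀ i, i ∉ J ∨ ¬ U i y) := fun J =>
    ((Cls.const True).concat (Cls.nil.not.and
      (Cls.forall fun i => (Cls.const (i ∉ J)).or (hU i).not))).not
  have h2 : ∀ J : Set ι, Cls sf fun v => L v ∧ ∀ i, i ∉ J ∨ V i v := fun J =>
    hL.and (Cls.forall fun i => (Cls.const (i ∉ J)).or (hV i))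
  refine (Cls.exists fun J => (h1 J).concat (h2 J)).congr fun w => ?_
  rw [untilLang_iff]
  constructor
  · rintro ⟨u, v, rfl, hu, hv⟩
    refine ⟨{i | V i v}, u, v, rfl, ?_, hv, fun i => (em _).symm⟩
    rintro ⟨x, y, rfl, -, hy, hn⟩
    obtain ⟨i, hi, hi'⟩ := (h y v).1 (hu x y rfl hy)
    exact (hn i).elim (fun h => h hi') fun h => h hi
  · rintro ⟨J, u, v, rfl, hu, hv, hJ⟩
    refine ⟨u, v, rfl, fun x y hxy hy => ?_, hv⟩
    by_contra hn
    refine hu ⟨x, y, hxy, trivial, hy, fun i => ?_⟩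
    rcases hJ i with hi | hi
    · exact Or.inl hi
    · exact Or.inr fun hi' => hn ((h y v).2 ⟨i, hi', hi⟩)

theorem ConsLang.iff {α : Type*} {a : α} {L : List α → Prop} {w : List α} :
    ConsLang a L w ↔ ∃ x v, w = x :: v ∧ x = a ∧ L v := by
  cases w <;> simp [ConsLang]

namespace LTLang
variable {α : Type*}

theorem cls {sf : Bool} [Finite α] {L : List α → Prop} (hL : LTLang L) : Cls sf L := by
  induction hL with
  | empty => exact Cls.const False
  | not _ ih => exact ih.not
  | and _ _ ih ih' => exact ih.and ih'
  | cons a _ ih => exact (ih.cons (p := fun x => x = a)).congr fun w => ConsLang.iff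
  | untl _ _ ih ih' => exact UntilLang.cls ih ih'

theorem congr {L K : List α → Prop} (hL : LTLang L) (h : ∀ w, K w ↔ L w) : LTLang K := by
  have : K = L := funext fun w => propext (h w)
  rwa [this]

theorem or {L K : List α → Prop} (hL : LTLang L) (hK : LTLang K) : LTLang fun w => L w ∨ K w :=
  (hL.not.and hK.not).not.congr fun w => by tauto

theorem const (p : Prop) : LTLang fun _ : List α => p := by
  by_cases hp : p
  · exact empty.not.congr fun w => by simp [hp]
  · exact empty.congr fun w => by simp [hp]

theorem finExists {ι : Type*} [Finite ι] {L : ι → List α → Prop}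
    (hL : ∀ i, LTLang (L i)) : LTLang fun w => ∃ i, L i w := by
  have key : ∀ s : Finset ι, LTLang fun w => ∃ i ∈ s, L i w := by
    classical
    intro s
    induction s using Finset.induction_on with
    | empty => exact (const False).congr fun w => by simp
    | insert a s _ ih => exact ((hL a).or ih).congr fun w => by simp
  cases nonempty_fintype ι
  exact (key Finset.univ).congr fun w => by simp

theorem nil [Finite α] : LTLang fun w : List α => w = [] :=
  (LTLang.finExists fun a => cons a (const True)).not.congr fun w => by
    cases w <;> simp [ConsLang]

theorem mem (a : α) : LTLang fun w : List α => a ∈ w := by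
  refine ((const True).untl (cons a (const True))).congr fun w => ?_
  induction w with
  | nil => simp [UntilLang, ConsLang]
  | cons b w ih => simp [UntilLang, ConsLang, ← ih, eq_comm]

theorem all [Finite α] (p : α → Prop) : LTLang fun w : List α => ∀ a ∈ w, p a :=
  (LTLang.finExists fun a => (mem a).and (const (¬ p a))).not.congr fun w => by
    push Not; rfl

end LTLang

/-! ### Aperiodic monoids recognize the star-free languages -/

/-- Aperiodicity of a monoid, with a uniform exponent. -/
def Aperiodic (M : Type*) [Monoid M] : Prop := ∃ n, ∀ x : M, x ^ n = x ^ (n + 1)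

theorem pow_stable {M : Type*} [Monoid M] {x : M} {n k : ℕ} (h : x ^ n = x ^ (n + 1))
    (hk : n ≤ k) : x ^ k = x ^ (k + 1) := by
  obtain ⟨d, rfl⟩ := Nat.exists_eq_add_of_le hk
  rw [pow_add, h, ← pow_add]
  congr 1
  omega

/-- Recognizability by a finite aperiodic monoid. -/
def AperiodicRec {α : Type*} (L : List α → Prop) : Prop :=
  ∃ (M : Type) (_ : Monoid M) (_ : Finite M) (f : α → M) (P : M → Prop),
    Aperiodic M ∧ ∀ w, L w ↔ P (w.map f).prod

/-- The monoid `{1, x, 0}` with `x * x = 0`. -/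
inductive TruncTwo
  | one
  | gen
  | zero

instance : Finite TruncTwo :=
  Finite.of_surjective (fun n : Fin 3 => match n with | 0 => .one | 1 => .gen | 2 => .zero)
    (by intro x; cases x; exacts [⟨0, rfl⟩, ⟨1, rfl⟩, ⟨2, rfl⟩])

instance : Monoid TruncTwo where
  mul
    | .one, b => b
    | a, .one => a
    | _, _ => .zero
  one := .one
  mul_assoc a b c := by cases a <;> cases b <;> cases c <;> rfl
  one_mul a := by cases a <;> rfl
  mul_one a := by cases a <;> rfl

theorem aperiodic_truncTwo : Aperiodic TruncTwo :=
  ⟨2, fun x => by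
    rw [pow_succ _ 2, pow_two]
    cases x <;> rfl⟩

/-- The Schützenberger product of two monoids. -/
def Schutz (M N : Type) := M × Set (M × N) × N

namespace Schutz
variable {M N : Type} [Monoid M] [Monoid N]

instance [Finite M] [Finite N] : Finite (Schutz M N) :=
  inferInstanceAs (Finite (M × Set (M × N) × N))

instance : Monoid (Schutz M N) where
  mul p q := (p.1 * q.1,
    {z | (∃ y ∈ q.2.1, z = (p.1 * y.1, y.2)) ∨ ∃ y ∈ p.2.1, z = (y.1, y.2 * q.2.2)},
    p.2.2 * q.2.2)
  one := (1, ∅, 1)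
  mul_assoc p q r := by
    refine Prod.ext (mul_assoc p.1 q.1 r.1) (Prod.ext (Set.ext fun z => ?_)
      (mul_assoc p.2.2 q.2.2 r.2.2))
    change (_ ∨ _) ↔ (_ ∨ _)
    constructor
    · rintro (⟨y, hy, rfl⟩ | ⟨y, ⟨x, hx, rfl⟩ | ⟨x, hx, rfl⟩, rfl⟩)
      · exact Or.inl ⟨_, Or.inl ⟨y, hy, rfl⟩, Prod.ext (mul_assoc ..) rfl⟩
      · exact Or.inl ⟨_, Or.inr ⟨x, hx, rfl⟩, rfl⟩
      · exact Or.inr ⟨x, hx, Prod.ext rfl (mul_assoc ..)⟩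
    · rintro (⟨y, ⟨x, hx, rfl⟩ | ⟨x, hx, rfl⟩, rfl⟩ | ⟨y, hy, rfl⟩)
      · exact Or.inl ⟨x, hx, Prod.ext (mul_assoc ..).symm rfl⟩
      · exact Or.inr ⟨_, Or.inl ⟨x, hx, rfl⟩, rfl⟩
      · exact Or.inr ⟨_, Or.inr ⟨y, hy, rfl⟩, Prod.ext rfl (mul_assoc ..).symm⟩
  one_mul p := by
    refine Prod.ext (one_mul p.1) (Prod.ext (Set.ext fun z => ?_) (one_mul p.2.2))
    change (_ ∨ _) ↔ _
    constructor
    · rintro (⟨y, hy, rfl⟩ | ⟨y, hy, -⟩)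
      · have : ((1 : M) * y.1, y.2) = y := by rw [one_mul]
        exact this.symm ▸ hy
      · exact hy.elim
    · intro hz
      exact Or.inl ⟨z, hz, Prod.ext (one_mul _).symm rfl⟩
  mul_one p := by
    refine Prod.ext (mul_one p.1) (Prod.ext (Set.ext fun z => ?_) (mul_one p.2.2))
    change (_ ∨ _) ↔ _
    constructor
    · rintro (⟨y, hy, -⟩ | ⟨y, hy, rfl⟩)
      · exact hy.elim
      · have : (y.1, y.2 * (1 : N)) = y := by rw [mul_one]
        exact this.symm ▸ hy
    · intro hz
      exact Or.inr ⟨z, hz, Prod.ext rfl (mul_one _).symm⟩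

theorem fst_mul (p q : Schutz M N) : (p * q).1 = p.1 * q.1 := rfl

theorem snd_mul (p q : Schutz M N) : (p * q).2.2 = p.2.2 * q.2.2 := rfl

theorem mem_mul (p q : Schutz M N) (z : M × N) : z ∈ (p * q).2.1 ↔
    (∃ y ∈ q.2.1, z = (p.1 * y.1, y.2)) ∨ ∃ y ∈ p.2.1, z = (y.1, y.2 * q.2.2) := Iff.rfl

theorem fst_pow (p : Schutz M N) (n : ℕ) : (p ^ n).1 = p.1 ^ n := by
  induction n with
  | zero => rw [pow_zero, pow_zero]; rfl
  | succ n ih => rw [pow_succ, pow_succ, fst_mul, ih]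

theorem snd_pow (p : Schutz M N) (n : ℕ) : (p ^ n).2.2 = p.2.2 ^ n := by
  induction n with
  | zero => rw [pow_zero, pow_zero]; rfl
  | succ n ih => rw [pow_succ, pow_succ, snd_mul, ih]

theorem mem_pow (p : Schutz M N) (n : ℕ) (z : M × N) : z ∈ (p ^ n).2.1 ↔
    ∃ y ∈ p.2.1, ∃ i j, i + j + 1 = n ∧ z = (p.1 ^ i * y.1, y.2 * p.2.2 ^ j) := by
  induction n generalizing z with
  | zero =>
    rw [pow_zero]
    constructor
    · exact fun h => h.elim
    · rintro ⟨_, _, i, j, h, -⟩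
      omega
  | succ n ih =>
    rw [pow_succ, mem_mul, fst_pow]
    constructor
    · rintro (⟨y, hy, rfl⟩ | ⟨x, hx, rfl⟩)
      · exact ⟨y, hy, n, 0, rfl, by simp⟩
      · obtain ⟨y, hy, i, j, rfl, rfl⟩ := (ih x).1 hx
        exact ⟨y, hy, i, j + 1, by omega, by simp [pow_succ, mul_assoc]⟩
    · rintro ⟨y, hy, i, j, h, rfl⟩
      rcases j with _ | j
      · obtain rfl : i = n := by omega
        exact Or.inl ⟨y, hy, by simp⟩
      · exact Or.inr ⟨_, (ih _).2 ⟨y, hy, i, j, by omega, rfl⟩, by simp [pow_succ, mul_assoc]⟩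

/-- By `mem_pow`, the middle component of a power consists of the pairs `(p.1 ^ i * y.1, y.2 * p.2.2
^ j)` with `i + j` fixed. If the sum is large, one of the exponents is in the stable range and can
be changed by one. -/
theorem aperiodic (hM : Aperiodic M) (hN : Aperiodic N) : Aperiodic (Schutz M N) := by
  obtain ⟨m, hm⟩ := hM
  obtain ⟨n, hn⟩ := hN
  -- The exponents then satisfy `i + j = m + n`, so `m ≤ i` or `n ≤ j`.
  refine ⟨m + n + 1, fun p => ?_⟩
  refine Prod.ext ?_ (Prod.ext (Set.ext fun z => ?_) ?_)
  · rw [fst_pow, fst_pow]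
    exact pow_stable (hm _) (by omega)
  · rw [mem_pow, mem_pow]
    constructor
    · rintro ⟨y, hy, i, j, h, rfl⟩
      by_cases hi : m ≤ i
      · exact ⟨y, hy, i + 1, j, by omega, by rw [← pow_stable (hm _) hi]⟩
      · exact ⟨y, hy, i, j + 1, by omega, by rw [← pow_stable (hn _) (by omega : n ≤ j)]⟩
    · rintro ⟨y, hy, i, j, h, rfl⟩
      by_cases hi : m + 1 ≤ i
      · obtain ⟨i, rfl⟩ : ∃ i', i = i' + 1 := ⟨i - 1, by omega⟩
        exact ⟨y, hy, i, j, by omega, by rw [← pow_stable (hm _) (by omega : m ≤ i)]⟩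
      · obtain ⟨j, rfl⟩ : ∃ j', j = j' + 1 := ⟨j - 1, by omega⟩
        exact ⟨y, hy, i, j, by omega, by rw [← pow_stable (hn _) (by omega : n ≤ j)]⟩
  · rw [snd_pow, snd_pow]
    exact pow_stable (hn _) (by omega)

/-- The generators of the Schützenberger product. -/
def of {α : Type*} (f : α → M) (g : α → N) (a : α) : Schutz M N := (f a, {(1, g a)}, g a)

/-- A generator places the cut in front of its letter, so the middle component lists the values of
all cuts except the one at the end of the word. -/
theorem prod_map {α : Type*} (f : α → M) (g : α → N) (w : List α) :
    (w.map (of f g)).prod = (show Schutz M N from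
      ((w.map f).prod, {z | ∃ u v, w = u ++ v ∧ v ≠ [] ∧ z = ((u.map f).prod, (v.map g).prod)},
        (w.map g).prod)) := by
  induction w with
  | nil =>
    refine Prod.ext rfl (Prod.ext (Set.ext fun z => ?_) rfl)
    change False ↔ _
    rw [false_iff]
    rintro ⟨u, v, h, hv, -⟩
    exact hv (List.nil_eq_append_iff.1 h).2
  | cons a w ih =>
    rw [List.map_cons, List.prod_cons, ih]
    refine Prod.ext (by rw [fst_mul, List.map_cons, List.prod_cons]; rfl)
      (Prod.ext (Set.ext fun z => ?_) (by rw [snd_mul, List.map_cons, List.prod_cons]; rfl))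
    rw [mem_mul]
    constructor
    · rintro (⟨_, ⟨u, v, rfl, hv, rfl⟩, rfl⟩ | ⟨y, rfl, rfl⟩)
      · exact ⟨a :: u, v, rfl, hv, by simp [of]⟩
      · exact ⟨[], a :: w, rfl, by simp, by simp⟩
    · rintro ⟨u, v, h, hv, rfl⟩
      rcases List.cons_eq_append_iff.1 h with ⟨rfl, rfl⟩ | ⟨z, rfl, rfl⟩
      · exact Or.inr ⟨_, rfl, by simp⟩
      · exact Or.inl ⟨_, ⟨z, v, rfl, hv, rfl⟩, by simp [of]⟩

end Schutz

/-- The easier half of Schützenberger's theorem: union uses the direct product, complement the same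
monoid, and concatenation the Schützenberger product. -/
theorem StarFreeExp.aperiodicRec {α : Type*} (e : StarFreeExp α) :
    AperiodicRec fun w => w ∈ e.lang := by
  classical
  induction e with
  | empty =>
    exact ⟨TruncTwo, inferInstance, inferInstance, fun _ => 1, fun _ => False,
      aperiodic_truncTwo, fun w => Iff.rfl⟩
  | eps =>
    refine ⟨TruncTwo, inferInstance, inferInstance, fun _ => .zero, fun x => x = 1,
      aperiodic_truncTwo, fun w => ?_⟩
    beta_reduce
    rw [StarFreeExp.mem_eps]
    cases w with
    | nil => simp
    | cons a w =>
      have : ∀ x : TruncTwo, ¬ .zero * x = 1 := by intro x; cases x <;> exact nofun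
      simpa using this _
  | letter a =>
    refine ⟨TruncTwo, inferInstance, inferInstance,
      fun b => if b = a then .gen else .zero, fun x => x = .gen,
      aperiodic_truncTwo, fun w => ?_⟩
    beta_reduce
    rw [StarFreeExp.mem_letter]
    have h2 : ∀ x : TruncTwo, ¬ .zero * x = .gen := by intro x; cases x <;> exact nofun
    have h1 : ∀ x : TruncTwo, .gen * x = .gen → x = .one := by
      intro x
      cases x
      exacts [fun _ => rfl, nofun, nofun]
    have h0 : ∀ y : TruncTwo, ¬ .gen * y = .one ∧ ¬ .zero * y = .one := by
      intro y; cases y <;> exact ⟨nofun, nofun⟩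
    cases w with
    | nil => simp [show (1 : TruncTwo) = .one from rfl]
    | cons b w =>
      rw [List.map_cons, List.prod_cons]
      by_cases hb : b = a
      · rw [if_pos hb]
        cases w with
        | nil => simp [hb]
        | cons b' w =>
          rw [List.map_cons, List.prod_cons]
          constructor
          · simp
          · intro h
            have := h1 _ h
            split_ifs at this
            exacts [absurd this (h0 _).1, absurd this (h0 _).2]
      · rw [if_neg hb]
        simpa [hb] using h2 _
  | plus e f he hf =>
    obtain ⟨M, _, _, g, P, ⟨m, hm⟩, h⟩ := he
    obtain ⟨M', _, _, g', P', ⟨m', hm'⟩, h'⟩ := hf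
    refine ⟨M × M', inferInstance, inferInstance, fun a => (g a, g' a), fun x => P x.1 ∨ P' x.2,
      ⟨m + m', fun x => Prod.ext (pow_stable (hm _) (by omega))
        (pow_stable (hm' _) (by omega))⟩, fun w => ?_⟩
    beta_reduce at *
    rw [StarFreeExp.mem_plus, h, h']
    have : (w.map fun a => (g a, g' a)).prod = ((w.map g).prod, (w.map g').prod) := by
      induction w with
      | nil => rfl
      | cons a w ih => simp [ih]
    rw [this]
  | compl e he =>
    obtain ⟨M, _, _, g, P, hM, h⟩ := he
    exact ⟨M, inferInstance, inferInstance, g, fun x => ¬ P x, hM, fun w => not_congr (h w)⟩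
  | comp e f he hf =>
    obtain ⟨M, _, _, g, P, hM, h⟩ := he
    obtain ⟨M', _, _, g', P', hM', h'⟩ := hf
    refine ⟨Schutz M M', inferInstance, inferInstance, Schutz.of g g',
      -- The first disjunct is the cut at the end of the word, which the middle component omits.
      fun x => (P x.1 ∧ P' 1) ∨ ∃ y ∈ x.2.1, P y.1 ∧ P' y.2, Schutz.aperiodic hM hM', fun w => ?_⟩
    beta_reduce at *
    rw [StarFreeExp.mem_comp, Schutz.prod_map]
    constructor
    · rintro ⟨u, v, rfl, hu, hv⟩
      rcases eq_or_ne v [] with rfl | hne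
      · left
        rw [List.append_nil]
        exact ⟨(h u).1 hu, by simpa using (h' []).1 hv⟩
      · exact Or.inr ⟨_, ⟨u, v, rfl, hne, rfl⟩, (h u).1 hu, (h' v).1 hv⟩
    · rintro (⟨h1, h2⟩ | ⟨_, ⟨u, v, rfl, hne, rfl⟩, h1, h2⟩)
      · exact ⟨w, [], by simp, (h w).2 h1, (h' []).2 (by simpa using h2)⟩
      · exact ⟨u, v, rfl, (h u).2 h1, (h' v).2 h2⟩

/-! ### Languages recognized by aperiodic monoids are definable in temporal logic -/

/-- The local divisor `cM ∩ Mc` of a monoid `M` at `c`. -/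
def LocDiv (M : Type) [Monoid M] (c : M) := {x : M // (∃ a, x = c * a) ∧ ∃ b, x = b * c}

namespace LocDiv
variable {M : Type} [Monoid M] {c : M}

instance [Finite M] : Finite (LocDiv M c) :=
  inferInstanceAs (Finite {x : M // (∃ a, x = c * a) ∧ ∃ b, x = b * c})

noncomputable instance : Mul (LocDiv M c) where
  mul x y := ⟨x.2.2.choose * y.1, by
    obtain ⟨⟨a, ha⟩, b, hb⟩ := y.2
    have hx := x.2.2.choose_spec
    obtain ⟨a', ha'⟩ := x.2.1
    refine ⟨⟨a' * a, ?_⟩, x.2.2.choose * b, by rw [mul_assoc, ← hb]⟩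
    rw [ha, ← mul_assoc, ← hx, ha', mul_assoc]⟩

/-- The product does not depend on the chosen `b`: writing `y = c * a` gives `b * y = b * c * a = x
* a`. -/
theorem val_mul {x y : LocDiv M c} {b : M} (hb : x.1 = b * c) : (x * y).1 = b * y.1 := by
  obtain ⟨a, ha⟩ := y.2.1
  change x.2.2.choose * y.1 = _
  rw [ha, ← mul_assoc, ← x.2.2.choose_spec, hb, mul_assoc]

noncomputable instance : Monoid (LocDiv M c) where
  one := ⟨c, ⟨1, by simp⟩, 1, by simp⟩
  mul_assoc x y z := by
    obtain ⟨b, hb⟩ := x.2.2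
    obtain ⟨b', hb'⟩ := y.2.2
    apply Subtype.ext
    rw [val_mul (x := x * y) (b := b * b') (by rw [val_mul hb, hb', mul_assoc]), val_mul hb,
      val_mul hb', mul_assoc]
  one_mul x := Subtype.ext (by rw [val_mul (b := 1) (one_mul c).symm, one_mul])
  mul_one x := by
    obtain ⟨b, hb⟩ := x.2.2
    apply Subtype.ext
    rw [val_mul hb, hb]
    rfl

theorem val_one : (1 : LocDiv M c).1 = c := rfl

theorem val_pow {x : LocDiv M c} {b : M} (hb : x.1 = b * c) (n : ℕ) :
    (x ^ n).1 = b ^ n * c := by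
  induction n with
  | zero => rw [pow_zero, pow_zero, one_mul, val_one]
  | succ n ih => rw [pow_succ', val_mul hb, ih, pow_succ', mul_assoc]

theorem aperiodic (hM : Aperiodic M) : Aperiodic (LocDiv M c) := by
  obtain ⟨n, hn⟩ := hM
  refine ⟨n, fun x => ?_⟩
  obtain ⟨b, hb⟩ := x.2.2
  apply Subtype.ext
  rw [val_pow hb, val_pow hb, hn]

/-- The unit is not in the local divisor: `1 = c * a` gives `c ^ k * a ^ k = 1` for all `k`, and
cancelling in `c ^ n = c ^ (n + 1)` yields `c = 1`. -/
theorem card_lt [Finite M] (hM : Aperiodic M) (hc : c ≠ 1) : Nat.card (LocDiv M c) < Nat.card M := by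
  refine Set.ncard_lt_card (s := {x : M | (∃ a, x = c * a) ∧ ∃ b, x = b * c}) fun h => ?_
  obtain ⟨⟨a, ha⟩, -⟩ : (1 : M) ∈ {x : M | (∃ a, x = c * a) ∧ ∃ b, x = b * c} := h ▸ trivial
  obtain ⟨n, hn⟩ := hM
  have h1 : ∀ k : ℕ, c ^ k * a ^ k = 1 := by
    intro k
    induction k with
    | zero => simp
    | succ k ih => rw [pow_succ, pow_succ', mul_assoc, ← mul_assoc c, ← ha, one_mul, ih]
  apply hc
  have := h1 n
  rwa [hn, pow_succ', mul_assoc, h1 n, mul_one] at this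

end LocDiv

-- Factorization of words at the occurrences of a letter

section factorization
variable {α : Type} {M : Type} [Monoid M]

open Classical in
/-- The part of a word before the first occurrence of `c`. -/
noncomputable def prefixBefore (c : α) : List α → List α
  | [] => []
  | a :: w => if a = c then [] else a :: prefixBefore c w

open Classical in
/-- The values of the blocks between the occurrences of `c`; the last block is flagged. -/
noncomputable def blockCode (f : α → M) (c : α) : List α → List (M × Bool)
  | [] => []
  | a :: w => if a = c then (((prefixBefore c w).map f).prod, decide (c ∉ w)) :: blockCode f c w
      else blockCode f c w

/-- Relativization of a temporal formula to the part before the first `c`: an until may not step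
over a `c`. -/
theorem LTLang.prefixBefore (c : α) {X : List α → Prop} (hX : LTLang X) :
    LTLang fun w => c ∈ w ∧ X (prefixBefore c w) := by
  induction hX with
  | empty => exact LTLang.empty.congr fun w => by simp
  | not _ ih => exact ((LTLang.mem c).and ih.not).congr fun w => by tauto
  | and _ _ ih ih' => exact (ih.and ih').congr fun w => by tauto
  | @cons a L _ ih =>
    by_cases hac : a = c
    · refine LTLang.empty.congr fun w => ?_
      rw [iff_false, not_and]
      intro _
      subst hac
      cases w with
      | nil => simp [_root_.prefixBefore, ConsLang]
      | cons b w => by_cases hb : b = a <;> simp [_root_.prefixBefore, ConsLang, hb]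
    · refine (ih.cons a).congr fun w => ?_
      cases w with
      | nil => simp [_root_.prefixBefore, ConsLang]
      | cons b w =>
        by_cases hb : b = c
        · subst hb
          simp [_root_.prefixBefore, ConsLang, Ne.symm hac]
        · simp only [_root_.prefixBefore, ConsLang, hb, if_false, List.mem_cons, Ne.symm hb,
            false_or]
          tauto
  | @untl K L _ _ ihK ihL =>
    refine ((ihK.and (LTLang.cons c (.const True)).not).untl ihL).congr fun w => ?_
    induction w with
    | nil => simp [UntilLang]
    | cons b w ih =>
      by_cases hb : b = c
      · subst hb
        simp [_root_.prefixBefore, ConsLang, UntilLang]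
      · rw [UntilLang, ← ih]
        simp only [_root_.prefixBefore, hb, if_false, List.mem_cons, Ne.symm hb, false_or,
          UntilLang, ConsLang, not_false_eq_true, and_true]
        tauto

theorem prefixBefore_subset (c : α) (w : List α) : ∀ a ∈ prefixBefore c w, a ∈ w ∧ a ≠ c := by
  induction w with
  | nil => simp [prefixBefore]
  | cons b w ih =>
    intro a ha
    by_cases hb : b = c
    · simp [prefixBefore, hb] at ha
    · simp only [prefixBefore, hb, if_false, List.mem_cons] at ha
      rcases ha with rfl | ha
      · exact ⟨by simp, hb⟩
      · exact ⟨by simp [(ih a ha).1], (ih a ha).2⟩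

theorem prefixBefore_eq_self {c : α} {w : List α} (h : c ∉ w) : prefixBefore c w = w := by
  induction w with
  | nil => rfl
  | cons b w ih =>
    simp only [List.mem_cons, not_or] at h
    rw [prefixBefore, if_neg (Ne.symm h.1), ih h.2]

/-- A formula on block codes is translated to words: suffixes of the code correspond to suffixes of
the word that begin with `c`. The value of a block is tested on the prefix up to the next `c`, or on
the entire tail if the flag says that no `c` follows. -/
theorem LTLang.blockCode [Finite α] [Finite M] (f : α → M) (c : α) (B : α → Prop)
    (hP : ∀ m, LTLang fun w : List α => (∀ a ∈ w, B a ∧ a ≠ c) ∧ (w.map f).prod = m)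
    {K : List (M × Bool) → Prop} (hK : LTLang K) :
    LTLang fun w => (∀ a ∈ w, B a) ∧ K (blockCode f c w) := by
  have hB : LTLang fun w : List α => ∀ a ∈ w, B a := .all B
  have hN : LTLang fun w : List α => ¬ ConsLang c (fun _ => True) w := (cons c (.const True)).not
  induction hK with
  | empty => exact LTLang.empty.congr fun w => by simp
  | not _ ih => exact (hB.and ih.not).congr fun w => by tauto
  | and _ _ ih ih' => exact (ih.and ih').congr fun w => by tauto
  | @cons l K _ ih =>
    obtain ⟨t, b⟩ := l
    have hE : LTLang fun v => (if b then (∀ a ∈ v, B a ∧ a ≠ c) ∧ (v.map f).prod = t else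
        c ∈ v ∧ (∀ a ∈ _root_.prefixBefore c v, B a ∧ a ≠ c) ∧
          ((_root_.prefixBefore c v).map f).prod = t) := by
      cases b
      · simpa using (hP t).prefixBefore c
      · simpa using hP t
    -- The until moves to the first `c`, where the first letter of the code is produced.
    refine (hB.and (hN.untl ((hE.and ih).cons c))).congr fun w => ?_
    refine and_congr_right fun hw => ?_
    induction w with
    | nil => simp [_root_.blockCode, ConsLang, UntilLang]
    | cons a w ihw =>
      have hw' : ∀ a ∈ w, B a := fun x hx => hw x (by simp [hx])
      by_cases ha : a = c
      · simp only [_root_.blockCode, ha, if_true, ConsLang, UntilLang, true_and, not_true,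
          false_and, or_false]
        rw [and_iff_right hw']
        refine and_congr_left fun _ => ?_
        rw [Prod.mk.injEq]
        by_cases hc : c ∈ w
        · have h1 : ∀ a ∈ _root_.prefixBefore c w, B a ∧ a ≠ c := fun a ha =>
            ⟨hw' a (prefixBefore_subset c w a ha).1, (prefixBefore_subset c w a ha).2⟩
          cases b
          · simp only [hc, not_true, decide_false, and_true, true_and]
            simp only [Bool.false_eq_true, if_false]
            rw [and_iff_right h1]
          · simp only [hc, not_true, decide_false, Bool.false_eq_true, and_false, if_true,
              false_iff]
            exact fun h => (h.1 c hc).2 rfl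
        · rw [prefixBefore_eq_self hc]
          cases b
          · simp [hc]
          · simp only [hc, not_false_eq_true, decide_true, and_true, if_true]
            exact (and_iff_right fun a ha => ⟨hw' a ha, fun h => hc (h ▸ ha)⟩).symm
      · simp only [_root_.blockCode, ha, if_false, ConsLang, UntilLang, false_and,
          not_false_eq_true, true_and, false_or]
        exact ihw hw'
  | @untl K L _ _ ihK ihL =>
    -- Only suffixes that begin with `c` are positions of the code, so `K` is not required
    -- elsewhere.
    refine (hB.and ((hN.or ihK).untl ihL)).congr fun w => ?_
    refine and_congr_right fun hw => ?_
    induction w with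
    | nil => simp [_root_.blockCode, UntilLang]
    | cons a w ihw =>
      have hw' : ∀ a ∈ w, B a := fun x hx => hw x (by simp [hx])
      rw [UntilLang, ← ihw hw']
      by_cases ha : a = c
      · simp only [_root_.blockCode, ha, if_true, ConsLang, UntilLang]
        subst ha
        tauto
      · simp only [_root_.blockCode, ha, if_false, ConsLang, false_and,
          not_false_eq_true, true_or, true_and]
        constructor
        · exact Or.inr
        · rintro (⟨-, h⟩ | h)
          exacts [UntilLang.of_right h, h]

/-- The product `c t₁ c t₂ ⋯ c tₙ`. -/
def interleave (c : M) : List (M × Bool) → M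
  | [] => 1
  | p :: τ => c * p.1 * interleave c τ

theorem prod_eq_interleave (f : α → M) (c : α) (w : List α) : (w.map f).prod =
    ((prefixBefore c w).map f).prod * interleave (f c) (blockCode f c w) := by
  induction w with
  | nil => simp [prefixBefore, blockCode, interleave]
  | cons a w ih =>
    by_cases ha : a = c
    · simp [prefixBefore, blockCode, interleave, ha, ih, mul_assoc]
    · simp [prefixBefore, blockCode, ha, ih, mul_assoc]

open Classical in
/-- The value in the local divisor of a letter of a block code. -/
noncomputable def locVal (c : M) (p : M × Bool) : LocDiv M c :=
  if p.2 then 1 else ⟨c * p.1 * c, ⟨p.1 * c, mul_assoc ..⟩, c * p.1, rfl⟩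

theorem blockCode_eq_nil {f : α → M} {c : α} {w : List α} (h : c ∉ w) : blockCode f c w = [] := by
  induction w with
  | nil => rfl
  | cons b w ih =>
    simp only [List.mem_cons, not_or] at h
    rw [blockCode, if_neg (Ne.symm h.1), ih h.2]

/-- With `∘` the product of the local divisor, `c t₁ c t₂ ⋯ c tₙ = (c t₁ c ∘ ⋯ ∘ c tₙ₋₁ c) tₙ`. No
`c` follows the last block, so it contributes the unit `c` to the local product and its value is
multiplied separately; the flag makes this value recoverable. -/
theorem blockCode_spec (f : α → M) (c : α) (w : List α) (h : c ∈ w) :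
    ∃ t, (∀ s, (s, true) ∈ blockCode f c w ↔ s = t) ∧
      interleave (f c) (blockCode f c w) = ((blockCode f c w).map (locVal (f c))).prod.1 * t := by
  induction w with
  | nil => simp at h
  | cons a w ih =>
    by_cases hw : c ∈ w
    · obtain ⟨t, h1, h2⟩ := ih hw
      refine ⟨t, ?_⟩
      by_cases ha : a = c
      · constructor
        · simpa [blockCode, ha, hw] using h1
        · simp only [blockCode, ha, if_true, interleave, h2, List.map_cons, List.prod_cons]
          rw [LocDiv.val_mul (b := f c * ((prefixBefore c w).map f).prod) (by simp [locVal, hw])]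
          simp only [mul_assoc]
      · simpa [blockCode, ha] using ⟨h1, h2⟩
    · obtain rfl : c = a := by simpa [hw] using h
      refine ⟨((prefixBefore c w).map f).prod, ?_, ?_⟩
      · simp [blockCode, blockCode_eq_nil hw, hw]
      · simp only [blockCode, if_true, blockCode_eq_nil hw, interleave, List.map_cons,
          List.map_nil, List.prod_cons, List.prod_nil, mul_one]
        simp [locVal, hw, LocDiv.val_one]

end factorization

/-- Induction on the size of the monoid and then on the alphabet `B`. Choose `c ∈ B` with value
different from `1` and cut the word at all `c`. The pieces use the smaller alphabet without `c`; the
word of pieces is evaluated in the local divisor at `c`, which is a smaller aperiodic monoid, over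
the alphabet `M × Bool`. -/
theorem ltLang_of_aperiodic (n : ℕ) : ∀ (M : Type) [Monoid M] [Finite M], Nat.card M = n →
    Aperiodic M → ∀ (α : Type) [Finite α] (f : α → M) (B : Finset α) (m : M),
      LTLang fun w : List α => (∀ a ∈ w, a ∈ B) ∧ (w.map f).prod = m := by
  classical
  induction n using Nat.strong_induction_on with
  | _ n ihn =>
  intro M _ _ hn hM α _ f B
  induction B using Finset.strongInduction with
  | H B ihB =>
  intro m
  by_cases hB : ∀ a ∈ B, f a = 1
  · refine ((LTLang.all fun a => a ∈ B).and (.const (1 = m))).congr fun w =>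
      and_congr_right fun hw => ?_
    rw [List.prod_eq_one]
    simpa using fun a ha => hB a (hw a ha)
  push Not at hB
  obtain ⟨c, hcB, hc⟩ := hB
  have hP : ∀ m, LTLang fun w : List α => (∀ a ∈ w, a ∈ B ∧ a ≠ c) ∧ (w.map f).prod = m :=
    fun m => (ihB (B.erase c) (Finset.erase_ssubset hcB) m).congr fun w => by
      simp only [Finset.mem_erase, and_comm]
  have hR : ∀ x : LocDiv M (f c), LTLang fun τ : List (M × Bool) =>
      (τ.map (locVal (f c))).prod = x := fun x => by
    cases nonempty_fintype (M × Bool)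
    exact (ihn _ (hn ▸ LocDiv.card_lt hM hc) (LocDiv M (f c)) rfl (LocDiv.aperiodic hM) (M × Bool)
      (locVal (f c)) Finset.univ x).congr fun w => by simp
  have hT : ∀ (x : LocDiv M (f c)) (t : M), LTLang fun w => (∀ a ∈ w, a ∈ B) ∧
      (((blockCode f c w).map (locVal (f c))).prod = x ∧ (t, true) ∈ blockCode f c w) :=
    fun x t => LTLang.blockCode f c (fun a => a ∈ B) hP ((hR x).and (.mem (t, true)))
  have hS : LTLang fun w => ∃ p : {p : M × LocDiv M (f c) × M // p.1 * (p.2.1.1 * p.2.2) = m},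
      (c ∈ w ∧ (∀ a ∈ prefixBefore c w, a ∈ B ∧ a ≠ c) ∧
        ((prefixBefore c w).map f).prod = p.1.1) ∧ ((∀ a ∈ w, a ∈ B) ∧
      (((blockCode f c w).map (locVal (f c))).prod = p.1.2.1 ∧
        (p.1.2.2, true) ∈ blockCode f c w)) :=
    LTLang.finExists fun p => ((hP p.1.1).prefixBefore c).and (hT p.1.2.1 p.1.2.2)
  refine ((hP m).or hS).congr fun w => ?_
  by_cases hw : c ∈ w
  · obtain ⟨t, h1, h2⟩ := blockCode_spec f c w hw
    have h3 := prod_eq_interleave f c w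
    rw [h2] at h3
    constructor
    · rintro ⟨h4, h5⟩
      exact Or.inr ⟨⟨(_, _, t), h3 ▸ h5⟩, ⟨hw, fun a ha => ⟨h4 a (prefixBefore_subset c w a ha).1,
        (prefixBefore_subset c w a ha).2⟩, rfl⟩, h4, rfl, (h1 t).2 rfl⟩
    · rintro (⟨h4, -⟩ | ⟨⟨⟨p, x, s⟩, hp⟩, ⟨-, -, h4⟩, h5, h6, h7⟩)
      · exact absurd rfl (h4 c hw).2
      · refine ⟨h5, ?_⟩
        dsimp only at h4 h6 h7 hp
        rw [h3, h4, h6, ← (h1 s).1 h7, hp]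
  · constructor
    · rintro ⟨h1, h2⟩
      exact Or.inl ⟨fun a ha => ⟨h1 a ha, fun h => hw (h ▸ ha)⟩, h2⟩
    · rintro (⟨h1, h2⟩ | ⟨_, ⟨h, -⟩, -⟩)
      · exact ⟨fun a ha => (h1 a ha).1, h2⟩
      · exact absurd h hw

theorem Cls.ltLang {α : Type} [Finite α] {L : List α → Prop} (hL : Cls true L) : LTLang L := by
  obtain ⟨e, he⟩ := hL
  obtain ⟨M, _, _, f, P, hM, h⟩ := e.aperiodicRec
  cases nonempty_fintype α
  refine (LTLang.finExists fun m : {m // P m} =>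
    ltLang_of_aperiodic _ M rfl hM α f Finset.univ m.1).congr fun w => ?_
  rw [← he]
  exact (h w).trans (by simp)

/-! ### Boolean automata -/

theorem LTLang.boolFun {α ι : Type*} [Finite ι] {L : ι → List α → Prop}
    (hL : ∀ i, LTLang (L i)) (G : Set ι → Prop) : LTLang fun w => G {i | L i w} := by
  have h1 : ∀ (Y : Set ι) (i : ι), LTLang fun w => (i ∈ Y ∧ ¬ L i w) ∨ (i ∉ Y ∧ L i w) :=
    fun Y i => ((const (i ∈ Y)).and (hL i).not).or ((const (i ∉ Y)).and (hL i))
  refine (finExists fun Y : Set ι => (const (G Y)).and (finExists (h1 Y)).not).congr fun w => ?_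
  constructor
  · intro h
    refine ⟨_, h, ?_⟩
    rintro ⟨i, hi⟩
    simp at hi
  · rintro ⟨Y, hY, h⟩
    have : {i | L i w} = Y := Set.ext fun i => by
      by_contra hn
      refine h ⟨i, ?_⟩
      simp only [Set.mem_ofPred_eq] at hn
      tauto
    rwa [this]

/-- Alternating automata on words whose transitions are monotone boolean functions. If `sf` is
`true`, they are partially ordered: a transition from `s` depends only on `s` itself and on the
states of smaller rank. -/
structure BAut (σ : Type) (sf : Bool) where
  Q : Type
  finite_Q : Finite Q
  δ : Q → σ → Set Q → Prop
  F : Set Q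
  rank : Q → ℕ
  mono : ∀ {s x Y Z}, (∀ t ∈ Y, (sf = true → t = s ∨ rank t < rank s) → t ∈ Z) →
    δ s x Y → δ s x Z

namespace BAut
variable {σ : Type} {sf : Bool}

/-- Acceptance of a word from a state. -/
def acc (A : BAut σ sf) : A.Q → List σ → Prop
  | s, [] => s ∈ A.F
  | s, x :: w => A.δ s x {t | A.acc t w}

/-- Acceptance is computed from the end of the word. To read forwards, a state is a family of sets
of states, and each letter pulls it back along `V ↦ {t | A.δ t x V}`. -/
theorem acc_reg (A : BAut σ sf) (s : A.Q) : Cls false (A.acc s) := by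
  have := A.finite_Q
  refine ⟨Set (Set A.Q), inferInstance, {V | s ∈ V},
    fun T x => {V | {t | A.δ t x V} ∈ T}, fun T => A.F ∈ T, fun w => ?_⟩
  have key : ∀ T : Set (Set A.Q), A.F ∈ w.foldl (fun T x => {V | {t | A.δ t x V} ∈ T}) T ↔
      {t | A.acc t w} ∈ T := by
    induction w with
    | nil => intro T; rfl
    | cons x w ih => intro T; rw [List.foldl_cons, ih]; rfl
  beta_reduce
  rw [key]
  rfl

/-- By induction on the rank, the states below `s` are definable. Let `α` say that the next
transition succeeds with these states alone and `β` that it succeeds if `s` is added. By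
monotonicity, acceptance from `s` is `α`, or `β` and acceptance from `s` one letter later, that is,
`β` until `α` or a final end. -/
theorem acc_ltLang [Finite σ] (A : BAut σ true) (s : A.Q) : LTLang (A.acc s) := by
  have := A.finite_Q
  induction hn : A.rank s using Nat.strong_induction_on generalizing s with
  | _ n ih =>
  subst hn
  have hlow : ∀ G : Set A.Q → Prop, LTLang fun w => G {t | A.rank t < A.rank s ∧ A.acc t w} :=
    fun G => LTLang.boolFun (L := fun t w => A.rank t < A.rank s ∧ A.acc t w) (fun t => by
      by_cases ht : A.rank t < A.rank s
      · simpa [ht] using ih _ ht t rfl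
      · simpa [ht] using LTLang.empty) G
  have hα : LTLang fun w => ∃ x, ConsLang x
      (fun w => A.δ s x {t | A.rank t < A.rank s ∧ A.acc t w}) w :=
    LTLang.finExists fun x => (hlow _).cons x
  have hβ : LTLang fun w => ∃ x, ConsLang x
      (fun w => A.δ s x (insert s {t | A.rank t < A.rank s ∧ A.acc t w})) w :=
    LTLang.finExists fun x => (hlow fun Y => A.δ s x (insert s Y)).cons x
  refine (hβ.untl (hα.or (LTLang.nil.and (.const (s ∈ A.F))))).congr fun w => ?_
  induction w with
  | nil => simp [UntilLang, acc, ConsLang]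
  | cons x w ihw =>
    rw [UntilLang, ← ihw]
    simp only [acc, ConsLang, exists_eq_left', reduceCtorEq, false_and, or_false]
    by_cases hs : A.acc s w
    · constructor
      · intro h
        refine Or.inr ⟨A.mono (fun t ht hr => ?_) h, hs⟩
        rcases hr rfl with rfl | hr
        exacts [Or.inl rfl, Or.inr ⟨hr, ht⟩]
      · rintro (h | ⟨h, -⟩)
        · exact A.mono (fun t ht _ => ht.2) h
        · refine A.mono (fun t ht _ => ?_) h
          rcases ht with rfl | ht
          exacts [hs, ht.2]
    · constructor
      · intro h
        refine Or.inl (A.mono (fun t ht hr => ?_) h)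
        rcases hr rfl with rfl | hr
        exacts [absurd ht hs, ⟨hr, ht⟩]
      · rintro (h | ⟨-, h⟩)
        · exact A.mono (fun t ht _ => ht.2) h
        · exact absurd h hs

theorem cls_acc [Finite σ] (A : BAut σ sf) (s : A.Q) : Cls sf (A.acc s) := by
  cases sf
  exacts [A.acc_reg s, (A.acc_ltLang s).cls]

/-- The dual automaton. -/
def dual (A : BAut σ sf) : BAut σ sf where
  Q := A.Q
  finite_Q := A.finite_Q
  δ s x Y := ¬ A.δ s x Yᶜ
  F := A.Fᶜ
  rank := A.rank
  mono {_ _ _ Z} h hY hZ := hY (A.mono (fun t ht hr hy => (show t ∉ Z from ht) (h t hy hr)) hZ)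

theorem acc_dual (A : BAut σ sf) (s : A.Q) (w : List σ) : A.dual.acc s w ↔ ¬ A.acc s w := by
  induction w generalizing s with
  | nil => exact Iff.rfl
  | cons x w ih =>
    have : ({t : A.Q | A.dual.acc t w} : Set A.Q)ᶜ = {t | A.acc t w} := Set.ext fun t => by
      change ¬ A.dual.acc t w ↔ A.acc t w
      rw [ih, not_not]
    exact not_congr (iff_of_eq (congrArg (A.δ s x) this))

theorem exists_rank_le (A : BAut σ sf) : ∃ N, ∀ q, A.rank q ≤ N := by
  have := A.finite_Q
  obtain ⟨N, hN⟩ := (Set.finite_range A.rank).bddAbove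
  exact ⟨N, fun q => hN ⟨q, rfl⟩⟩

/-- The union of two automata with an additional state. -/
noncomputable def join (A B : BAut σ sf) (d : σ → Set A.Q → Set B.Q → Prop → Prop)
    (hd : ∀ {x Y Y' Z Z' p p'}, Y ⊆ Y' → Z ⊆ Z' → (p → p') → d x Y Z p → d x Y' Z' p')
    (f : Prop) : BAut σ sf where
  Q := Option (A.Q ⊕ B.Q)
  finite_Q := have := A.finite_Q; have := B.finite_Q; inferInstance
  δ
    | none, x, Y => d x {q | some (.inl q) ∈ Y} {q | some (.inr q) ∈ Y} (none ∈ Y)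
    | some (.inl q), x, Y => A.δ q x {q | some (.inl q) ∈ Y}
    | some (.inr q), x, Y => B.δ q x {q | some (.inr q) ∈ Y}
  F := {q | match q with
    | none => f
    | some (.inl q) => q ∈ A.F
    | some (.inr q) => q ∈ B.F}
  rank
    | none => A.exists_rank_le.choose + B.exists_rank_le.choose + 1
    | some (.inl q) => A.rank q
    | some (.inr q) => B.rank q
  mono {s x Y Z} h hY := by
    match s with
    | none =>
      have hA := A.exists_rank_le.choose_spec
      have hB := B.exists_rank_le.choose_spec
      refine hd (fun q hq => h _ hq fun _ => Or.inr ?_) (fun q hq => h _ hq fun _ => Or.inr ?_)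
        (fun hq => h _ hq fun _ => Or.inl rfl) hY
      · have := hA q
        dsimp only
        omega
      · have := hB q
        dsimp only
        omega
    | some (.inl q) =>
      refine A.mono (fun t ht hr => h _ ht fun hs => ?_) hY
      exact (hr hs).imp (fun h => by rw [h]) id
    | some (.inr q) =>
      refine B.mono (fun t ht hr => h _ ht fun hs => ?_) hY
      exact (hr hs).imp (fun h => by rw [h]) id

section join
variable (A B : BAut σ sf) (d : σ → Set A.Q → Set B.Q → Prop → Prop)
    (hd : ∀ {x Y Y' Z Z' p p'}, Y ⊆ Y' → Z ⊆ Z' → (p → p') → d x Y Z p → d x Y' Z' p')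
    (f : Prop)

theorem acc_join_inl (q : A.Q) (w : List σ) :
    (A.join B d hd f).acc (some (.inl q)) w ↔ A.acc q w := by
  induction w generalizing q with
  | nil => exact Iff.rfl
  | cons x w ih =>
    have : {q | (A.join B d hd f).acc (some (.inl q)) w} = {t | A.acc t w} :=
      Set.ext fun t => ih t
    change A.δ q x {q | (A.join B d hd f).acc (some (.inl q)) w} ↔ A.δ q x {t | A.acc t w}
    rw [this]

theorem acc_join_inr (q : B.Q) (w : List σ) :
    (A.join B d hd f).acc (some (.inr q)) w ↔ B.acc q w := by
  induction w generalizing q with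
  | nil => exact Iff.rfl
  | cons x w ih =>
    have : {q | (A.join B d hd f).acc (some (.inr q)) w} = {t | B.acc t w} :=
      Set.ext fun t => ih t
    change B.δ q x {q | (A.join B d hd f).acc (some (.inr q)) w} ↔ B.δ q x {t | B.acc t w}
    rw [this]

theorem acc_join_none_cons (x : σ) (w : List σ) :
    (A.join B d hd f).acc none (x :: w) ↔
      d x {t | A.acc t w} {t | B.acc t w} ((A.join B d hd f).acc none w) := by
  have h1 : {q | (A.join B d hd f).acc (some (.inl q)) w} = {t | A.acc t w} :=
    Set.ext fun t => acc_join_inl A B d hd f t w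
  have h2 : {q | (A.join B d hd f).acc (some (.inr q)) w} = {t | B.acc t w} :=
    Set.ext fun t => acc_join_inr A B d hd f t w
  change d x {q | (A.join B d hd f).acc (some (.inl q)) w}
    {q | (A.join B d hd f).acc (some (.inr q)) w} _ ↔ _
  rw [h1, h2]
  rfl

end join
end BAut

/-- Negation is dualization; conjunction, next letter and until each add one state on top, and only
the one for until has a loop. -/
theorem LTLang.exists_bAut {σ : Type} {L : List σ → Prop} (hL : LTLang L) :
    ∃ (A : BAut σ true) (s : A.Q), ∀ w, A.acc s w ↔ L w := by
  induction hL with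
  | empty =>
    refine ⟨⟨Unit, inferInstance, fun _ _ _ => False, ∅, fun _ => 0, fun _ h => h⟩, (),
      fun w => ?_⟩
    cases w <;> exact Iff.rfl
  | not _ ih =>
    obtain ⟨A, s, h⟩ := ih
    exact ⟨A.dual, s, fun w => by rw [BAut.acc_dual, h]⟩
  | @and L K _ _ ih ih' =>
    obtain ⟨A, s, h⟩ := ih
    obtain ⟨B, t, h'⟩ := ih'
    refine ⟨A.join B (fun x Y Z _ => A.δ s x Y ∧ B.δ t x Z)
      (fun hY hZ _ hd => ⟨A.mono (fun q hq _ => hY hq) hd.1, B.mono (fun q hq _ => hZ hq) hd.2⟩)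
      (s ∈ A.F ∧ t ∈ B.F), none, fun w => ?_⟩
    refine Iff.trans ?_ (and_congr (h w) (h' w))
    cases w with
    | nil => exact Iff.rfl
    | cons x w => rw [BAut.acc_join_none_cons]; rfl
  | @cons a L _ ih =>
    obtain ⟨A, s, h⟩ := ih
    -- The second copy of `A` only fills the second argument of `join`.
    refine ⟨A.join A (fun x Y _ _ => x = a ∧ s ∈ Y) (fun hY _ _ hd => ⟨hd.1, hY hd.2⟩) False,
      none, fun w => ?_⟩
    cases w with
    | nil => exact Iff.rfl
    | cons x w =>
      rw [BAut.acc_join_none_cons, ConsLang, ← h w]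
      rfl
  | @untl K L _ _ ih ih' =>
    obtain ⟨A, s, h⟩ := ih
    obtain ⟨B, t, h'⟩ := ih'
    refine ⟨A.join B (fun x Y Z p => B.δ t x Z ∨ (A.δ s x Y ∧ p))
      (fun hY hZ hp hd => hd.imp (B.mono fun q hq _ => hZ hq)
        (And.imp (A.mono fun q hq _ => hY hq) hp)) (t ∈ B.F), none, fun w => ?_⟩
    induction w with
    | nil => exact h' []
    | cons x w ihw =>
      rw [BAut.acc_join_none_cons, ihw, UntilLang, ← h' (x :: w), ← h (x :: w)]
      rfl

theorem Cls.exists_bAut {σ : Type} [Finite σ] {sf : Bool} {L : List σ → Prop} (hL : Cls sf L) :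
    ∃ (A : BAut σ sf) (s : A.Q), ∀ w, A.acc s w ↔ L w := by
  cases sf
  · obtain ⟨S, hS, s, f, F, h⟩ := hL
    refine ⟨⟨S, hS, fun s x Y => f s x ∈ Y, {s | F s}, fun _ => 0,
      fun hYZ h => hYZ _ h nofun⟩, s, fun w => ?_⟩
    rw [h]
    clear h
    induction w generalizing s with
    | nil => exact Iff.rfl
    | cons x w ih => exact ih (f s x)
  · exact hL.ltLang.exists_bAut

/-! ### Positions of timed words -/

namespace TimedWord
variable {AP : Type*} (ρ : TimedWord AP)

theorem mem_positions {p : ρ.Pos → Prop} {k : ρ.Pos} : k ∈ ρ.positions p ↔ p k := by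
  simp [positions]

theorem positions_pairwise (p : ρ.Pos → Prop) : (ρ.positions p).Pairwise (· < ·) :=
  (List.pairwise_lt_finRange _).filter _

theorem eq_positions {p : ρ.Pos → Prop} {l : List ρ.Pos} (hl : l.Pairwise (· < ·))
    (h : ∀ k, k ∈ l ↔ p k) : l = ρ.positions p := by
  refine List.Perm.eq_of_pairwise (le := (· < ·)) (fun a b _ _ h1 h2 => absurd h1 (lt_asymm h2)) hl
    (ρ.positions_pairwise p) ?_
  refine (List.perm_ext_iff_of_nodup (hl.imp ne_of_lt)
    ((ρ.positions_pairwise p).imp ne_of_lt)).2 fun k => ?_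
  rw [h, mem_positions]

theorem positions_congr {p q : ρ.Pos → Prop} (h : ∀ k, p k ↔ q k) :
    ρ.positions p = ρ.positions q := by
  have : p = q := funext fun k => propext (h k)
  rw [this]

theorem positions_append {p q : ρ.Pos → Prop} (h : ∀ j k, p j → q k → j < k) :
    ρ.positions (fun k => p k ∨ q k) = ρ.positions p ++ ρ.positions q := by
  refine (ρ.eq_positions (List.pairwise_append.2 ⟨ρ.positions_pairwise p, ρ.positions_pairwise q,
    fun j hj k hk => h j k (ρ.mem_positions.1 hj) (ρ.mem_positions.1 hk)⟩) fun k => ?_).symm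
  rw [List.mem_append, mem_positions, mem_positions]

theorem positions_eq_singleton (k : ρ.Pos) : ρ.positions (fun j => j = k) = [k] :=
  (ρ.eq_positions (List.pairwise_singleton _ _) fun j => by simp).symm

theorem positions_eq_nil {p : ρ.Pos → Prop} (h : ∀ k, ¬ p k) : ρ.positions p = [] :=
  (ρ.eq_positions List.Pairwise.nil fun j => by simp [h]).symm

open Classical in
theorem filter_positions (p q : ρ.Pos → Prop) :
    (ρ.positions p).filter (fun k => decide (q k)) = ρ.positions fun k => p k ∧ q k :=
  ρ.eq_positions ((ρ.positions_pairwise p).filter _) fun k => by simp [mem_positions]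

/-- The positions after `k`. -/
noncomputable def after (k : ρ.Pos) : List ρ.Pos := ρ.positions fun j => k < j

theorem mem_after {j k : ρ.Pos} : j ∈ ρ.after k ↔ k < j := ρ.mem_positions

theorem positions_eq_cons {p : ρ.Pos → Prop} {k : ρ.Pos} (hk : p k) (h : ∀ j, p j → k ≤ j) :
    ρ.positions p = k :: ρ.positions fun j => k < j ∧ p j := by
  refine (ρ.eq_positions (List.pairwise_cons.2 ⟨fun j hj => (ρ.mem_positions.1 hj).1,
    ρ.positions_pairwise _⟩) fun j => ?_).symm
  rw [List.mem_cons, mem_positions]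
  constructor
  · rintro (rfl | h)
    exacts [hk, h.2]
  · intro hj
    rcases (h j hj).eq_or_lt with rfl | hlt
    exacts [Or.inl rfl, Or.inr ⟨hlt, hj⟩]

theorem positions_true : (ρ.positions fun _ => True) = 0 :: ρ.after 0 := by
  rw [ρ.positions_eq_cons (k := 0) trivial fun j _ => Fin.zero_le _]
  simp [after]

theorem after_cases (k : ρ.Pos) : (ρ.after k = [] ∧ ∀ j, ¬ k < j) ∨
    ∃ j : ρ.Pos, j.1 = k.1 + 1 ∧ ρ.after k = j :: ρ.after j := by
  by_cases hk : k.1 + 1 < ρ.len + 1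
  · refine Or.inr ⟨⟨k.1 + 1, hk⟩, rfl, ?_⟩
    rw [after, ρ.positions_eq_cons (k := ⟨k.1 + 1, hk⟩) (Fin.mk_lt_mk.2 (Nat.lt_succ_self _))
      fun j hj => Nat.succ_le_of_lt hj]
    congr 1
    refine ρ.positions_congr fun j => ?_
    simp only [Fin.lt_def]
    omega
  · have : ∀ j, ¬ k < j := fun j hj => by
      have := j.2
      rw [Fin.lt_def] at hj
      omega
    exact Or.inl ⟨ρ.positions_eq_nil this, this⟩

/-- Induction from the last position backwards. -/
theorem after_induction {C : ρ.Pos → Prop} (h0 : ∀ k, ρ.after k = [] → (∀ j, ¬ k < j) → C k)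
    (h1 : ∀ k j : ρ.Pos, j.1 = k.1 + 1 → ρ.after k = j :: ρ.after j → C j → C k) (k : ρ.Pos) :
    C k := by
  induction hn : ρ.len - k.1 generalizing k with
  | zero =>
    rcases ρ.after_cases k with h | ⟨j, hj, -⟩
    · exact h0 k h.1 h.2
    · have := j.2
      omega
  | succ n ih =>
    rcases ρ.after_cases k with h | ⟨j, hj, h⟩
    · exact h0 k h.1 h.2
    · exact h1 k j hj h (ih j (by omega))

/-- The first position with the same time stamp as `k`. -/
noncomputable def blockStart (k : ρ.Pos) : ρ.Pos :=
  (Finset.univ.filter fun j => ρ.time j = ρ.time k).min' ⟨k, by simp⟩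

theorem time_blockStart (k : ρ.Pos) : ρ.time (ρ.blockStart k) = ρ.time k := by
  have := Finset.min'_mem (Finset.univ.filter fun j => ρ.time j = ρ.time k) ⟨k, by simp⟩
  exact (Finset.mem_filter.1 this).2

theorem blockStart_le {j k : ρ.Pos} (h : ρ.time j = ρ.time k) : ρ.blockStart k ≤ j :=
  Finset.min'_le _ _ (by simpa using h)

theorem eq_blockStart {b k : ρ.Pos} (h : ρ.time b = ρ.time k)
    (hb : ∀ j, ρ.time j = ρ.time k → b ≤ j) : ρ.blockStart k = b :=
  le_antisymm (ρ.blockStart_le h) (hb _ (ρ.time_blockStart k))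

theorem blockStart_congr {j k : ρ.Pos} (h : ρ.time j = ρ.time k) :
    ρ.blockStart j = ρ.blockStart k :=
  ρ.eq_blockStart (by rw [time_blockStart, h]) fun i hi => ρ.blockStart_le (hi.trans h)

theorem blockStart_zero : ρ.blockStart 0 = 0 :=
  ρ.eq_blockStart rfl fun _ _ => Fin.zero_le _

end TimedWord

/-! ### Definable properties of positions -/

/-- Properties of the positions of timed words. -/
abbrev PosProp (AP : Type u) := ∀ ρ : TimedWord AP, ρ.Pos → Prop

/-- What is observed at position `j` from position `k`: the properties among `P` that hold at `j`
and the intervals among `I` that contain the time distance. -/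
def obs {AP : Type u} {ι κ : Type} (P : ι → PosProp AP) (I : κ → TimeInterval)
    (ρ : TimedWord AP) (k j : ρ.Pos) : Set ι × Set κ :=
  ({i | P i ρ j}, {i | ρ.time j - ρ.time k ∈ (I i).toSet})

/-- Properties defined by letters, boolean operations, languages of the class on the observations
after the position and, if `p` holds, evaluation at the first position with the same time
stamp. -/
inductive Definable {AP : Type u} (sf : Bool) (p : Prop) : PosProp AP → Prop
  | letter (T : Set (Letter AP)) : Definable sf p fun ρ k => ρ.letter k ∈ T
  | not {P} : Definable sf p P → Definable sf p fun ρ k => ¬ P ρ k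
  | and {P Q} : Definable sf p P → Definable sf p Q → Definable sf p fun ρ k => P ρ k ∧ Q ρ k
  | future {ι κ : Type} [Finite ι] [Finite κ] {P : ι → PosProp AP} (I : κ → TimeInterval)
      {L : List (Set ι × Set κ) → Prop} :
      (∀ i, Definable sf p (P i)) → Cls sf L →
        Definable sf p fun ρ k => L ((ρ.after k).map (obs P I ρ k))
  | start {P} : p → Definable sf p P → Definable sf p fun ρ k => P ρ (ρ.blockStart k)

namespace Definable
variable {AP : Type u} {sf : Bool} {p : Prop} {P Q : PosProp AP}

theorem congr (hP : Definable sf p P) (h : ∀ ρ k, Q ρ k ↔ P ρ k) : Definable sf p Q := by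
  have : Q = P := funext fun ρ => funext fun k => propext (h ρ k)
  rwa [this]

theorem or (hP : Definable sf p P) (hQ : Definable sf p Q) :
    Definable sf p fun ρ k => P ρ k ∨ Q ρ k :=
  (hP.not.and hQ.not).not.congr fun ρ k => by tauto

theorem const (q : Prop) : Definable sf p fun (_ : TimedWord AP) _ => q :=
  (letter {_x | q}).congr fun _ _ => Iff.rfl

theorem finExists {ι : Type*} [Finite ι] {P : ι → PosProp AP}
    (hP : ∀ i, Definable sf p (P i)) : Definable sf p fun ρ k => ∃ i, P i ρ k := by
  have key : ∀ s : Finset ι, Definable sf p fun ρ k => ∃ i ∈ s, P i ρ k := by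
    classical
    intro s
    induction s using Finset.induction_on with
    | empty => exact (const False).congr fun ρ k => by simp
    | insert a s _ ih => exact ((hP a).or ih).congr fun ρ k => by simp
  cases nonempty_fintype ι
  exact (key Finset.univ).congr fun ρ k => by simp

theorem finForall {ι : Type*} [Finite ι] {P : ι → PosProp AP}
    (hP : ∀ i, Definable sf p (P i)) : Definable sf p fun ρ k => ∀ i, P i ρ k :=
  (finExists fun i => (hP i).not).not.congr fun ρ k => by push Not; rfl

theorem setEq {ι : Type*} [Finite ι] {P : ι → PosProp AP}
    (hP : ∀ i, Definable sf p (P i)) (Y : Set ι) :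
    Definable sf p fun ρ k => {i | P i ρ k} = Y :=
  (finForall fun i => ((const (i ∈ Y)).and (hP i)).or ((const (i ∉ Y)).and (hP i).not)).congr
    fun ρ k => by
      rw [Set.ext_iff]
      refine forall_congr' fun i => ?_
      simp only [Set.mem_ofPred_eq]
      tauto

/-- No later position has the same time stamp. -/
theorem last : Definable sf p fun (ρ : TimedWord AP) k => ∀ j, k < j → ρ.time k < ρ.time j := by
  refine (future (ι := Empty) (κ := Unit) (P := nofun) (fun _ => .icc 0 0) nofun
    (Cls.all fun x => () ∉ x.2)).congr fun ρ k => ?_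
  simp only [List.mem_map, forall_exists_index, and_imp, forall_apply_eq_imp_iff₂, ρ.mem_after]
  refine forall₂_congr fun j hj => ?_
  have := ρ.time_mono hj.le
  simp only [obs, TimeInterval.toSet, Set.mem_ofPred_eq, Nat.cast_zero, Set.Icc_self,
    Set.mem_singleton_iff, sub_eq_zero]
  exact ⟨fun h => h.ne', fun h => lt_of_le_of_ne this (Ne.symm h)⟩

end Definable

/-! ### Rational languages -/

/-- Rational languages. -/
inductive RationalLang {σ : Type*} : (List σ → Prop) → Prop
  | empty : RationalLang fun _ => False
  | nil : RationalLang fun w => w = []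
  | letter (x : σ) : RationalLang fun w => w = [x]
  | or {L K} : RationalLang L → RationalLang K → RationalLang fun w => L w ∨ K w
  | concat {L K} : RationalLang L → RationalLang K →
      RationalLang fun w => ∃ u v, w = u ++ v ∧ L u ∧ K v
  | star {L} : RationalLang L →
      RationalLang fun w => ∃ ws : List (List σ), w = ws.flatten ∧ ∀ y ∈ ws, L y

namespace RationalLang
variable {σ S : Type*}

theorem congr {L K : List σ → Prop} (hL : RationalLang L) (h : ∀ w, K w ↔ L w) :
    RationalLang K := by
  have : K = L := funext fun w => propext (h w)
  rwa [this]

theorem finExists {ι : Type*} [Finite ι] {L : ι → List σ → Prop}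
    (hL : ∀ i, RationalLang (L i)) : RationalLang fun w => ∃ i, L i w := by
  have key : ∀ s : Finset ι, RationalLang fun w => ∃ i ∈ s, L i w := by
    classical
    intro s
    induction s using Finset.induction_on with
    | empty => exact empty.congr fun w => by simp
    | insert a s _ ih => exact ((hL a).or ih).congr fun w => by simp
  cases nonempty_fintype ι
  exact (key Finset.univ).congr fun w => by simp

/-- The automaton moves from `p` to `q` reading `w`, visiting only states of `T` in between. -/
def Through (f : S → σ → S) (T : Set S) (p : S) (w : List σ) (q : S) : Prop :=
  w.foldl f p = q ∧ ∀ u v, w = u ++ v → u ≠ [] → v ≠ [] → u.foldl f p ∈ T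

theorem Through.append {f : S → σ → S} {T : Set S} {p q r : S} {u v : List σ} (hr : r ∈ T)
    (hu : Through f T p u r) (hv : Through f T r v q) : Through f T p (u ++ v) q := by
  refine ⟨by rw [List.foldl_append, hu.1, hv.1], fun x y hxy hx hy => ?_⟩
  rcases List.append_eq_append_iff.1 hxy with ⟨z, rfl, rfl⟩ | ⟨z, rfl, rfl⟩
  · rw [List.foldl_append, hu.1]
    rcases eq_or_ne z [] with rfl | hz
    · exact hr
    · exact hv.2 z y rfl hz hy
  · rcases eq_or_ne z [] with rfl | hz
    · rw [List.append_nil] at hu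
      rwa [hu.1]
    · exact hu.2 x z rfl hx hz

theorem Through.mono {f : S → σ → S} {T T' : Set S} (hT : T ⊆ T') {p q : S} {w : List σ}
    (h : Through f T p w q) : Through f T' p w q :=
  ⟨h.1, fun u v h1 h2 h3 => hT (h.2 u v h1 h2 h3)⟩

/-- Kleene's recursion: a path through the new state `r` is cut at its visits to `r`. -/
theorem through_insert {f : S → σ → S} {T : Set S} {p q r : S} {w : List σ} :
    Through f (insert r T) p w q ↔ Through f T p w q ∨ ∃ u v, w = u ++ v ∧ Through f T p u r ∧
      ∃ x y, v = x ++ y ∧ (∃ ws : List (List σ), x = ws.flatten ∧ ∀ y ∈ ws, Through f T r y r) ∧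
        Through f T r y q := by
  have hr : r ∈ insert r T := Set.mem_insert r T
  have hT : T ⊆ insert r T := Set.subset_insert r T
  constructor
  · intro h
    -- One visit to `r` splits the word into two shorter words, and the two decompositions are
    -- glued.
    induction hn : w.length using Nat.strong_induction_on generalizing w p q with
    | _ n ih =>
    subst hn
    by_cases hw : Through f T p w q
    · exact Or.inl hw
    have : ∃ u v, w = u ++ v ∧ u ≠ [] ∧ v ≠ [] ∧ u.foldl f p ∉ T := by
      by_contra hn
      refine hw ⟨h.1, fun u v h1 h2 h3 => ?_⟩
      by_contra h4
      exact hn ⟨u, v, h1, h2, h3, h4⟩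
    obtain ⟨u, v, rfl, hu, hv, huT⟩ := this
    have hur : u.foldl f p = r := (h.2 u v rfl hu hv).resolve_right huT
    have hu' := List.length_pos_iff.2 hu
    have hv' := List.length_pos_iff.2 hv
    have h1 := ih u.length (by simp; omega) (p := p) (q := r) (w := u)
      ⟨hur, fun x y hxy hx hy => h.2 x (y ++ v) (by rw [hxy, List.append_assoc]) hx (by simp [hy])⟩
      rfl
    have h2 := ih v.length (by simp; omega) (p := r) (q := q) (w := v)
      ⟨by rw [← h.1, List.foldl_append, hur], fun x y hxy hx hy => by
        have := h.2 (u ++ x) y (by rw [hxy, List.append_assoc]) (by simp [hx]) hy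
        rwa [List.foldl_append, hur] at this⟩ rfl
    have h1' : ∃ x ws, u = x ++ List.flatten ws ∧ Through f T p x r ∧
        ∀ y ∈ ws, Through f T r y r := by
      rcases h1 with h1 | ⟨x, _, rfl, hx, _, y, rfl, ⟨ws, rfl, hws⟩, hy⟩
      · exact ⟨u, [], by simp, h1, by simp⟩
      · exact ⟨x, ws ++ [y], by simp, hx, by
          simp only [List.mem_append, List.mem_singleton]
          rintro z (hz | rfl)
          exacts [hws z hz, hy]⟩
    have h2' : ∃ y ws, v = List.flatten ws ++ y ∧ Through f T r y q ∧
        ∀ y ∈ ws, Through f T r y r := by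
      rcases h2 with h2 | ⟨x, _, rfl, hx, _, y, rfl, ⟨ws, rfl, hws⟩, hy⟩
      · exact ⟨v, [], by simp, h2, by simp⟩
      · exact ⟨y, x :: ws, by simp, hy, by
          simp only [List.mem_cons]
          rintro z (rfl | hz)
          exacts [hx, hws z hz]⟩
    obtain ⟨x, ws, rfl, hx, hws⟩ := h1'
    obtain ⟨y, ws', rfl, hy, hws'⟩ := h2'
    refine Or.inr ⟨x, _, List.append_assoc .., hx, ws.flatten ++ ws'.flatten, y,
      by rw [List.append_assoc], ⟨ws ++ ws', by simp, ?_⟩, hy⟩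
    simp only [List.mem_append]
    rintro z (hz | hz)
    exacts [hws z hz, hws' z hz]
  · rintro (h | ⟨u, _, rfl, hu, _, y, rfl, ⟨ws, rfl, hws⟩, hy⟩)
    · exact h.mono hT
    · refine (hu.mono hT).append hr (Through.append hr ?_ (hy.mono hT))
      induction ws with
      | nil => exact ⟨rfl, fun u v h hu => absurd (List.nil_eq_append_iff.1 h).1 hu⟩
      | cons x ws ih =>
        rw [List.flatten_cons]
        exact ((hws x (by simp)).mono hT).append hr (ih fun y hy => hws y (by simp [hy]))

theorem through [Finite σ] (f : S → σ → S) (T : Finset S) (p q : S) :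
    RationalLang fun w => Through f T p w q := by
  classical
  induction T using Finset.induction_on generalizing p q with
  | empty =>
    have h1 : RationalLang fun w : List σ => ∃ _ : PLift (p = q), w = [] :=
      finExists fun _ => .nil
    have h2 : RationalLang fun w : List σ => ∃ x : {x // f p x = q}, w = [x.1] :=
      finExists fun x => .letter x.1
    refine (h1.or h2).congr fun w => ?_
    constructor
    · rintro ⟨h, h'⟩
      match w with
      | [] => exact Or.inl ⟨⟨h⟩, rfl⟩
      | [x] => exact Or.inr ⟨⟨x, h⟩, rfl⟩
      | x :: y :: w => exact absurd (h' [x] (y :: w) rfl (by simp) (by simp)) (by simp)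
    · rintro (⟨⟨rfl⟩, rfl⟩ | ⟨⟨x, rfl⟩, rfl⟩)
      · exact ⟨rfl, fun u v h hu => absurd (List.nil_eq_append_iff.1 h).1 hu⟩
      · refine ⟨rfl, fun u v h hu hv => ?_⟩
        rcases List.append_eq_singleton_iff.1 h.symm with h | h
        exacts [absurd h.1 hu, absurd h.2 hv]
  | insert r T _ ih =>
    refine ((ih p q).or ((ih p r).concat ((ih r r).star.concat (ih r q)))).congr fun w => ?_
    rw [Finset.coe_insert]
    exact through_insert

end RationalLang

theorem RegLang.rationalLang {σ : Type*} [Finite σ] {L : List σ → Prop} (hL : RegLang L) :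
    RationalLang L := by
  obtain ⟨S, hS, s, f, F, h⟩ := hL
  cases nonempty_fintype S
  have h1 : RationalLang fun w => ∃ q : {q // F q},
      RationalLang.Through f (Finset.univ : Finset S) s w q.1 :=
    .finExists fun q => .through f _ s q.1
  refine h1.congr fun w => ?_
  rw [h]
  constructor
  · exact fun hw => ⟨⟨_, hw⟩, rfl, fun _ _ _ _ _ => by simp⟩
  · rintro ⟨⟨q, hq⟩, rfl, -⟩
    exact hq

/-! ### Rational expressions of formulae -/

namespace RatExp
variable {AP : Type u}

/-- The letters of a rational expression. -/
def letters : RatExp AP → Set (RatMTL AP)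
  | .eps => ∅
  | .letter φ => {φ}
  | .comp r s => r.letters ∪ s.letters
  | .plus r s => r.letters ∪ s.letters
  | .star r => r.letters

theorem marked_iff (ρ : TimedWord AP) (k : ρ.Pos) (ψ : RatMTL AP) :
    ∀ re : RatExp AP, re.Marked ρ k ψ ↔ ψ ∈ re.letters ∧ ψ.Sat ρ k
  | .eps => by simp [Marked, letters]
  | .letter φ => by
    simp only [Marked, letters, Set.mem_singleton_iff]
    exact and_congr_right fun h => by rw [h]
  | .comp r s => by
    simp only [Marked, letters, Set.mem_union, marked_iff ρ k ψ r, marked_iff ρ k ψ s, or_and_right]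
  | .plus r s => by
    simp only [Marked, letters, Set.mem_union, marked_iff ρ k ψ r, marked_iff ρ k ψ s, or_and_right]
  | .star r => by
    simp only [Marked, letters, marked_iff ρ k ψ r]

theorem letters_finite : ∀ re : RatExp AP, re.letters.Finite
  | .eps => Set.finite_empty
  | .letter φ => Set.finite_singleton φ
  | .comp r s => (letters_finite r).union (letters_finite s)
  | .plus r s => (letters_finite r).union (letters_finite s)
  | .star r => letters_finite r

theorem lettersSfr_iff : ∀ re : RatExp AP, re.LettersSfr ↔ ∀ ψ ∈ re.letters, ψ.IsSfr
  | .eps => by simp [LettersSfr, letters]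
  | .letter φ => by simp [LettersSfr, letters]
  | .comp r s => by
    simp only [LettersSfr, letters, Set.mem_union, lettersSfr_iff r, lettersSfr_iff s, or_imp,
      forall_and]
  | .plus r s => by
    simp only [LettersSfr, letters, Set.mem_union, lettersSfr_iff r, lettersSfr_iff s, or_imp,
      forall_and]
  | .star r => by simp only [LettersSfr, letters, lettersSfr_iff r]

theorem mem_letters_of_mem_lang : ∀ (re : RatExp AP) (w : List (RatMTL AP)), w ∈ re.lang →
    ∀ ψ ∈ w, ψ ∈ re.letters
  | .eps, w, hw, ψ, hψ => by
    have : w = [] := hw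
    simp [this] at hψ
  | .letter φ, w, hw, ψ, hψ => by
    have : w = [φ] := hw
    simpa [this, letters] using hψ
  | .comp r s, w, hw, ψ, hψ => by
    obtain ⟨u, hu, v, hv, rfl⟩ := Language.mem_mul.1 hw
    rcases List.mem_append.1 hψ with h | h
    exacts [Or.inl (mem_letters_of_mem_lang r u hu ψ h),
      Or.inr (mem_letters_of_mem_lang s v hv ψ h)]
  | .plus r s, w, hw, ψ, hψ => by
    rcases (Language.mem_add _ _ _).1 hw with h | h
    exacts [Or.inl (mem_letters_of_mem_lang r w h ψ hψ),
      Or.inr (mem_letters_of_mem_lang s w h ψ hψ)]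
  | .star r, w, hw, ψ, hψ => by
    obtain ⟨ws, rfl, h⟩ := Language.mem_kstar.1 hw
    obtain ⟨u, hu, hψ⟩ := List.mem_flatten.1 hψ
    exact mem_letters_of_mem_lang r u (h u hu) ψ hψ

/-- Satisfaction as a relation between formulae and positions. -/
abbrev _root_.TimedWord.sat (ρ : TimedWord AP) (ψ : RatMTL AP) (k : ρ.Pos) : Prop := ψ.Sat ρ k

/-- Some word of the expression is related to the given word. -/
def Matches {β : Type*} (re : RatExp AP) (R : RatMTL AP → β → Prop) (ks : List β) : Prop :=
  ∃ w ∈ re.lang, List.Forall₂ R w ks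

/-- Words of the expression contain only its own letters, so the restriction of markings to these
letters has no effect. -/
theorem nonempty_iff (re : RatExp AP) (ρ : TimedWord AP) (ks : List ρ.Pos) :
    (single (ks.map fun k => {ψ | re.Marked ρ k ψ}) ∩ re.lang).Nonempty ↔ re.Matches ρ.sat ks := by
  constructor
  · rintro ⟨w, h1, h2⟩
    refine ⟨w, h2, ?_⟩
    have h1 : List.Forall₂ (fun x A => x ∈ A) w _ := h1
    rw [List.forall₂_map_right_iff] at h1
    exact h1.imp fun ψ k h => ((marked_iff ρ k ψ re).1 h).2
  · rintro ⟨w, h1, h2⟩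
    refine ⟨w, ?_, h1⟩
    change List.Forall₂ (fun x A => x ∈ A) w _
    rw [List.forall₂_map_right_iff]
    have h3 := mem_letters_of_mem_lang re w h1
    clear h1
    induction h2 with
    | nil => exact .nil
    | cons h _ ih =>
      exact .cons ((marked_iff ρ _ _ re).2 ⟨h3 _ (by simp), h⟩) (ih fun ψ hψ => h3 ψ (by simp [hψ]))

variable {β : Type*} (R : RatMTL AP → β → Prop)

theorem matches_eps (ks : List β) :
    (eps : RatExp AP).Matches R ks ↔ ks = [] := by
  constructor
  · rintro ⟨w, h, h'⟩
    obtain rfl : w = [] := h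
    exact List.forall₂_nil_left_iff.1 h'
  · rintro rfl
    exact ⟨[], rfl, .nil⟩

theorem matches_letter (φ : RatMTL AP) (ks : List β) :
    (letter φ).Matches R ks ↔ ∃ k, ks = [k] ∧ R φ k := by
  constructor
  · rintro ⟨w, h, h'⟩
    obtain rfl : w = [φ] := h
    obtain ⟨k, l, h1, h2, rfl⟩ := List.forall₂_cons_left_iff.1 h'
    obtain rfl := List.forall₂_nil_left_iff.1 h2
    exact ⟨k, rfl, h1⟩
  · rintro ⟨k, rfl, h⟩
    exact ⟨[φ], rfl, .cons h .nil⟩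

theorem matches_plus (r s : RatExp AP) (ks : List β) :
    (plus r s).Matches R ks ↔ r.Matches R ks ∨ s.Matches R ks := by
  constructor
  · rintro ⟨w, h | h, h'⟩
    exacts [Or.inl ⟨w, h, h'⟩, Or.inr ⟨w, h, h'⟩]
  · rintro (⟨w, h, h'⟩ | ⟨w, h, h'⟩)
    exacts [⟨w, Or.inl h, h'⟩, ⟨w, Or.inr h, h'⟩]

theorem _root_.List.forall₂_append_left_iff {α β : Type*} {R : α → β → Prop} {u v : List α}
    {l : List β} : List.Forall₂ R (u ++ v) l ↔
      ∃ x y, l = x ++ y ∧ List.Forall₂ R u x ∧ List.Forall₂ R v y := by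
  constructor
  · intro h
    induction u generalizing l with
    | nil => exact ⟨[], l, rfl, .nil, h⟩
    | cons a u ih =>
      obtain ⟨b, l, hab, hl, rfl⟩ := List.forall₂_cons_left_iff.1 h
      obtain ⟨x, y, rfl, hx, hy⟩ := ih hl
      exact ⟨b :: x, y, rfl, .cons hab hx, hy⟩
  · rintro ⟨x, y, rfl, h1, h2⟩
    exact List.rel_append h1 h2

theorem matches_comp (r s : RatExp AP) (ks : List β) :
    (comp r s).Matches R ks ↔ ∃ u v, ks = u ++ v ∧ r.Matches R u ∧ s.Matches R v := by
  constructor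
  · rintro ⟨w, h, h'⟩
    obtain ⟨u, hu, v, hv, rfl⟩ := Language.mem_mul.1 h
    obtain ⟨x, y, rfl, hx, hy⟩ := List.forall₂_append_left_iff.1 h'
    exact ⟨x, y, rfl, ⟨u, hu, hx⟩, v, hv, hy⟩
  · rintro ⟨x, y, rfl, ⟨u, hu, hx⟩, v, hv, hy⟩
    exact ⟨u ++ v, Language.append_mem_mul hu hv, List.rel_append hx hy⟩

theorem matches_star (r : RatExp AP) (ks : List β) :
    (star r).Matches R ks ↔
      ∃ kss : List (List β), ks = kss.flatten ∧ ∀ y ∈ kss, r.Matches R y := by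
  constructor
  · rintro ⟨w, h, h'⟩
    obtain ⟨ws, rfl, hws⟩ := Language.mem_kstar.1 h
    clear h
    induction ws generalizing ks with
    | nil => exact ⟨[], List.forall₂_nil_left_iff.1 h', by simp⟩
    | cons u ws ih =>
      rw [List.flatten_cons] at h'
      obtain ⟨x, y, rfl, hx, hy⟩ := List.forall₂_append_left_iff.1 h'
      obtain ⟨kss, rfl, h⟩ := ih y (fun v hv => hws v (by simp [hv])) hy
      refine ⟨x :: kss, rfl, ?_⟩
      simp only [List.mem_cons]
      rintro z (rfl | hz)
      exacts [⟨u, hws u (by simp), hx⟩, h z hz]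
  · rintro ⟨kss, rfl, h⟩
    choose! g hg hg' using h
    refine ⟨(kss.map g).flatten, Language.mem_kstar.2 ⟨_, rfl, by simpa using hg⟩, ?_⟩
    clear hg
    induction kss with
    | nil => exact .nil
    | cons x kss ih =>
      exact List.rel_append (hg' x (by simp)) (ih fun y hy => hg' y (by simp [hy]))

/-- An expression with prescribed letters. -/
def ofLetters : List (RatMTL AP) → RatExp AP
  | [] => .eps
  | ψ :: l => .comp (.letter ψ) (ofLetters l)

theorem letters_ofLetters (l : List (RatMTL AP)) : (ofLetters l).letters = {ψ | ψ ∈ l} := by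
  induction l with
  | nil => simp [ofLetters, letters]
  | cons φ l ih =>
    ext ψ
    simp [ofLetters, letters, ih]

end RatExp

theorem RationalLang.exists_ratExp {AP : Type u} {σ : Type*} {L : List σ → Prop}
    (hL : RationalLang L) (χ : σ → RatMTL AP) :
    ∃ re : RatExp AP, re.letters ⊆ insert (.neg .top) (Set.range χ) ∧
      ∀ ρ ks, re.Matches ρ.sat ks ↔ ∃ w, L w ∧ List.Forall₂ (fun x k => (χ x).Sat ρ k) w ks := by
  induction hL with
  | empty =>
    -- Rational expressions have no constant for the empty language; a letter that never holds
    -- replaces it.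
    refine ⟨.letter (.neg .top), by simp [RatExp.letters], fun ρ ks => ?_⟩
    simp [RatExp.matches_letter, TimedWord.sat, RatMTL.Sat]
  | nil =>
    refine ⟨.eps, by simp [RatExp.letters], fun ρ ks => ?_⟩
    simp [RatExp.matches_eps]
  | letter x =>
    refine ⟨.letter (χ x), by simp [RatExp.letters], fun ρ ks => ?_⟩
    rw [RatExp.matches_letter]
    simp only [exists_eq_left, List.forall₂_cons_left_iff, List.forall₂_nil_left_iff]
    constructor
    · rintro ⟨k, rfl, h⟩
      exact ⟨k, [], h, rfl, rfl⟩
    · rintro ⟨k, _, h, rfl, rfl⟩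
      exact ⟨k, rfl, h⟩
  | or _ _ ih ih' =>
    obtain ⟨r, h1, h2⟩ := ih
    obtain ⟨s, h3, h4⟩ := ih'
    refine ⟨.plus r s, Set.union_subset h1 h3, fun ρ ks => ?_⟩
    rw [RatExp.matches_plus, h2, h4]
    constructor
    · rintro (⟨w, h, h'⟩ | ⟨w, h, h'⟩)
      exacts [⟨w, Or.inl h, h'⟩, ⟨w, Or.inr h, h'⟩]
    · rintro ⟨w, h | h, h'⟩
      exacts [Or.inl ⟨w, h, h'⟩, Or.inr ⟨w, h, h'⟩]
  | concat _ _ ih ih' =>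
    obtain ⟨r, h1, h2⟩ := ih
    obtain ⟨s, h3, h4⟩ := ih'
    refine ⟨.comp r s, Set.union_subset h1 h3, fun ρ ks => ?_⟩
    rw [RatExp.matches_comp]
    simp only [h2, h4]
    constructor
    · rintro ⟨x, y, rfl, ⟨u, hu, hx⟩, v, hv, hy⟩
      exact ⟨u ++ v, ⟨u, v, rfl, hu, hv⟩, List.rel_append hx hy⟩
    · rintro ⟨_, ⟨u, v, rfl, hu, hv⟩, h⟩
      obtain ⟨x, y, rfl, hx, hy⟩ := List.forall₂_append_left_iff.1 h
      exact ⟨x, y, rfl, ⟨u, hu, hx⟩, v, hv, hy⟩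
  | star _ ih =>
    obtain ⟨r, h1, h2⟩ := ih
    refine ⟨.star r, h1, fun ρ ks => ?_⟩
    rw [RatExp.matches_star]
    simp only [h2]
    constructor
    · rintro ⟨kss, rfl, h⟩
      choose! g hg hg' using h
      refine ⟨(kss.map g).flatten, ⟨_, rfl, by simpa using hg⟩, ?_⟩
      clear hg
      induction kss with
      | nil => exact .nil
      | cons x kss ih =>
        exact List.rel_append (hg' x (by simp)) (ih fun y hy => hg' y (by simp [hy]))
    · rintro ⟨_, ⟨ws, rfl, hws⟩, h⟩
      induction ws generalizing ks with
      | nil => exact ⟨[], List.forall₂_nil_left_iff.1 h, by simp⟩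
      | cons u ws ih =>
        rw [List.flatten_cons] at h
        obtain ⟨x, y, rfl, hx, hy⟩ := List.forall₂_append_left_iff.1 h
        obtain ⟨kss, rfl, hk⟩ := ih y (fun v hv => hws v (by simp [hv])) hy
        refine ⟨x :: kss, rfl, ?_⟩
        simp only [List.mem_cons]
        rintro z (rfl | hz)
        exacts [⟨u, hws u (by simp), hx⟩, hk z hz]

/-- Renaming of the letters of a star-free expression. -/
def StarFreeExp.mapLetters {α β : Type*} (g : α → β) : StarFreeExp α → StarFreeExp β
  | .empty => .empty
  | .eps => .eps
  | .letter a => .letter (g a)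
  | .plus e f => .plus (e.mapLetters g) (f.mapLetters g)
  | .comp e f => .comp (e.mapLetters g) (f.mapLetters g)
  | .compl e => .compl (e.mapLetters g)

/-- Injectivity is demanded only at letters of `w`, because it will be known only for markings that
occur in a timed word. -/
theorem StarFreeExp.map_mem_mapLetters {α β : Type*} {g : α → β} (e : StarFreeExp α)
    {w : List α} (hw : ∀ x ∈ w, ∀ y, g x = g y → x = y) :
    w.map g ∈ (e.mapLetters g).lang ↔ w ∈ e.lang := by
  induction e generalizing w with
  | empty => exact Iff.rfl
  | eps => exact List.map_eq_nil_iff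
  | letter a =>
    rw [mapLetters, mem_letter, mem_letter]
    constructor
    · intro h
      obtain ⟨x, rfl, hx⟩ := List.map_eq_singleton_iff.1 h
      rw [hw x (by simp) a hx]
    · rintro rfl
      rfl
  | plus e f he hf => exact or_congr (he hw) (hf hw)
  | compl e he => exact not_congr (he hw)
  | comp e f he hf =>
    rw [mapLetters, mem_comp, mem_comp]
    constructor
    · rintro ⟨_, _, h, hu, hv⟩
      obtain ⟨u, v, rfl, rfl, rfl⟩ := List.map_eq_append_iff.1 h
      exact ⟨u, v, rfl, (he fun x hx => hw x (by simp [hx])).1 hu,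
        (hf fun x hx => hw x (by simp [hx])).1 hv⟩
    · rintro ⟨u, v, rfl, hu, hv⟩
      exact ⟨_, _, List.map_append, (he fun x hx => hw x (by simp [hx])).2 hu,
        (hf fun x hx => hw x (by simp [hx])).2 hv⟩

/-! ### Properties expressible by formulae -/

namespace RatMTL
variable {AP : Type u} (ρ : TimedWord AP) (φ ψ : RatMTL AP) (k : ρ.Pos)

theorem sat_atom (a : AP) : (atom a).Sat ρ k ↔ a ∈ (ρ.letter k).1 := by simp only [Sat]

theorem sat_top : (top : RatMTL AP).Sat ρ k := by simp only [Sat]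

theorem sat_and : (and φ ψ).Sat ρ k ↔ φ.Sat ρ k ∧ ψ.Sat ρ k := by simp only [Sat]

theorem sat_neg : (neg φ).Sat ρ k ↔ ¬ φ.Sat ρ k := by simp only [Sat]

theorem sat_rat (I : TimeInterval) (re : RatExp AP) : (rat I re).Sat ρ k ↔
    re.Matches ρ.sat (ρ.positions fun j => ρ.time j - ρ.time k ∈ I.toSet) := by
  rw [← RatExp.nonempty_iff]
  simp only [Sat]

theorem sat_urat (I : TimeInterval) (re : RatExp AP) : (urat φ I re ψ).Sat ρ k ↔
    ∃ j, k < j ∧ ψ.Sat ρ j ∧ ρ.time j - ρ.time k ∈ I.toSet ∧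
      (∀ i, k < i → i < j → φ.Sat ρ i) ∧ re.Matches ρ.sat (ρ.positions fun i => k < i ∧ i < j) := by
  simp only [← RatExp.nonempty_iff]
  simp only [Sat]

end RatMTL

/-- The property is expressed by a formula, which belongs to `SfrMTL` if `sf` is `true`. -/
def Expressible {AP : Type u} (sf : Bool) (P : PosProp AP) : Prop :=
  ∃ φ : RatMTL AP, (sf = true → φ.IsSfr) ∧ ∀ ρ k, φ.Sat ρ k ↔ P ρ k

namespace Expressible
variable {AP : Type u} {sf : Bool} {P Q : PosProp AP}

theorem congr (hP : Expressible sf P) (h : ∀ ρ k, Q ρ k ↔ P ρ k) : Expressible sf Q := by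
  have : Q = P := funext fun ρ => funext fun k => propext (h ρ k)
  rwa [this]

theorem not (hP : Expressible sf P) : Expressible sf fun ρ k => ¬ P ρ k := by
  obtain ⟨φ, h, h'⟩ := hP
  exact ⟨.neg φ, h, fun ρ k => (RatMTL.sat_neg ..).trans (not_congr (h' ρ k))⟩

theorem and (hP : Expressible sf P) (hQ : Expressible sf Q) :
    Expressible sf fun ρ k => P ρ k ∧ Q ρ k := by
  obtain ⟨φ, h, h'⟩ := hP
  obtain ⟨ψ, g, g'⟩ := hQ
  exact ⟨.and φ ψ, fun hs => ⟨h hs, g hs⟩, fun ρ k =>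
    (RatMTL.sat_and ..).trans (and_congr (h' ρ k) (g' ρ k))⟩

theorem or (hP : Expressible sf P) (hQ : Expressible sf Q) :
    Expressible sf fun ρ k => P ρ k ∨ Q ρ k :=
  (hP.not.and hQ.not).not.congr fun ρ k => by tauto

theorem const (q : Prop) : Expressible sf fun (_ : TimedWord AP) _ => q := by
  have : Expressible sf fun (_ : TimedWord AP) _ => True :=
    ⟨.top, fun _ => trivial, fun _ _ => iff_true_intro (RatMTL.sat_top ..)⟩
  by_cases hq : q
  · exact this.congr fun _ _ => by simp [hq]
  · exact this.not.congr fun _ _ => by simp [hq]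

theorem finExists {ι : Type*} [Finite ι] {P : ι → PosProp AP}
    (hP : ∀ i, Expressible sf (P i)) : Expressible sf fun ρ k => ∃ i, P i ρ k := by
  have key : ∀ s : Finset ι, Expressible sf fun ρ k => ∃ i ∈ s, P i ρ k := by
    classical
    intro s
    induction s using Finset.induction_on with
    | empty => exact (const False).congr fun ρ k => by simp
    | insert a s _ ih => exact ((hP a).or ih).congr fun ρ k => by simp
  cases nonempty_fintype ι
  exact (key Finset.univ).congr fun ρ k => by simp

theorem finForall {ι : Type*} [Finite ι] {P : ι → PosProp AP}
    (hP : ∀ i, Expressible sf (P i)) : Expressible sf fun ρ k => ∀ i, P i ρ k :=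
  (finExists fun i => (hP i).not).not.congr fun ρ k => by push Not; rfl

theorem setEq {ι : Type*} [Finite ι] {P : ι → PosProp AP}
    (hP : ∀ i, Expressible sf (P i)) (Y : Set ι) :
    Expressible sf fun ρ k => {i | P i ρ k} = Y :=
  (finForall fun i => ((const (i ∈ Y)).and (hP i)).or ((const (i ∉ Y)).and (hP i).not)).congr
    fun ρ k => by
      rw [Set.ext_iff]
      refine forall_congr' fun i => ?_
      simp only [Set.mem_ofPred_eq]
      tauto

theorem letter [Finite AP] (T : Set (Letter AP)) :
    Expressible sf fun (ρ : TimedWord AP) k => ρ.letter k ∈ T := by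
  have h1 : Expressible sf fun (ρ : TimedWord AP) k => ∃ A : T, {a | a ∈ (ρ.letter k).1} = A.1.1 :=
    finExists fun A => setEq (P := fun a ρ k => a ∈ (ρ.letter k).1)
      (fun a => ⟨.atom a, fun _ => trivial, fun _ _ => RatMTL.sat_atom ..⟩) _
  refine h1.congr fun ρ k => ⟨fun h => ⟨⟨_, h⟩, rfl⟩, ?_⟩
  rintro ⟨⟨A, hA⟩, h⟩
  rwa [show ρ.letter k = A from Subtype.ext h]

/-- Languages of the class on markings are given by rational expressions. -/
theorem exists_ratExp {ι : Type} [Finite ι] {P : ι → PosProp AP}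
    (hP : ∀ i, Expressible sf (P i)) {L : List (Set ι) → Prop} (hL : Cls sf L) :
    ∃ re : RatExp AP, (sf = true → re.HasStarFree ∧ re.LettersSfr) ∧
      ∀ ρ ks, re.Matches ρ.sat ks ↔ L (ks.map fun k => {i | P i ρ k}) := by
  -- The formula `χ Y` says that exactly the properties in `Y` hold, so each position determines its
  -- `Y`.
  choose χ hχ hχ' using setEq hP
  have hR : RationalLang L := by
    refine RegLang.rationalLang ?_
    cases sf
    exacts [hL, hL.ltLang.cls (sf := false)]
  obtain ⟨r, hr, hr'⟩ := hR.exists_ratExp χ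
  cases nonempty_fintype (Set ι)
  -- The second summand matches nothing, but makes every `χ Y` a letter of `re`. Every marking is
  -- then a singleton `{χ Y}`, and a star-free expression for `L` carries over letter by letter.
  set re : RatExp AP :=
    .plus r (.comp (.letter (.neg .top)) (.ofLetters (Finset.univ.toList.map χ))) with hre
  have hlet : re.letters = insert (.neg .top) (Set.range χ) := by
    have : re.letters = r.letters ∪ ({.neg .top} ∪ {ψ | ψ ∈ Finset.univ.toList.map χ}) := by
      rw [← RatExp.letters_ofLetters]
      rfl
    rw [this]
    ext ψ
    have := @hr ψ
    simp only [Set.mem_insert_iff, Set.mem_union, Set.mem_singleton_iff, Set.mem_ofPred_eq,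
      List.mem_map, Finset.mem_toList, Finset.mem_univ, true_and, Set.mem_range] at this ⊢
    tauto
  have hmatch : ∀ ρ ks, re.Matches ρ.sat ks ↔ L (ks.map fun k => {i | P i ρ k}) := by
    intro ρ ks
    have h1 : re.Matches ρ.sat ks ↔ r.Matches ρ.sat ks := by
      rw [hre, RatExp.matches_plus, RatExp.matches_comp, or_iff_left]
      rintro ⟨u, v, -, h, -⟩
      obtain ⟨k, -, h⟩ := (RatExp.matches_letter _ _ _).1 h
      exact (RatMTL.sat_neg ..).1 h (RatMTL.sat_top ..)
    have h2 : ∀ w, List.Forall₂ (fun x k => (χ x).Sat ρ k) w ks ↔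
        w = ks.map fun k => {i | P i ρ k} := by
      intro w
      have h3 : (fun x k => (χ x).Sat ρ k) = fun x k => x = {i | P i ρ k} :=
        funext fun x => funext fun k => propext ((hχ' x ρ k).trans eq_comm)
      rw [h3, ← List.forall₂_map_right_iff (R := fun x y => x = y), List.forall₂_eq_eq_eq]
    rw [h1, hr']
    simp only [h2, exists_eq_right]
  refine ⟨re, fun hs => ⟨?_, ?_⟩, hmatch⟩
  · subst hs
    obtain ⟨e, he⟩ := hL
    have hmarks : ∀ ρ k, re.marks ρ k = {χ {i | P i ρ k}} := by
      intro ρ k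
      ext ψ
      change re.Marked ρ k ψ ↔ _
      rw [RatExp.marked_iff, hlet, Set.mem_singleton_iff]
      constructor
      · rintro ⟨rfl | ⟨Y, rfl⟩, h⟩
        · exact absurd (RatMTL.sat_top ..) ((RatMTL.sat_neg ..).1 h)
        · rw [(hχ' Y ρ k).1 h]
      · rintro rfl
        exact ⟨Or.inr ⟨_, rfl⟩, (hχ' _ ρ k).2 rfl⟩
    refine ⟨e.mapLetters fun Y => {χ Y}, fun ρ i j => ?_⟩
    have h1 := RatExp.nonempty_iff re ρ (ρ.positions fun k => i ≤ k ∧ k ≤ j)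
    refine Iff.trans ?_ (h1.trans (hmatch ρ _)).symm
    rw [← he, List.map_congr_left fun k _ => hmarks ρ k]
    have h2 := StarFreeExp.map_mem_mapLetters e (g := fun Y => ({χ Y} : Set (RatMTL AP)))
      (w := (ρ.positions fun k => i ≤ k ∧ k ≤ j).map fun k => {i | P i ρ k})
    rw [List.map_map] at h2
    refine h2 ?_
    intro x hx y hxy
    obtain ⟨k, -, rfl⟩ := List.mem_map.1 hx
    have h2 : χ {i | P i ρ k} = χ y := Set.singleton_injective hxy
    have h3 := (hχ' _ ρ k).2 rfl
    rw [h2] at h3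
    exact (hχ' y ρ k).1 h3
  · rw [RatExp.lettersSfr_iff, hlet]
    rintro ψ (rfl | ⟨Y, rfl⟩)
    exacts [trivial, hχ Y hs]

theorem rat {ι : Type} [Finite ι] {P : ι → PosProp AP} (hP : ∀ i, Expressible sf (P i))
    {L : List (Set ι) → Prop} (hL : Cls sf L) (I : TimeInterval) :
    Expressible sf fun ρ k =>
      L ((ρ.positions fun j => ρ.time j - ρ.time k ∈ I.toSet).map fun j => {i | P i ρ j}) := by
  obtain ⟨re, h, h'⟩ := exists_ratExp hP hL
  exact ⟨.rat I re, h, fun ρ k => (RatMTL.sat_rat ..).trans (h' ρ _)⟩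

theorem urat {ι : Type} [Finite ι] {P : ι → PosProp AP} (hP : ∀ i, Expressible sf (P i))
    {L : List (Set ι) → Prop} (hL : Cls sf L) (hQ : Expressible sf Q) (I : TimeInterval) :
    Expressible sf fun ρ k => ∃ j, k < j ∧ Q ρ j ∧ ρ.time j - ρ.time k ∈ I.toSet ∧
      L ((ρ.positions fun i => k < i ∧ i < j).map fun j => {i | P i ρ j}) := by
  obtain ⟨re, h, h'⟩ := exists_ratExp hP hL
  obtain ⟨φ, g, g'⟩ := hQ
  refine ⟨.urat .top I re φ, fun hs => ⟨trivial, g hs, h hs⟩, fun ρ k => ?_⟩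
  rw [RatMTL.sat_urat]
  refine exists_congr fun j => and_congr_right fun _ => and_congr (g' ρ j) (and_congr_right
    fun _ => ?_)
  exact (and_iff_right fun _ _ _ => RatMTL.sat_top ..).trans (h' ρ _)

end Expressible

/-! ### Regions -/

/-- The number of the region of a clock value: `2 n` for `n`, `2 n + 1` for the open interval
between `n` and `n + 1`, and `2 K + 1` for all values above `K`. -/
noncomputable def region (K : ℕ) (v : ℝ) : ℕ := min (⌊v⌋₊ + ⌈v⌉₊) (2 * K + 1)

theorem region_mono (K : ℕ) : Monotone (region K) := fun _ _ h =>
  min_le_min (add_le_add (Nat.floor_mono h) (Nat.ceil_mono h)) le_rfl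

theorem two_mul_le_region {K a : ℕ} (ha : a ≤ K) {v : ℝ} (hv : 0 ≤ v) :
    2 * a ≤ region K v ↔ (a : ℝ) ≤ v := by
  rw [region, ← Nat.le_floor_iff hv]
  have h1 := Nat.floor_le_ceil v
  have h2 := Nat.ceil_le_floor_add_one v
  omega

theorem two_mul_lt_region {K a : ℕ} (ha : a ≤ K) {v : ℝ} :
    2 * a < region K v ↔ (a : ℝ) < v := by
  rw [region, ← Nat.lt_ceil]
  have h1 := Nat.floor_le_ceil v
  have h2 := Nat.ceil_le_floor_add_one v
  omega

/-- Membership of a region in a time interval. -/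
def TimeInterval.HasRegion : TimeInterval → ℕ → Prop
  | .icc a b, r => 2 * a ≤ r ∧ ¬ 2 * b < r
  | .ico a b, r => 2 * a ≤ r ∧ ¬ 2 * b ≤ r
  | .ioc a b, r => 2 * a < r ∧ ¬ 2 * b < r
  | .ioo a b, r => 2 * a < r ∧ ¬ 2 * b ≤ r
  | .ici a, r => 2 * a ≤ r
  | .ioi a, r => 2 * a < r

/-- A bound for the end points of a time interval. -/
def TimeInterval.bound : TimeInterval → ℕ
  | .icc a b => max a b
  | .ico a b => max a b
  | .ioc a b => max a b
  | .ioo a b => max a b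
  | .ici a => a
  | .ioi a => a

theorem TimeInterval.hasRegion_iff (I : TimeInterval) {K : ℕ} (hK : I.bound ≤ K) {v : ℝ}
    (hv : 0 ≤ v) : I.HasRegion (region K v) ↔ v ∈ I.toSet := by
  cases I <;> simp only [bound, max_le_iff] at hK <;>
    simp [HasRegion, toSet, two_mul_le_region, two_mul_lt_region, hK, hv]

theorem TimeInterval.nonneg (I : TimeInterval) {v : ℝ} (hv : v ∈ I.toSet) : 0 ≤ v := by
  cases I
  exacts [(Nat.cast_nonneg _).trans hv.1, (Nat.cast_nonneg _).trans hv.1,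
    (Nat.cast_nonneg _).trans hv.1.le, (Nat.cast_nonneg _).trans hv.1.le,
    (Nat.cast_nonneg _).trans hv, (Nat.cast_nonneg _).trans (le_of_lt hv)]

theorem exists_interval_region {K r : ℕ} (hr : r ≤ 2 * K + 1) :
    ∃ I : TimeInterval, ∀ v : ℝ, 0 ≤ v → (v ∈ I.toSet ↔ region K v = r) := by
  have hle : ∀ v, region K v ≤ 2 * K + 1 := fun v => min_le_right _ _
  obtain ⟨n, rfl | rfl⟩ : ∃ n, r = 2 * n ∨ r = 2 * n + 1 := ⟨r / 2, by omega⟩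
  · refine ⟨.icc n n, fun v hv => ?_⟩
    rw [← TimeInterval.hasRegion_iff (K := K) _ (by simp [TimeInterval.bound]; omega) hv]
    simp only [TimeInterval.HasRegion]
    omega
  · by_cases hn : n = K
    · subst hn
      refine ⟨.ioi n, fun v hv => ?_⟩
      rw [← TimeInterval.hasRegion_iff (K := n) _ le_rfl hv]
      simp only [TimeInterval.HasRegion]
      have := hle v
      omega
    · refine ⟨.ioo n (n + 1), fun v hv => ?_⟩
      rw [← TimeInterval.hasRegion_iff (K := K) _ (by simp [TimeInterval.bound]; omega) hv]
      simp only [TimeInterval.HasRegion]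
      omega

theorem TimedWord.sub_nonneg_of_lt {AP : Type u} (ρ : TimedWord AP) {k j : ρ.Pos} (h : k < j) :
    0 ≤ ρ.time j - ρ.time k := sub_nonneg.2 (ρ.time_mono h.le)

-- Expressing the future region by region

namespace Expressible
variable {AP : Type u} {sf : Bool} {ι : Type} [Finite ι] {P : ι → PosProp AP}

/-- `Rat` over `[0, 0]` would include earlier simultaneous positions. Instead `URat` over `[0, 0]`
aims at the last simultaneous position; the marking `Y` there is guessed and removed from `L` by a
right quotient. -/
theorem simultaneous (hP : ∀ i, Expressible sf (P i)) {L : List (Set ι) → Prop}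
    (hL : Cls sf L) : Expressible sf fun ρ k =>
      L ((ρ.positions fun j => k < j ∧ ρ.time j = ρ.time k).map fun j => {i | P i ρ j}) := by
  have h1 : Expressible sf fun (ρ : TimedWord AP) k => ∃ j, k < j ∧ ρ.time j = ρ.time k :=
    (urat (ι := Empty) (P := nofun) nofun (Cls.const True) (const True) (.icc 0 0)).congr
      fun ρ k => by simp [TimeInterval.toSet, sub_eq_zero]
  have h2 : Expressible sf fun ρ k => ∃ Y : Set ι, ∃ j, k < j ∧
      ({i | P i ρ j} = Y ∧ ¬ ∃ i, j < i ∧ ρ.time i = ρ.time j) ∧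
      ρ.time j - ρ.time k ∈ (TimeInterval.icc 0 0).toSet ∧
      L (((ρ.positions fun i => k < i ∧ i < j).map fun j => {i | P i ρ j}) ++ [Y]) :=
    finExists fun Y => urat hP (hL.rightQuotient [Y]) ((setEq hP Y).and h1.not) (.icc 0 0)
  refine ((h1.not.and (const (L []))).or h2).congr fun ρ k => ?_
  by_cases hk : ∃ j, k < j ∧ ρ.time j = ρ.time k
  · have hpos : ∀ j, k < j → ρ.time j = ρ.time k → (¬ ∃ i, j < i ∧ ρ.time i = ρ.time j) →
        (ρ.positions fun j => k < j ∧ ρ.time j = ρ.time k) =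
          (ρ.positions fun i => k < i ∧ i < j) ++ [j] := by
      intro j hkj hj hlast
      rw [← ρ.positions_eq_singleton, ← ρ.positions_append (fun i i' h h' => by rw [h']; exact h.2)]
      refine ρ.positions_congr fun i => ⟨fun h => ?_, ?_⟩
      · rcases lt_trichotomy i j with hij | hij | hij
        · exact Or.inl ⟨h.1, hij⟩
        · exact Or.inr hij
        · exact absurd ⟨i, hij, h.2.trans hj.symm⟩ hlast
      · rintro (⟨h, h'⟩ | rfl)
        · exact ⟨h, le_antisymm (hj ▸ ρ.time_mono h'.le) (ρ.time_mono h.le)⟩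
        · exact ⟨hkj, hj⟩
    constructor
    · intro h
      obtain ⟨j, ⟨hkj, hj⟩, hmax⟩ := Set.exists_max_image
        {j | k < j ∧ ρ.time j = ρ.time k} id (Set.toFinite _) hk
      have hlast : ¬ ∃ i, j < i ∧ ρ.time i = ρ.time j := by
        rintro ⟨i, hji, hi⟩
        exact absurd (hmax i ⟨hkj.trans hji, hi.trans hj⟩) (not_le.2 hji)
      refine Or.inr ⟨_, j, hkj, ⟨rfl, hlast⟩, by simp [TimeInterval.toSet, hj], ?_⟩
      rw [hpos j hkj hj hlast, List.map_append] at h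
      exact h
    · rintro (⟨h, -⟩ | ⟨_, j, hkj, ⟨rfl, hlast⟩, hj, h⟩)
      · exact absurd hk h
      · have hj : ρ.time j = ρ.time k := by simpa [TimeInterval.toSet, sub_eq_zero] using hj
        rw [hpos j hkj hj hlast, List.map_append]
        exact h
  · rw [ρ.positions_eq_nil fun j hj => hk ⟨j, hj⟩]
    constructor
    · exact fun h => Or.inl ⟨hk, h⟩
    · rintro (⟨-, h⟩ | ⟨_, j, hkj, -, hj, -⟩)
      · exact h
      · exact absurd ⟨j, hkj, by simpa [TimeInterval.toSet, sub_eq_zero] using hj⟩ hk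

/-- A region other than `0` excludes distance zero, so `Rat` over its interval sees only positions
after `k`. Region `0` is the case `simultaneous`, and regions beyond `2 * K + 1` are empty. -/
theorem inRegion (hP : ∀ i, Expressible sf (P i)) {L : List (Set ι) → Prop}
    (hL : Cls sf L) (K r : ℕ) : Expressible sf fun ρ k =>
      L ((ρ.positions fun j => k < j ∧ region K (ρ.time j - ρ.time k) = r).map
        fun j => {i | P i ρ j}) := by
  rcases Nat.eq_zero_or_pos r with rfl | hr
  · refine (simultaneous hP hL).congr fun ρ k => ?_
    rw [ρ.positions_congr fun j => and_congr_right fun h => ?_]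
    have := (two_mul_lt_region (K := K) (Nat.zero_le K) (v := ρ.time j - ρ.time k))
    have h2 := ρ.sub_nonneg_of_lt h
    constructor
    · intro h0
      rw [h0] at this
      have := not_lt.1 (fun h => absurd (this.2 h) (by simp))
      push_cast at this
      linarith
    · intro h0
      by_contra hne
      have := this.1 (by omega)
      push_cast at this
      linarith
  by_cases hK : r ≤ 2 * K + 1
  · obtain ⟨I, hI⟩ := exists_interval_region hK
    refine (rat hP hL I).congr fun ρ k => ?_
    rw [ρ.positions_congr fun j => ?_]
    constructor
    · rintro ⟨h1, h2⟩
      exact (hI _ (ρ.sub_nonneg_of_lt h1)).2 h2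
    · intro h1
      have h2 := (hI _ (I.nonneg h1)).1 h1
      refine ⟨ρ.time_mono.reflect_lt (lt_of_le_of_ne (sub_nonneg.1 (I.nonneg h1)) fun h0 => ?_), h2⟩
      rw [h0, sub_self] at h2
      simp [region] at h2
      omega
  · refine (const (L [])).congr fun ρ k => ?_
    rw [ρ.positions_eq_nil fun j hj => ?_]
    · rfl
    · have : region K (ρ.time j - ρ.time k) ≤ 2 * K + 1 := min_le_right _ _
      omega

/-- The regions increase along the word, so `Cls.split` can peel off the last one; within a region
the membership in all intervals is constant and can be hard-wired into the language. -/
theorem future {κ : Type} [Finite κ] (I : κ → TimeInterval) (hP : ∀ i, Expressible sf (P i))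
    {L : List (Set ι × Set κ) → Prop} (hL : Cls sf L) :
    Expressible sf fun ρ k => L ((ρ.after k).map (obs P I ρ k)) := by
  obtain ⟨K, hK⟩ : ∃ K, ∀ i, (I i).bound ≤ K := by
    obtain ⟨K, hK⟩ := (Set.finite_range fun i => (I i).bound).bddAbove
    exact ⟨K, fun i => hK ⟨i, rfl⟩⟩
  have key : ∀ (N : ℕ) {L : List (Set ι × Set κ) → Prop}, Cls sf L →
      Expressible sf fun ρ k => L ((ρ.positions fun j => k < j ∧
        region K (ρ.time j - ρ.time k) < N).map (obs P I ρ k)) := by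
    intro N
    induction N with
    | zero =>
      intro L _
      refine (const (L [])).congr fun ρ k => ?_
      rw [ρ.positions_eq_nil (by simp)]
      rfl
    | succ N ih =>
      intro L hL
      obtain ⟨J, _, U, V, hU, hV, h⟩ := hL.split
      have hV' : ∀ i, Cls sf fun w : List (Set ι) =>
          V i (w.map fun Y => (Y, {i | (I i).HasRegion N})) := fun i => (hV i).map _
      refine (finExists fun i => (ih (hU i)).and (inRegion hP (hV' i) K N)).congr fun ρ k => ?_
      rw [ρ.positions_congr (q := fun j => (k < j ∧ region K (ρ.time j - ρ.time k) < N) ∨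
          (k < j ∧ region K (ρ.time j - ρ.time k) = N)) (fun j => by
            rw [← and_or_left, Nat.lt_succ_iff_lt_or_eq]), ρ.positions_append, List.map_append, h]
      · refine exists_congr fun i => and_congr_right fun _ => iff_of_eq (congrArg _ ?_)
        rw [List.map_map]
        refine List.map_congr_left fun j hj => ?_
        obtain ⟨h1, rfl⟩ := ρ.mem_positions.1 hj
        refine Prod.ext rfl (Set.ext fun i => ?_)
        exact ((I i).hasRegion_iff (hK i) (ρ.sub_nonneg_of_lt h1)).symm
      · rintro i j ⟨-, h1⟩ ⟨-, rfl⟩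
        by_contra hn
        exact absurd (region_mono K (sub_le_sub_right (ρ.time_mono (not_lt.1 hn)) _)) (not_le.2 h1)
  refine (key (2 * K + 2) hL).congr fun ρ k => ?_
  rw [TimedWord.after, ρ.positions_congr fun j => (and_iff_left ?_).symm]
  exact Nat.lt_succ_of_le (min_le_right _ _)

end Expressible

theorem Definable.expressible {AP : Type u} [Finite AP] {sf : Bool} {P : PosProp AP}
    (hP : Definable sf False P) : Expressible sf P := by
  induction hP with
  | letter T => exact .letter T
  | not _ ih => exact ih.not
  | and _ _ ih ih' => exact ih.and ih'
  | future I _ hL ih => exact .future I ih hL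
  | start h => exact h.elim

/-! ### Formulae define definable properties -/

theorem TimeInterval.ordConnected (I : TimeInterval) : I.toSet.OrdConnected := by
  cases I
  exacts [Set.ordConnected_Icc, Set.ordConnected_Ico, Set.ordConnected_Ioc, Set.ordConnected_Ioo,
    Set.ordConnected_Ici, Set.ordConnected_Ioi]

namespace TimedWord
variable {AP : Type u} (ρ : TimedWord AP)

/-- The list consists of consecutive positions. -/
def Segment (ks : List ρ.Pos) : Prop :=
  ks = [] ∨ ∃ i j, ks = ρ.positions fun k => i ≤ k ∧ k ≤ j

theorem segment_positions {p : ρ.Pos → Prop} (hp : ∀ i j k, i ≤ j → j ≤ k → p i → p k → p j) :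
    ρ.Segment (ρ.positions p) := by
  by_cases h : ∃ k, p k
  · obtain ⟨i, hi, hi'⟩ := Set.exists_min_image {k | p k} id (Set.toFinite _) h
    obtain ⟨j, hj, hj'⟩ := Set.exists_max_image {k | p k} id (Set.toFinite _) h
    exact Or.inr ⟨i, j, ρ.positions_congr fun k =>
      ⟨fun hk => ⟨hi' k hk, hj' k hk⟩, fun hk => hp i k j hk.1 hk.2 hi hj⟩⟩
  · exact Or.inl (ρ.positions_eq_nil fun k hk => h ⟨k, hk⟩)

theorem after_eq_append_cons {j k : ρ.Pos} {l l' : List ρ.Pos} :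
    ρ.after k = l ++ j :: l' ↔
      k < j ∧ l = (ρ.positions fun i => k < i ∧ i < j) ∧ l' = ρ.after j := by
  constructor
  · intro h
    have h1 := ρ.positions_pairwise fun j => k < j
    have hmem : ∀ i, k < i ↔ i ∈ l ∨ i = j ∨ i ∈ l' := fun i => by
      rw [← ρ.mem_after, h, List.mem_append, List.mem_cons]
    rw [after] at h
    rw [h, List.pairwise_append, List.pairwise_cons] at h1
    obtain ⟨h1, ⟨h2, h3⟩, h4⟩ := h1
    refine ⟨(hmem j).2 (by simp), ρ.eq_positions h1 fun i => ⟨fun hi => ?_, fun hi => ?_⟩,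
      ρ.eq_positions h3 fun i => ⟨h2 i, fun hi => ?_⟩⟩
    · exact ⟨(hmem i).2 (Or.inl hi), h4 i hi j (by simp)⟩
    · rcases (hmem i).1 hi.1 with h | rfl | h
      exacts [h, absurd hi.2 (lt_irrefl _), absurd (h2 i h) (lt_asymm hi.2)]
    · rcases (hmem i).1 (((hmem j).2 (by simp)).trans hi) with h | rfl | h
      exacts [absurd (h4 i h j (by simp)) (lt_asymm hi), absurd hi (lt_irrefl _), h]
  · rintro ⟨hkj, rfl, rfl⟩
    rw [after, ρ.positions_congr (q := fun i => (k < i ∧ i < j) ∨ (i = j ∨ j < i)) fun i => ?_,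
      ρ.positions_append, ρ.positions_append, ρ.positions_eq_singleton]
    · rfl
    · rintro i i' rfl h
      exact h
    · rintro i i' h (rfl | h')
      exacts [h.2, h.2.trans h']
    · constructor
      · intro h
        rcases lt_trichotomy i j with hij | hij | hij
        exacts [Or.inl ⟨h, hij⟩, Or.inr (Or.inl hij), Or.inr (Or.inr hij)]
      · rintro (h | rfl | h)
        exacts [h.1, hkj, hkj.trans h]

end TimedWord

section
variable {AP : Type u}

theorem RatExp.cls_matches {ι : Type} [Finite ι] (v : ι → RatMTL AP) : ∀ re : RatExp AP,
    Cls false fun w : List (Set ι) => re.Matches (fun ψ Y => ∃ i ∈ Y, v i = ψ) w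
  | .eps => Cls.nil.congr fun w => matches_eps _ w
  | .letter φ => (Cls.letter fun Y => ∃ i ∈ Y, v i = φ).congr fun w => matches_letter _ φ w
  | .comp r s => ((cls_matches v r).concat (cls_matches v s)).congr fun w => matches_comp _ r s w
  | .plus r s => ((cls_matches v r).or (cls_matches v s)).congr fun w => matches_plus _ r s w
  | .star r => (cls_matches v r).star.congr fun w => matches_star _ r w

/-- On consecutive positions, a rational expression is given by a language of the class. -/
theorem RatExp.exists_cls {sf : Bool} (re : RatExp AP) (hre : sf = true → re.HasStarFree)
    {ι : Type} [Finite ι] (v : ι → RatMTL AP) (hv : Set.range v = re.letters) :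
    ∃ L : List (Set ι) → Prop, Cls sf L ∧ ∀ (ρ : TimedWord AP) (ks : List ρ.Pos),
      ρ.Segment ks → (re.Matches ρ.sat ks ↔ L (ks.map fun k => {i | (v i).Sat ρ k})) := by
  cases sf
  · refine ⟨_, re.cls_matches v, fun ρ ks hks => ?_⟩
    clear hks
    refine exists_congr fun w => and_congr_right fun hw => ?_
    rw [List.forall₂_map_right_iff]
    have hw' := mem_letters_of_mem_lang re w hw
    rw [← hv] at hw'
    clear hw
    constructor
    · intro h
      induction h with
      | nil => exact .nil
      | cons h _ ih =>
        obtain ⟨i, rfl⟩ := hw' _ (List.mem_cons_self ..)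
        exact .cons ⟨i, h, rfl⟩ (ih fun ψ hψ => hw' ψ (List.mem_cons_of_mem _ hψ))
    · intro h
      refine h.imp ?_
      rintro ψ k ⟨i, hi, rfl⟩
      exact hi
  · obtain ⟨e, he⟩ := hre rfl
    have hc : Cls true fun w => w ∈ e.lang := ⟨e, fun w => Iff.rfl⟩
    refine ⟨_, hc.map fun Y : Set ι => v '' Y, fun ρ ks hks => ?_⟩
    have hmarks : ∀ (ρ : TimedWord AP) k, v '' {i | (v i).Sat ρ k} = re.marks ρ k := by
      intro ρ k
      ext ψ
      change _ ↔ re.Marked ρ k ψ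
      rw [marked_iff, ← hv]
      constructor
      · rintro ⟨i, hi, rfl⟩
        exact ⟨⟨i, rfl⟩, hi⟩
      · rintro ⟨⟨i, rfl⟩, hi⟩
        exact ⟨i, hi, rfl⟩
    have key : ∀ (ρ : TimedWord AP) i j, re.Matches ρ.sat (ρ.positions fun k => i ≤ k ∧ k ≤ j) ↔
        (ρ.positions fun k => i ≤ k ∧ k ≤ j).map (re.marks ρ) ∈ e.lang := fun ρ i j =>
      (re.nonempty_iff ρ _).symm.trans (he ρ i j).symm
    rw [List.map_map, show (fun Y => v '' Y) ∘ (fun k => {i | (v i).Sat ρ k}) = re.marks ρ from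
      funext (hmarks ρ)]
    rcases hks with rfl | ⟨i, j, rfl⟩
    -- The empty block arises from end points in the wrong order, which needs two positions; `ρ` may
    -- have only one.
    · let ρ' : TimedWord AP := ⟨1, fun _ => ρ.letter 0, fun _ => 0, monotone_const, rfl⟩
      have h1 : (ρ'.positions fun k => (1 : Fin 2) ≤ k ∧ k ≤ (0 : Fin 2)) = [] :=
        ρ'.positions_eq_nil fun k hk =>
          absurd (hk.1.trans hk.2) (by decide : ¬ (1 : Fin 2) ≤ (0 : Fin 2))
      have h2 := key ρ' (1 : Fin 2) (0 : Fin 2)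
      rw [h1] at h2
      refine Iff.trans ?_ h2
      exact exists_congr fun w => and_congr_right fun _ => by
        rw [List.forall₂_nil_right_iff, List.forall₂_nil_right_iff]
    · exact key ρ i j

namespace Definable
variable {sf : Bool} {p : Prop} {ι : Type} [Finite ι] {P : ι → PosProp AP}

theorem within (hP : ∀ i, Definable sf p (P i)) (I : TimeInterval) {L : List (Set ι) → Prop}
    (hL : Cls sf L) : Definable sf p fun ρ k =>
      L ((ρ.positions fun j => k < j ∧ ρ.time j - ρ.time k ∈ I.toSet).map
        fun j => {i | P i ρ j}) := by
  classical
  refine (future (κ := Unit) (fun _ => I) hP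
    (hL.filterMap fun x => if () ∈ x.2 then some x.1 else none)).congr fun ρ k => ?_
  rw [← ρ.filter_positions (fun j => k < j)]
  refine iff_of_eq (congrArg L ?_)
  change _ = ((ρ.positions fun j => k < j).map _).filterMap _
  induction ρ.positions fun j => k < j with
  | nil => rfl
  | cons j l ih =>
    by_cases h : ρ.time j - ρ.time k ∈ I.toSet
    · rw [List.filter_cons_of_pos (by simpa using h), List.map_cons, ih, List.map_cons,
        List.filterMap_cons_some (b := {i | P i ρ j})]
      simp [obs, h]
    · rw [List.filter_cons_of_neg (by simpa using h), ih, List.map_cons, List.filterMap_cons_none]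
      simp [obs, h]

theorem within_self (hP : ∀ i, Definable sf p (P i)) (I : TimeInterval) {L : List (Set ι) → Prop}
    (hL : Cls sf L) : Definable sf p fun ρ k =>
      L ({i | P i ρ k} :: (ρ.positions fun j => k < j ∧ ρ.time j - ρ.time k ∈ I.toSet).map
        fun j => {i | P i ρ j}) := by
  refine (finExists fun Y => (setEq hP Y).and (within hP I (hL.leftQuotient [Y]))).congr
    fun ρ k => ?_
  simp

/-- If `0 ∉ I`, the positions seen lie strictly after `k`. Otherwise they begin with the first
position simultaneous with `k`; this is the only use of `start`. -/
theorem rat (hp : p) (hP : ∀ i, Definable sf p (P i)) (I : TimeInterval)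
    {L : List (Set ι) → Prop} (hL : Cls sf L) : Definable sf p fun ρ k =>
      L ((ρ.positions fun j => ρ.time j - ρ.time k ∈ I.toSet).map fun j => {i | P i ρ j}) := by
  by_cases h0 : (0 : ℝ) ∈ I.toSet
  · refine (start hp (within_self hP I hL)).congr fun ρ k => ?_
    rw [ρ.positions_eq_cons (k := ρ.blockStart k), List.map_cons]
    · simp only [ρ.time_blockStart]
    · rwa [ρ.time_blockStart, sub_self]
    · intro j hj
      have h1 := sub_nonneg.1 (I.nonneg hj)
      by_contra hn
      have h2 := ρ.time_mono (not_le.1 hn).le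
      rw [ρ.time_blockStart] at h2
      exact hn (ρ.blockStart_le (le_antisymm h2 h1))
  · refine (within hP I hL).congr fun ρ k => ?_
    rw [ρ.positions_congr fun j => ⟨fun h => ⟨?_, h⟩, And.right⟩]
    have h1 := sub_nonneg.1 (I.nonneg h)
    refine ρ.time_mono.reflect_lt (lt_of_le_of_ne h1 fun h2 => h0 ?_)
    rwa [h2, sub_self] at h

theorem urat {Q Q' : PosProp AP} (hP : ∀ i, Definable sf p (P i)) (hQ : Definable sf p Q)
    (hQ' : Definable sf p Q') (I : TimeInterval) {L : List (Set ι) → Prop} (hL : Cls sf L) :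
    Definable sf p fun ρ k => ∃ j, k < j ∧ Q' ρ j ∧ ρ.time j - ρ.time k ∈ I.toSet ∧
      (∀ i, k < i → i < j → Q ρ i) ∧
        L ((ρ.positions fun i => k < i ∧ i < j).map fun j => {i | P i ρ j}) := by
  -- In the alphabet, `none` stands for `Q`, `some none` for `Q'` and `some (some i)` for `P i`.
  have h1 : Cls sf fun w : List (Set (Option (Option ι)) × Set Unit) => ∃ u v, w = u ++ v ∧
      ((∀ y ∈ u, none ∈ y.1) ∧ L (u.map fun y => {i | some (some i) ∈ y.1})) ∧
        ∃ x t, v = x :: t ∧ (some none ∈ x.1 ∧ () ∈ x.2) ∧ True :=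
    ((Cls.all _).and (hL.map _)).concat (Cls.cons (Cls.const True))
  let R : Option (Option ι) → PosProp AP := fun i => i.elim Q fun i => i.elim Q' P
  refine (future (P := R) (fun _ => I) ?_ h1).congr
    fun ρ k => ?_
  · rintro (_ | _ | i)
    exacts [hQ, hQ', hP i]
  · constructor
    · rintro ⟨j, hkj, h1, h2, h3, h4⟩
      refine ⟨(ρ.positions fun i => k < i ∧ i < j).map (obs R (fun _ => I) ρ k),
        obs R (fun _ => I) ρ k j :: (ρ.after j).map (obs R (fun _ => I) ρ k), ?_, ⟨?_, ?_⟩,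
        obs R (fun _ => I) ρ k j, _, rfl, ⟨h1, h2⟩, trivial⟩
      · rw [ρ.after_eq_append_cons.2 ⟨hkj, rfl, rfl⟩, List.map_append, List.map_cons]
      · intro y hy
        obtain ⟨i, hi, rfl⟩ := List.mem_map.1 hy
        have hi := ρ.mem_positions.1 hi
        exact h3 i hi.1 hi.2
      · rw [List.map_map]
        exact h4
    · rintro ⟨_, _, h, ⟨h1, h2⟩, _, _, rfl, ⟨h3, h4⟩, -⟩
      obtain ⟨l, l', hl, rfl, h5⟩ := List.map_eq_append_iff.1 h
      obtain ⟨j, l', rfl, rfl, rfl⟩ := List.map_eq_cons_iff.1 h5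
      obtain ⟨hkj, rfl, rfl⟩ := ρ.after_eq_append_cons.1 hl
      refine ⟨j, hkj, h3, h4, fun i hi hij => ?_, ?_⟩
      · exact h1 _ (List.mem_map_of_mem (ρ.mem_positions.2 ⟨hi, hij⟩))
      · rw [List.map_map] at h2
        exact h2

end Definable

theorem RatExp.exists_enum (re : RatExp AP) :
    ∃ (n : ℕ) (v : Fin n → RatMTL AP), Set.range v = re.letters := by
  have := re.letters_finite.to_subtype
  obtain ⟨n, ⟨f⟩⟩ := Finite.exists_equiv_fin re.letters
  exact ⟨n, fun i => (f.symm i).1, by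
    ext ψ
    constructor
    · rintro ⟨i, rfl⟩
      exact (f.symm i).2
    · intro hψ
      exact ⟨f ⟨ψ, hψ⟩, by simp⟩⟩

mutual

theorem RatMTL.definable {sf : Bool} : ∀ φ : RatMTL AP, (sf = true → φ.IsSfr) →
    Definable sf True fun ρ k => φ.Sat ρ k
  | .atom a, _ => (Definable.letter {A | a ∈ A.1}).congr fun ρ k => RatMTL.sat_atom ..
  | .top, _ => (Definable.const True).congr fun ρ k => iff_true_intro (RatMTL.sat_top ..)
  | .and φ ψ, h => ((RatMTL.definable φ fun hs => (h hs).1).and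
      (RatMTL.definable ψ fun hs => (h hs).2)).congr fun ρ k => RatMTL.sat_and ..
  | .neg φ, h => (RatMTL.definable φ h).not.congr fun ρ k => RatMTL.sat_neg ..
  | .rat I re, h => by
    obtain ⟨n, v, hv⟩ := re.exists_enum
    have hd := RatExp.definable re fun hs => (h hs).2
    obtain ⟨L, hL, hL'⟩ := re.exists_cls (fun hs => (h hs).1) v hv
    refine (Definable.rat trivial (P := fun i ρ k => (v i).Sat ρ k)
      (fun i => hd _ (hv ▸ ⟨i, rfl⟩)) I hL).congr fun ρ k => ?_
    rw [RatMTL.sat_rat, hL']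
    refine ρ.segment_positions fun i j l hij hjl hi hl => I.ordConnected.out hi hl ⟨?_, ?_⟩
    · exact sub_le_sub_right (ρ.time_mono hij) _
    · exact sub_le_sub_right (ρ.time_mono hjl) _
  | .urat φ I re ψ, h => by
    obtain ⟨n, v, hv⟩ := re.exists_enum
    have hd := RatExp.definable re fun hs => (h hs).2.2.2
    have h1 := RatMTL.definable φ fun hs => (h hs).1
    have h2 := RatMTL.definable ψ fun hs => (h hs).2.1
    obtain ⟨L, hL, hL'⟩ := re.exists_cls (fun hs => (h hs).2.2.1) v hv
    refine (Definable.urat (P := fun i ρ k => (v i).Sat ρ k)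
      (fun i => hd _ (hv ▸ ⟨i, rfl⟩)) h1 h2 I hL).congr fun ρ k => ?_
    rw [RatMTL.sat_urat]
    refine exists_congr fun j => and_congr_right fun _ => and_congr_right fun _ =>
      and_congr_right fun _ => and_congr_right fun _ => hL' ρ _ (ρ.segment_positions ?_)
    exact fun i i' l hii hil hi hl => ⟨hi.1.trans_le hii, hil.trans_lt hl.2⟩

theorem RatExp.definable {sf : Bool} : ∀ re : RatExp AP, (sf = true → re.LettersSfr) →
    ∀ ψ ∈ re.letters, Definable sf True fun ρ k => ψ.Sat ρ k
  | .eps, _, ψ, hψ => hψ.elim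
  | .letter φ, h, ψ, hψ => by
    obtain rfl : ψ = φ := hψ
    exact RatMTL.definable ψ h
  | .comp r s, h, ψ, hψ => by
    rcases hψ with hψ | hψ
    exacts [RatExp.definable r (fun hs => (h hs).1) ψ hψ,
      RatExp.definable s (fun hs => (h hs).2) ψ hψ]
  | .plus r s, h, ψ, hψ => by
    rcases hψ with hψ | hψ
    exacts [RatExp.definable r (fun hs => (h hs).1) ψ hψ,
      RatExp.definable s (fun hs => (h hs).2) ψ hψ]
  | .star r, h, ψ, hψ => RatExp.definable r h ψ hψ

end

end

/-! ### Elimination of the first position with the same time stamp -/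

theorem TimedWord.blockStart_of_last {AP : Type u} (ρ : TimedWord AP) {j k : ρ.Pos}
    (hj : j.1 = k.1 + 1) (hk : ρ.time k < ρ.time j) : ρ.blockStart j = j := by
  refine ρ.eq_blockStart rfl fun i hi => ?_
  by_contra hn
  have hik : i ≤ k := Fin.le_def.2 (by have := Fin.lt_def.1 (not_le.1 hn); omega)
  have := ρ.time_mono hik
  linarith

section blockMachine
variable {ι' ι κ : Type} {β : ι → Type}

open Classical in
/-- The bits of the current block: they are read at its first position and kept afterwards. -/
noncomputable def blockBits {α : Type} (s : Option (Set ι')) (Y : Set (Option (ι' ⊕ α))) : Set ι' :=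
  s.elim {b | some (.inl b) ∈ Y} id

open Classical in
/-- The state after a position: `none` if the position is the last one of its block. -/
noncomputable def blockStep {α : Type} (s : Option (Set ι'))
    (x : Set (Option (ι' ⊕ α)) × Set κ) : Option (Set ι') :=
  if none ∈ x.1 then none else some (blockBits s x.1)

theorem foldl_blockStep_of_forall {α : Type} {c : Set ι'}
    {w : List (Set (Option (ι' ⊕ α)) × Set κ)} (h : ∀ x ∈ w, none ∉ x.1) :
    w.foldl blockStep (some c) = some c := by
  induction w with
  | nil => rfl
  | cons x w ih =>
    rw [List.foldl_cons, blockStep, if_neg (h x (by simp))]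
    exact ih fun y hy => h y (by simp [hy])

/-- After a nonempty word the state is `none` exactly if the last letter ends a block. It is `some
c` if no block has ended since some visit to `none` and the first letter after this visit has the
bits `c`, or if the run started in `some c` and no block has ended. Both conditions are star-free,
as `Cls.mealy` requires. -/
theorem cls_blockStep {α : Type} [Finite α] [Finite ι'] [Finite κ] {sf : Bool}
    (s t : Option (Set ι')) :
    Cls sf fun w : List (Set (Option (ι' ⊕ α)) × Set κ) => w.foldl blockStep s = t := by
  have h0 : ∀ s : Option (Set ι'), Cls sf fun w : List (Set (Option (ι' ⊕ α)) × Set κ) =>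
      w.foldl blockStep s = none := by
    intro s
    refine ((Cls.nil.and (Cls.const (s = none))).or ((Cls.const True).concat
      (Cls.letter fun x : Set (Option (ι' ⊕ α)) × Set κ => none ∈ x.1))).congr fun w => ?_
    rcases List.eq_nil_or_concat w with rfl | ⟨u, x, rfl⟩
    · simp
    · rw [List.concat_eq_append, List.foldl_append, List.foldl_cons, List.foldl_nil, blockStep]
      constructor
      · intro h
        by_cases hx : none ∈ x.1
        · exact Or.inr ⟨u, [x], rfl, trivial, x, rfl, hx⟩
        · simp [hx] at h
      · rintro (⟨h, -⟩ | ⟨u', _, h, -, y, rfl, hy⟩)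
        · simp at h
        · obtain ⟨-, h⟩ := List.append_inj' h rfl
          obtain rfl : x = y := by simpa using h
          rw [if_pos hy]
  cases t with
  | none => exact h0 s
  | some c =>
    refine (((Cls.all fun x : Set (Option (ι' ⊕ α)) × Set κ => none ∉ x.1).and
      (Cls.const (s = some c))).or ((h0 s).concat (Cls.cons
        (p := fun x => none ∉ x.1 ∧ {b | some (.inl b) ∈ x.1} = c)
          (Cls.all fun x => none ∉ x.1)))).congr fun w => ?_
    constructor
    · intro h
      induction w using List.reverseRecOn with
      | nil => exact Or.inl ⟨by simp, h⟩
      | append_singleton w x ih =>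
        rw [List.foldl_append, List.foldl_cons, List.foldl_nil, blockStep] at h
        by_cases hx : none ∈ x.1
        · simp [hx] at h
        rw [if_neg hx, Option.some_inj] at h
        rcases hs : w.foldl blockStep s with _ | d
        · rw [hs] at h
          exact Or.inr ⟨w, [x], rfl, hs, x, [], rfl, ⟨hx, h⟩, by simp⟩
        · rw [hs] at h
          obtain rfl : d = c := h
          have hall : ∀ {v : List (Set (Option (ι' ⊕ α)) × Set κ)}, (∀ y ∈ v, none ∉ y.1) →
              ∀ y ∈ v ++ [x], none ∉ y.1 := by
            intro v hv y hy
            rcases List.mem_append.1 hy with hy | hy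
            · exact hv y hy
            · rwa [List.mem_singleton.1 hy]
          rcases ih hs with ⟨h1, h2⟩ | ⟨u, _, rfl, h1, y, z, rfl, h2, h3⟩
          · exact Or.inl ⟨hall h1, h2⟩
          · exact Or.inr ⟨u, y :: (z ++ [x]), by simp, h1, y, _, rfl, h2, hall h3⟩
    · rintro (⟨h1, rfl⟩ | ⟨u, _, rfl, h1, y, z, rfl, ⟨h2, h3⟩, h4⟩)
      · exact foldl_blockStep_of_forall h1
      · rw [List.foldl_append, h1, List.foldl_cons, blockStep, if_neg h2,
          foldl_blockStep_of_forall h4]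
        exact congrArg some h3

/-- The output at a position: the properties that hold there, in the context of the block. -/
noncomputable def blockOut (s : Option (Set (Σ i, β i)))
    (x : Set (Option ((Σ i, β i) ⊕ Σ i, Set (β i))) × Set κ) : Set ι × Set κ :=
  ({i | some (.inr ⟨i, {d | ⟨i, d⟩ ∈ blockBits s x.1}⟩) ∈ x.1}, x.2)

end blockMachine

namespace Definable
variable {AP : Type u} {sf : Bool} {P : PosProp AP}

/-- A definable property depends on the earlier positions only through finitely many properties
of the first position with the same time stamp. -/
theorem exists_context (hP : Definable sf True P) :
    ∃ (ι : Type) (_ : Finite ι) (B : ι → PosProp AP) (R : Set ι → PosProp AP),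
      (∀ i, Definable sf False (B i)) ∧ (∀ c, Definable sf False (R c)) ∧
        ∀ ρ k, P ρ k ↔ R {i | B i ρ (ρ.blockStart k)} ρ k := by
  induction hP with
  | letter T => exact ⟨Empty, inferInstance, nofun, fun _ ρ k => ρ.letter k ∈ T, nofun,
      fun _ => .letter T, fun _ _ => Iff.rfl⟩
  | not _ ih =>
    obtain ⟨ι, _, B, R, hB, hR, h⟩ := ih
    exact ⟨ι, inferInstance, B, fun c ρ k => ¬ R c ρ k, hB, fun c => (hR c).not,
      fun ρ k => not_congr (h ρ k)⟩
  | and _ _ ih ih' =>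
    obtain ⟨ι, _, B, R, hB, hR, h⟩ := ih
    obtain ⟨ι', _, B', R', hB', hR', h'⟩ := ih'
    refine ⟨ι ⊕ ι', inferInstance, Sum.elim B B',
      fun c ρ k => R {i | .inl i ∈ c} ρ k ∧ R' {i | .inr i ∈ c} ρ k, ?_,
      fun c => (hR _).and (hR' _), fun ρ k => and_congr (h ρ k) (h' ρ k)⟩
    rintro (i | i)
    exacts [hB i, hB' i]
  | @start P _ _ ih =>
    obtain ⟨ι, _, B, R, hB, hR, h⟩ := ih
    -- The value at the block start becomes the single context bit; the position itself is no longer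
    -- consulted.
    refine ⟨Unit, inferInstance, fun _ ρ k => ∃ c, {i | B i ρ k} = c ∧ R c ρ k,
      fun c _ _ => () ∈ c, fun _ => finExists fun c => (setEq hB c).and (hR c),
      fun c => const _, fun ρ k => ?_⟩
    beta_reduce
    rw [h, ρ.blockStart_congr (ρ.time_blockStart k)]
    simp
  | @future ι κ _ _ P I L _ hL ih =>
    choose β hβ B R hB hR h using ih
    let J : Option ((Σ i, β i) ⊕ Σ i, Set (β i)) → PosProp AP := fun
      | none => fun ρ k => ∀ j, k < j → ρ.time k < ρ.time j
      | some (.inl b) => B b.1 b.2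
      | some (.inr d) => R d.1 d.2
    have hJ : ∀ i, Definable sf False (J i) := by
      rintro (_ | b | d)
      exacts [last, hB _ _, hR _ _]
    have hF : ∀ s : Option (Set (Σ i, β i)), Definable sf False fun ρ k =>
        L (mealyRun blockStep blockOut s ((ρ.after k).map (obs J I ρ k))) := fun s =>
      future I hJ (Cls.mealy _ _ cls_blockStep hL s)
    -- The machine starts in the state reached after `k`: the context `c` remains valid unless `k`
    -- ends its block.
    refine ⟨Σ i, β i, inferInstance, fun b => B b.1 b.2, fun c ρ k =>
      ((∀ j, k < j → ρ.time k < ρ.time j) ∧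
          L (mealyRun blockStep blockOut none ((ρ.after k).map (obs J I ρ k)))) ∨
        (¬ (∀ j, k < j → ρ.time k < ρ.time j) ∧
          L (mealyRun blockStep blockOut (some c) ((ρ.after k).map (obs J I ρ k)))),
      fun b => hB _ _, fun c => (last.and (hF _)).or (last.not.and (hF _)), fun ρ k => ?_⟩
    classical
    -- The observer `k₀`, from which time is measured, stays fixed while `k` moves backwards through
    -- the word.
    have key : ∀ k₀ k, mealyRun blockStep blockOut
        (if ∀ j, k < j → ρ.time k < ρ.time j then none else
          some {b : Σ i, β i | B b.1 b.2 ρ (ρ.blockStart k)}) ((ρ.after k).map (obs J I ρ k₀)) =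
        (ρ.after k).map (obs P I ρ k₀) := by
      intro k₀ k
      induction k using ρ.after_induction with
      | h0 k h0 _ => rw [h0]; rfl
      | h1 k j hj hk ih =>
        rw [hk, List.map_cons, List.map_cons, mealyRun]
        have hbits : blockBits (if ∀ j, k < j → ρ.time k < ρ.time j then none else
            some {b : Σ i, β i | B b.1 b.2 ρ (ρ.blockStart k)}) (obs J I ρ k₀ j).1 =
            {b : Σ i, β i | B b.1 b.2 ρ (ρ.blockStart j)} := by
          have hkj : k < j := Fin.lt_def.2 (by omega)
          split_ifs with hlast
          · rw [ρ.blockStart_of_last hj (hlast j hkj)]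
            rfl
          · push Not at hlast
            obtain ⟨i, hki, hi⟩ := hlast
            have hji : j ≤ i := Fin.le_def.2 (by have := Fin.lt_def.1 hki; omega)
            rw [ρ.blockStart_congr (le_antisymm ((ρ.time_mono hji).trans hi)
              (ρ.time_mono hkj.le) : ρ.time j = ρ.time k)]
            rfl
        rw [← ih]
        congr 1
        · refine Prod.ext (Set.ext fun i => ?_) rfl
          change some (.inr _) ∈ (obs J I ρ k₀ j).1 ↔ P i ρ j
          rw [hbits, h]
          rfl
        · rw [blockStep, hbits]
          exact congrArg (fun s => mealyRun blockStep blockOut s _) (if_congr Iff.rfl rfl rfl)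
    beta_reduce
    rw [← key]
    by_cases hlast : ∀ j, k < j → ρ.time k < ρ.time j
    · rw [if_pos hlast]
      exact ⟨fun h => Or.inl ⟨hlast, h⟩, fun h => h.elim And.right fun h => absurd hlast h.1⟩
    · rw [if_neg hlast]
      exact ⟨fun h => Or.inr ⟨hlast, h⟩, fun h => h.elim (fun h => absurd h.1 hlast) And.right⟩

theorem eliminate_start (hP : Definable sf True P) :
    ∃ Q, Definable sf False Q ∧ ∀ ρ, P ρ 0 ↔ Q ρ 0 := by
  obtain ⟨ι, _, B, R, hB, hR, h⟩ := hP.exists_context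
  refine ⟨fun ρ k => ∃ c, {i | B i ρ k} = c ∧ R c ρ k,
    finExists fun c => (setEq hB c).and (hR c), fun ρ => ?_⟩
  rw [h, ρ.blockStart_zero]
  simp

end Definable

/-! ### Acceptance by backward evaluation -/

namespace TransFormula
variable {S S' : Type}

/-- Evaluation of a transition formula: `G` is the set of clock constraints that hold, `g` and `b`
are the locations that succeed without and with reset. -/
def Holds : TransFormula S → Set TimeInterval → (S → Prop) → (S → Prop) → Prop
  | .top, _, _, _ => True
  | .bot, _, _, _ => False
  | .and φ ψ, G, g, b => φ.Holds G g b ∧ ψ.Holds G g b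
  | .or φ ψ, G, g, b => φ.Holds G g b ∨ ψ.Holds G g b
  | .loc s, _, g, _ => g s
  | .guard I, G, _, _ => I ∈ G
  | .reset φ, _, _, b => φ.Holds {I | 0 ∈ I.toSet} b b

/-- The clock constraints outside the scope of every reset. -/
def guards : TransFormula S → Set TimeInterval
  | .and φ ψ => φ.guards ∪ ψ.guards
  | .or φ ψ => φ.guards ∪ ψ.guards
  | .guard I => {I}
  | _ => ∅

theorem guards_finite (φ : TransFormula S) : φ.guards.Finite := by
  induction φ with
  | and φ ψ h h' => exact h.union h'
  | or φ ψ h h' => exact h.union h'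
  | guard I => exact Set.finite_singleton I
  | _ => exact Set.finite_empty

theorem Holds.mono {φ : TransFormula S} {G G' : Set TimeInterval} {g g' b b' : S → Prop}
    (h : φ.Holds G g b) (hG : ∀ I ∈ φ.guards, I ∈ G → I ∈ G')
    (hg : ∀ s ∈ φ.freeLocs, g s → g' s) (hb : ∀ s ∈ φ.boundLocs, b s → b' s) :
    φ.Holds G' g' b' := by
  induction φ generalizing G G' g g' with
  | top => trivial
  | bot => exact h
  | and φ ψ ih ih' =>
    exact ⟨ih h.1 (fun I hI => hG I (Or.inl hI)) (fun s hs => hg s (Or.inl hs))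
      fun s hs => hb s (Or.inl hs), ih' h.2 (fun I hI => hG I (Or.inr hI))
      (fun s hs => hg s (Or.inr hs)) fun s hs => hb s (Or.inr hs)⟩
  | or φ ψ ih ih' =>
    exact Or.imp (fun h => ih h (fun I hI => hG I (Or.inl hI)) (fun s hs => hg s (Or.inl hs))
      fun s hs => hb s (Or.inl hs)) (fun h => ih' h (fun I hI => hG I (Or.inr hI))
      (fun s hs => hg s (Or.inr hs)) fun s hs => hb s (Or.inr hs)) h
  | loc s => exact hg s rfl h
  | guard I => exact hG I rfl h
  | reset φ ih =>
    exact ih h (fun _ _ h => h) (fun s hs => hb s (Or.inl hs)) fun s hs => hb s (Or.inr hs)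

theorem holds_congr {φ : TransFormula S} {G G' : Set TimeInterval} {g g' b b' : S → Prop}
    (hG : ∀ I ∈ φ.guards, I ∈ G ↔ I ∈ G') (hg : ∀ s ∈ φ.freeLocs, g s ↔ g' s)
    (hb : ∀ s ∈ φ.boundLocs, b s ↔ b' s) : φ.Holds G g b ↔ φ.Holds G' g' b' :=
  ⟨fun h => h.mono (fun I hI => (hG I hI).1) (fun s hs => (hg s hs).1) fun s hs => (hb s hs).1,
    fun h => h.mono (fun I hI => (hG I hI).2) (fun s hs => (hg s hs).2) fun s hs => (hb s hs).2⟩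

/-- Clock values are replaced by the time `r` of the last reset, which does not change as time
elapses: a member `c` of a configuration at time `t` was reset at `t - c.2`. -/
theorem holds_iff_exists_outcomes (φ : TransFormula S) (t r : ℝ) (g : S → ℝ → Prop) :
    φ.Holds {I | t - r ∈ I.toSet} (g · r) (g · t) ↔
      ∃ M ∈ φ.outcomes (t - r), ∀ c ∈ M, g c.1 (t - c.2) := by
  induction φ generalizing r with
  | top => simp [Holds, outcomes]
  | bot => simp [Holds, outcomes]
  | and φ ψ ih ih' =>
    rw [Holds, ih, ih']
    constructor
    · rintro ⟨⟨M, hM, h⟩, N, hN, h'⟩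
      exact ⟨M ∪ N, ⟨M, hM, N, hN, rfl⟩, fun c hc => hc.elim (h c) (h' c)⟩
    · rintro ⟨_, ⟨M, hM, N, hN, rfl⟩, h⟩
      exact ⟨⟨M, hM, fun c hc => h c (Or.inl hc)⟩, N, hN, fun c hc => h c (Or.inr hc)⟩
  | or φ ψ ih ih' =>
    rw [Holds, ih, ih', outcomes, ← exists_or]
    exact exists_congr fun M => or_and_right.symm
  | loc s => simp [Holds, outcomes]
  | guard I => simp [Holds, outcomes]
  | reset φ ih =>
    have := ih t
    rw [sub_self] at this
    exact this

end TransFormula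

namespace OneATA
variable {AP : Type u} (A : OneATA AP) (ρ : TimedWord AP)

/-- Acceptance from a location and the time of the last reset, on the given remaining positions. -/
def accFrom : List ρ.Pos → A.Loc → ℝ → Prop
  | [], s, _ => s ∈ A.final
  | j :: js, s, r => (A.δ s (ρ.letter j)).Holds {I | ρ.time j - r ∈ I.toSet}
      (accFrom js · r) (accFrom js · (ρ.time j))

theorem accFrom_cons (j : ρ.Pos) (js : List ρ.Pos) (s : A.Loc) (r : ℝ) :
    A.accFrom ρ (j :: js) s r ↔ (A.δ s (ρ.letter j)).Holds {I | ρ.time j - r ∈ I.toSet}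
      (A.accFrom ρ js · r) (A.accFrom ρ js · (ρ.time j)) := Iff.rfl

-- The members of a configuration choose their clauses independently. So a run can be built forwards
-- by choosing, for each member that accepts the rest, an outcome all of whose members accept the
-- rest; conversely, acceptance propagates backwards along a run.
open Classical in
theorem accepts_iff : A.Accepts ρ ↔ A.accFrom ρ (0 :: ρ.after 0) A.init 0 := by
  -- The time at which the `i`-th configuration is reached; the initial one belongs to time `0`.
  let T : Fin (ρ.len + 2) → ℝ := Fin.cons 0 ρ.time
  let rest : Fin (ρ.len + 2) → List ρ.Pos := fun i => ρ.positions fun j => i ≤ j.castSucc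
  let Good : Fin (ρ.len + 2) → A.Loc × ℝ → Prop := fun i c =>
    A.accFrom ρ (rest i) c.1 (T i - c.2)
  have rest_zero : rest 0 = 0 :: ρ.after 0 := by
    rw [← ρ.positions_true]
    exact ρ.positions_congr fun j => iff_true_intro (Fin.zero_le _)
  have rest_last : rest (Fin.last _) = [] := ρ.positions_eq_nil fun j hj =>
    absurd hj (not_le.2 (Fin.castSucc_lt_last j))
  have rest_cons : ∀ k : ρ.Pos, rest k.castSucc = k :: rest k.succ := by
    intro k
    refine (ρ.positions_eq_cons (k := k) le_rfl fun j hj => hj).trans (congrArg _ ?_)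
    refine ρ.positions_congr fun j => ?_
    simp only [Fin.le_def, Fin.lt_def, Fin.val_castSucc, Fin.val_succ]
    omega
  have T_succ : ∀ k : ρ.Pos, T k.succ = ρ.time k := fun k => Fin.cons_succ _ _ k
  have good_iff : ∀ (k : ρ.Pos) (c : A.Loc × ℝ), Good k.castSucc c ↔
      ∃ M ∈ (A.δ c.1 (ρ.letter k)).outcomes (c.2 + delay ρ k), ∀ d ∈ M, Good k.succ d := by
    intro k c
    have h1 : ρ.time k - (T k.castSucc - c.2) = c.2 + delay ρ k := by
      simp only [delay, T]
      ring
    have h2 := (A.δ c.1 (ρ.letter k)).holds_iff_exists_outcomes (ρ.time k) (T k.castSucc - c.2)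
      (A.accFrom ρ (rest k.succ))
    rw [h1] at h2
    simp only [Good]
    rw [rest_cons, accFrom_cons, h1, h2, T_succ]
  have h0 : Good 0 (A.init, 0) ↔ A.accFrom ρ (0 :: ρ.after 0) A.init 0 := by
    simp only [Good, T]
    rw [rest_zero, Fin.cons_zero, sub_zero]
  rw [← h0]
  constructor
  · rintro ⟨C, hC0, hC, hlast⟩
    have key : ∀ i, ∀ c ∈ C i, Good i c := by
      intro i
      induction i using Fin.reverseInduction with
      | last =>
        intro c hc
        simp only [Good]
        rw [rest_last]
        exact hlast c hc
      | cast k ih =>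
        intro c hc
        obtain ⟨M, hM, hM'⟩ := hC k
        refine (good_iff k c).2 ⟨_, hM (c.1, c.2 + delay ρ k) ⟨c, hc, rfl⟩, fun d hd => ih d ?_⟩
        rw [hM']
        exact Set.mem_biUnion (Set.mem_image_of_mem _ hc) hd
    exact key 0 _ (by rw [hC0]; rfl)
  · intro hinit
    let M : ρ.Pos → A.Loc × ℝ → A.Config := fun k c =>
      if h : ∃ M ∈ (A.δ c.1 (ρ.letter k)).outcomes c.2, ∀ d ∈ M, Good k.succ d then h.choose else ∅
    let C : Fin (ρ.len + 2) → A.Config := Fin.induction {(A.init, 0)} fun k C =>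
      ⋃ c ∈ A.elapse C (delay ρ k), M k c
    have C_succ : ∀ k : ρ.Pos, C k.succ = ⋃ c ∈ A.elapse (C k.castSucc) (delay ρ k), M k c :=
      fun k => Fin.induction_succ ..
    have hgood : ∀ i, ∀ c ∈ C i, Good i c := by
      intro i
      induction i using Fin.induction with
      | zero =>
        rintro c (rfl : c = _)
        exact hinit
      | succ k ih =>
        intro d hd
        rw [C_succ] at hd
        obtain ⟨_, ⟨c, hc, rfl⟩, hd⟩ := Set.mem_iUnion₂.1 hd
        have h := (good_iff k c).1 (ih c hc)
        simp only [M, dif_pos h] at hd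
        exact h.choose_spec.2 d hd
    refine ⟨C, rfl, fun k => ⟨M k, ?_, C_succ k⟩, fun c hc => ?_⟩
    · rintro _ ⟨c, hc, rfl⟩
      have h := (good_iff k c).1 (hgood _ c hc)
      simp only [M, dif_pos h]
      exact h.choose_spec.1
    · have := hgood _ c hc
      simp only [Good] at this
      rw [rest_last] at this
      exact this

end OneATA

/-! ### Automata define definable properties -/

theorem ncard_setOf_lt_lt {α : Type*} [Finite α] [PartialOrder α] {p q : α} (h : q < p) :
    Set.ncard {x | x < q} < Set.ncard {x | x < p} :=
  Set.ncard_lt_ncard ((Set.ssubset_iff_of_subset fun _ hx => lt_trans hx h).2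
    ⟨q, h, fun hq : q < q => lt_irrefl q hq⟩) (Set.toFinite _)

namespace OneATA
variable {AP : Type u}

theorem definable_holds {sf : Bool} {p : Prop} {S : Type} {P : S → PosProp AP}
    (hP : ∀ s, Definable sf p (P s)) (φ : TransFormula S) (G : Set TimeInterval) :
    Definable sf p fun ρ k => φ.Holds G (P · ρ k) (P · ρ k) := by
  induction φ generalizing G with
  | top => exact Definable.const True
  | bot => exact Definable.const False
  | and φ ψ h h' => exact (h G).and (h' G)
  | or φ ψ h h' => exact (h G).or (h' G)
  | loc s => exact hP s
  | guard I => exact Definable.const (I ∈ G)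
  | reset φ h => exact h _

/-- If resets lead to smaller ranks along the relation `R`, then the language is definable. -/
theorem exists_definable [Finite AP] {sf : Bool} (A : OneATA AP) (R : A.Loc → A.Loc → Prop)
    (hR : ∀ p, R p p) (rk : A.Loc → ℕ)
    (hfree : ∀ p s a, R p s → ∀ q ∈ (A.δ s a).freeLocs, R p q)
    (hbound : ∀ p s a, R p s → ∀ q ∈ (A.δ s a).boundLocs, rk q < rk p)
    (hsf : sf = true → ∀ s a, ∀ q ∈ (A.δ s a).freeLocs, q = s ∨ rk q < rk s) :
    ∃ P, Definable sf False P ∧ ∀ ρ, A.Accepts ρ ↔ P ρ 0 := by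
  have := A.finite_loc
  obtain ⟨n, ⟨e⟩⟩ := Finite.exists_equiv_fin (Letter AP)
  have hacc : ∀ p, Definable sf False fun ρ k => A.accFrom ρ (ρ.after k) p (ρ.time k) := by
    intro p
    induction hn : rk p using Nat.strong_induction_on generalizing p with
    | _ n ih =>
    subst hn
    let 𝒢 : Set TimeInterval := ⋃ s, ⋃ a, (A.δ s a).guards
    have : Finite 𝒢 := (Set.finite_iUnion fun s => Set.finite_iUnion fun a =>
      (A.δ s a).guards_finite).to_subtype
    -- Observed are the letter and, for locations of smaller rank, acceptance after a reset at the
    -- observed position.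
    let P : Fin n ⊕ A.Loc → PosProp AP := Sum.elim (fun i ρ k => e (ρ.letter k) = i)
      fun q ρ k => rk q < rk p ∧ A.accFrom ρ (ρ.after k) q (ρ.time k)
    have hP : ∀ i, Definable sf False (P i) := by
      rintro (i | q)
      · exact .letter {a | e a = i}
      · by_cases hq : rk q < rk p
        · exact (ih _ hq q rfl).congr fun ρ k => and_iff_right hq
        · exact (Definable.const False).congr fun ρ k => iff_of_false (fun h => hq h.1) id
    -- Guards and reset locations are read off the observation, so only the moves without reset
    -- remain.
    let B : BAut (Set (Fin n ⊕ A.Loc) × Set 𝒢) sf :=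
      { Q := A.Loc
        finite_Q := A.finite_loc
        δ := fun s x Y => ∃ i, .inl i ∈ x.1 ∧ (A.δ s (e.symm i)).Holds
          {I | ∃ h, (⟨I, h⟩ : 𝒢) ∈ x.2} (· ∈ Y) (.inr · ∈ x.1)
        F := A.final
        rank := rk
        mono := fun {s x Y Z} h ⟨i, hi, hY⟩ => ⟨i, hi, hY.mono (fun _ _ h => h)
          (fun t ht hY => h t hY fun h => hsf h s _ t ht) fun _ _ h => h⟩ }
    refine (Definable.future (fun I : 𝒢 => I.1) hP (B.cls_acc p)).congr fun ρ k => ?_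
    have key : ∀ j s, R p s → (A.accFrom ρ (ρ.after j) s (ρ.time k) ↔
        B.acc s ((ρ.after j).map (obs P (fun I : 𝒢 => I.1) ρ k))) := by
      intro j
      induction j using ρ.after_induction with
      | h0 j h _ =>
        intro s _
        rw [h]
        exact Iff.rfl
      | h1 j i hi h ih =>
        intro s hs
        rw [h, List.map_cons, accFrom_cons]
        have hsucc : (A.δ s (ρ.letter i)).Holds {I | ρ.time i - ρ.time k ∈ I.toSet}
            (A.accFrom ρ (ρ.after i) · (ρ.time k)) (A.accFrom ρ (ρ.after i) · (ρ.time i)) ↔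
            (A.δ s (ρ.letter i)).Holds
              {I | ∃ h, (⟨I, h⟩ : 𝒢) ∈ (obs P (fun I : 𝒢 => I.1) ρ k i).2}
              (B.acc · ((ρ.after i).map (obs P (fun I : 𝒢 => I.1) ρ k)))
              (.inr · ∈ (obs P (fun I : 𝒢 => I.1) ρ k i).1) := by
          refine TransFormula.holds_congr (fun I hI => ?_) (fun q hq => ?_) fun q hq => ?_
          · exact ⟨fun h => ⟨Set.mem_iUnion.2 ⟨s, Set.mem_iUnion.2 ⟨_, hI⟩⟩, h⟩, fun ⟨_, h⟩ => h⟩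
          · exact ih q (hfree p s _ hs q hq)
          · exact (and_iff_right (hbound p s _ hs q hq)).symm
        rw [hsucc]
        constructor
        · intro h
          refine ⟨e (ρ.letter i), rfl, ?_⟩
          rw [e.symm_apply_apply]
          exact h
        · rintro ⟨a, rfl, h⟩
          rw [e.symm_apply_apply] at h
          exact h
    exact key k p (hR p)
  -- The first position is read at time `0`, where moves with and without reset have the same
  -- effect.
  refine ⟨fun ρ k => ∃ i, e (ρ.letter k) = i ∧ (A.δ A.init (e.symm i)).Holds {I | 0 ∈ I.toSet}
    (A.accFrom ρ (ρ.after k) · (ρ.time k)) (A.accFrom ρ (ρ.after k) · (ρ.time k)),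
    Definable.finExists fun i => (Definable.letter {a | e a = i}).and
      (definable_holds hacc _ _), fun ρ => ?_⟩
  rw [accepts_iff, accFrom_cons]
  simp [ρ.time_zero]

/-- The relation is membership in the same island, and the rank counts the headers below the header
of the island. -/
theorem IsLFR.exists_definable [Finite AP] {A : OneATA AP} (hA : A.IsLFR) :
    ∃ P, Definable false False P ∧ ∀ ρ, A.Accepts ρ ↔ P ρ 0 := by
  have := A.finite_loc
  obtain ⟨N, o, h⟩ := hA
  let hd : A.Loc → {s // N.header s = s} := fun s => ⟨N.header s, N.header_header s⟩
  refine A.exists_definable (fun p s => N.header p = N.header s) (fun _ => rfl)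
    (fun p => Set.ncard {q | o.lt q (hd p)}) ?_ ?_ nofun
  · intro p s a hps q hq
    exact hps.trans (N.free_island s a q hq).1.symm
  · intro p s a hps q hq
    have h1 : o.lt (hd q) (hd p) := by
      have h2 : hd q = ⟨q, N.bound_header s a q hq⟩ := Subtype.ext (N.bound_header s a q hq)
      have h3 : hd p = hd s := Subtype.ext hps
      rw [h2, h3]
      exact h s a q hq
    exact ncard_setOf_lt_lt h1

/-- Here the lower set of a location plays the role of its island. -/
theorem IsPO.exists_definable [Finite AP] {A : OneATA AP} (hA : A.IsPO) :
    ∃ P, Definable true False P ∧ ∀ ρ, A.Accepts ρ ↔ P ρ 0 := by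
  have := A.finite_loc
  obtain ⟨o, h⟩ := hA
  refine A.exists_definable (fun p s => s ≤ p) (fun _ => le_rfl)
    (fun p => Set.ncard {q | q < p}) ?_ ?_ ?_
  · intro p s a hps q hq
    rcases (h s a).1 q (Or.inl hq) with rfl | hlt
    exacts [hps, hlt.le.trans hps]
  · intro p s a hps q hq
    rcases (h s a).1 q (Or.inr hq) with rfl | hlt
    exacts [absurd hq (h q a).2, ncard_setOf_lt_lt (lt_of_lt_of_le hlt hps)]
  · intro _ s a q hq
    exact ((h s a).1 q (Or.inl hq)).imp id ncard_setOf_lt_lt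

end OneATA

/-! ### Finite disjunctions and conjunctions of transition formulae -/

namespace TransFormula
variable {S S' : Type} {ι : Type}

/-- Renaming of locations. -/
def map (f : S → S') : TransFormula S → TransFormula S'
  | .top => .top
  | .bot => .bot
  | .and φ ψ => .and (φ.map f) (ψ.map f)
  | .or φ ψ => .or (φ.map f) (ψ.map f)
  | .loc s => .loc (f s)
  | .guard I => .guard I
  | .reset φ => .reset (φ.map f)

theorem holds_map (f : S → S') (φ : TransFormula S) (G : Set TimeInterval) (g b : S' → Prop) :
    (φ.map f).Holds G g b ↔ φ.Holds G (fun s => g (f s)) fun s => b (f s) := by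
  induction φ generalizing G g with
  | and φ ψ h h' => exact and_congr (h G g) (h' G g)
  | or φ ψ h h' => exact or_congr (h G g) (h' G g)
  | reset φ h => exact h _ _
  | _ => exact Iff.rfl

theorem freeLocs_map (f : S → S') (φ : TransFormula S) :
    (φ.map f).freeLocs = f '' φ.freeLocs := by
  induction φ with
  | and φ ψ h h' => rw [map, freeLocs, freeLocs, h, h', Set.image_union]
  | or φ ψ h h' => rw [map, freeLocs, freeLocs, h, h', Set.image_union]
  | loc s => exact (Set.image_singleton ..).symm
  | _ => exact (Set.image_empty f).symm

theorem boundLocs_map (f : S → S') (φ : TransFormula S) :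
    (φ.map f).boundLocs = f '' φ.boundLocs := by
  induction φ with
  | and φ ψ h h' => rw [map, boundLocs, boundLocs, h, h', Set.image_union]
  | or φ ψ h h' => rw [map, boundLocs, boundLocs, h, h', Set.image_union]
  | reset φ h => rw [map, boundLocs, boundLocs, h, freeLocs_map, Set.image_union]
  | _ => exact (Set.image_empty f).symm

theorem exists_bigOr [Finite ι] (f : ι → TransFormula S) : ∃ φ : TransFormula S,
    (∀ G g b, φ.Holds G g b ↔ ∃ i, (f i).Holds G g b) ∧
      (∀ s ∈ φ.freeLocs, ∃ i, s ∈ (f i).freeLocs) ∧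
        ∀ s ∈ φ.boundLocs, ∃ i, s ∈ (f i).boundLocs := by
  have key : ∀ t : Finset ι, ∃ φ : TransFormula S,
      (∀ G g b, φ.Holds G g b ↔ ∃ i ∈ t, (f i).Holds G g b) ∧
        (∀ s ∈ φ.freeLocs, ∃ i, s ∈ (f i).freeLocs) ∧
          ∀ s ∈ φ.boundLocs, ∃ i, s ∈ (f i).boundLocs := by
    classical
    intro t
    induction t using Finset.induction_on with
    | empty => exact ⟨.bot, fun _ _ _ => by simp [Holds], nofun, nofun⟩
    | insert i t _ ih =>
      obtain ⟨φ, h1, h2, h3⟩ := ih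
      exact ⟨.or (f i) φ, fun G g b => by simp [Holds, h1],
        fun s hs => hs.elim (fun h => ⟨i, h⟩) (h2 s),
        fun s hs => hs.elim (fun h => ⟨i, h⟩) (h3 s)⟩
  cases nonempty_fintype ι
  obtain ⟨φ, h1, h2⟩ := key Finset.univ
  exact ⟨φ, fun G g b => by simp [h1], h2⟩

/-- Finite disjunction. -/
noncomputable def bigOr [Finite ι] (f : ι → TransFormula S) : TransFormula S :=
  (exists_bigOr f).choose

theorem holds_bigOr [Finite ι] (f : ι → TransFormula S) (G : Set TimeInterval) (g b : S → Prop) :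
    (bigOr f).Holds G g b ↔ ∃ i, (f i).Holds G g b :=
  (exists_bigOr f).choose_spec.1 G g b

theorem freeLocs_bigOr [Finite ι] {f : ι → TransFormula S} {s : S} (hs : s ∈ (bigOr f).freeLocs) :
    ∃ i, s ∈ (f i).freeLocs :=
  (exists_bigOr f).choose_spec.2.1 s hs

theorem boundLocs_bigOr [Finite ι] {f : ι → TransFormula S} {s : S}
    (hs : s ∈ (bigOr f).boundLocs) : ∃ i, s ∈ (f i).boundLocs :=
  (exists_bigOr f).choose_spec.2.2 s hs

theorem exists_bigAnd [Finite ι] (f : ι → TransFormula S) : ∃ φ : TransFormula S,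
    (∀ G g b, φ.Holds G g b ↔ ∀ i, (f i).Holds G g b) ∧
      (∀ s ∈ φ.freeLocs, ∃ i, s ∈ (f i).freeLocs) ∧
        ∀ s ∈ φ.boundLocs, ∃ i, s ∈ (f i).boundLocs := by
  have key : ∀ t : Finset ι, ∃ φ : TransFormula S,
      (∀ G g b, φ.Holds G g b ↔ ∀ i ∈ t, (f i).Holds G g b) ∧
        (∀ s ∈ φ.freeLocs, ∃ i, s ∈ (f i).freeLocs) ∧
          ∀ s ∈ φ.boundLocs, ∃ i, s ∈ (f i).boundLocs := by
    classical
    intro t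
    induction t using Finset.induction_on with
    | empty => exact ⟨.top, fun _ _ _ => by simp [Holds], nofun, nofun⟩
    | insert i t _ ih =>
      obtain ⟨φ, h1, h2, h3⟩ := ih
      exact ⟨.and (f i) φ, fun G g b => by simp [Holds, h1],
        fun s hs => hs.elim (fun h => ⟨i, h⟩) (h2 s),
        fun s hs => hs.elim (fun h => ⟨i, h⟩) (h3 s)⟩
  cases nonempty_fintype ι
  obtain ⟨φ, h1, h2⟩ := key Finset.univ
  exact ⟨φ, fun G g b => by simp [h1], h2⟩

/-- Finite conjunction. -/
noncomputable def bigAnd [Finite ι] (f : ι → TransFormula S) : TransFormula S :=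
  (exists_bigAnd f).choose

theorem holds_bigAnd [Finite ι] (f : ι → TransFormula S) (G : Set TimeInterval) (g b : S → Prop) :
    (bigAnd f).Holds G g b ↔ ∀ i, (f i).Holds G g b :=
  (exists_bigAnd f).choose_spec.1 G g b

theorem freeLocs_bigAnd [Finite ι] {f : ι → TransFormula S} {s : S}
    (hs : s ∈ (bigAnd f).freeLocs) : ∃ i, s ∈ (f i).freeLocs :=
  (exists_bigAnd f).choose_spec.2.1 s hs

theorem boundLocs_bigAnd [Finite ι] {f : ι → TransFormula S} {s : S}
    (hs : s ∈ (bigAnd f).boundLocs) : ∃ i, s ∈ (f i).boundLocs :=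
  (exists_bigAnd f).choose_spec.2.2 s hs

/-- The negation of a clock constraint. -/
def notGuard : TimeInterval → TransFormula S
  | .icc a b => .or (.guard (.ico 0 a)) (.guard (.ioi b))
  | .ico a b => .or (.guard (.ico 0 a)) (.guard (.ici b))
  | .ioc a b => .or (.guard (.icc 0 a)) (.guard (.ioi b))
  | .ioo a b => .or (.guard (.icc 0 a)) (.guard (.ici b))
  | .ici a => .guard (.ico 0 a)
  | .ioi a => .guard (.icc 0 a)

theorem holds_notGuard (I : TimeInterval) {v : ℝ} (hv : 0 ≤ v) (g b : S → Prop) :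
    (notGuard I).Holds {I | v ∈ I.toSet} g b ↔ v ∉ I.toSet := by
  cases I <;> simp [notGuard, Holds, TimeInterval.toSet, hv, imp_iff_or_not, or_comm]

theorem freeLocs_notGuard (I : TimeInterval) : (notGuard I : TransFormula S).freeLocs = ∅ := by
  cases I <;> simp [notGuard, freeLocs]

theorem boundLocs_notGuard (I : TimeInterval) : (notGuard I : TransFormula S).boundLocs = ∅ := by
  cases I <;> simp [notGuard, boundLocs]

end TransFormula

/-! ### Automata with ranked islands -/

/-- One-clock alternating timed automata with islands and ranks that decrease along resets and, if
`sf` holds, along all transitions that are not loops. -/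
structure RankedATA (AP : Type u) (sf : Bool) extends OneATA AP where
  header : Loc → Loc
  rank : Loc → ℕ
  header_header : ∀ s, header (header s) = header s
  header_init : header init = init
  bound : ∀ s a, ∀ q ∈ (δ s a).boundLocs, header q = q ∧ rank q < rank (header s) ∧ rank q < rank s
  free : ∀ s a, ∀ p ∈ (δ s a).freeLocs, header p = header s ∧ p ≠ header s ∧
    (sf = true → p = s ∨ rank p < rank s)

namespace RankedATA
variable {AP : Type u} {sf : Bool}

/-- The order given by a rank. -/
abbrev rankOrder {α : Type*} (f : α → ℕ) : PartialOrder α where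
  le a b := a = b ∨ f a < f b
  lt a b := f a < f b
  le_refl a := Or.inl rfl
  le_trans a b c := by
    rintro (rfl | h) (rfl | h')
    exacts [Or.inl rfl, Or.inr h', Or.inr h, Or.inr (h.trans h')]
  le_antisymm a b := by
    rintro (rfl | h) (h' | h')
    exacts [rfl, rfl, h'.symm, absurd h (lt_asymm h')]
  lt_iff_le_not_ge a b := by
    constructor
    · intro h
      refine ⟨Or.inr h, ?_⟩
      rintro (rfl | h')
      exacts [lt_irrefl _ h, lt_asymm h h']
    · rintro ⟨rfl | h, h'⟩
      exacts [absurd (Or.inl rfl) h', h]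

theorem isLFR (M : RankedATA AP sf) : M.IsLFR :=
  ⟨⟨M.header, M.header_header, M.header_init, fun s a q hq => (M.bound s a q hq).1,
    fun s a p hp => ⟨(M.free s a p hp).1, (M.free s a p hp).2.1⟩⟩, rankOrder fun s => M.rank s.1,
    fun p a q hq => (M.bound p a q hq).2.1⟩

theorem isPO (M : RankedATA AP true) : M.IsPO :=
  ⟨rankOrder M.rank, fun s a => ⟨fun p hp => hp.elim (fun h => (M.free s a p h).2.2 rfl)
    fun h => Or.inr (M.bound s a p h).2.2, fun h => lt_irrefl _ (M.bound s a s h).2.2⟩⟩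

theorem exists_rank_lt {ι : Type} [Finite ι] (M : ι → RankedATA AP sf) :
    ∃ N, ∀ i s, (M i).rank s < N := by
  have := fun i => (M i).finite_loc
  obtain ⟨N, hN⟩ := (Set.finite_range fun x : Σ i, (M i).Loc => (M x.1).rank x.2).bddAbove
  exact ⟨N + 1, fun i s => Nat.lt_succ_of_le (hN ⟨⟨i, s⟩, rfl⟩)⟩

/-- A new island over the locations `L`. -/
structure Island (AP : Type u) (sf : Bool) (L : Type) (hd : L → L) where
  E : Type
  finite_E : Finite E
  root : E
  final : Set E
  rank : E → ℕ
  δ : E → Letter AP → TransFormula (L ⊕ E)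
  bound : ∀ e a, ∀ q ∈ (δ e a).boundLocs, ∃ x, q = .inl x ∧ hd x = x
  free : ∀ e a, ∀ p ∈ (δ e a).freeLocs, ∃ e', p = .inr e' ∧ e' ≠ root ∧
    (sf = true → e' = e ∨ rank e' < rank e)

section join
variable {ι : Type} [Finite ι] (M : ι → RankedATA AP sf)

/-- The headers of the disjoint union. -/
def sigmaHeader (x : Σ i, (M i).Loc) : Σ i, (M i).Loc := ⟨x.1, (M x.1).header x.2⟩

/-- The disjoint union of ranked automata and a new island above them. -/
noncomputable def join (E : Island AP sf (Σ i, (M i).Loc) (sigmaHeader M)) : RankedATA AP sf where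
  Loc := (Σ i, (M i).Loc) ⊕ E.E
  finite_loc := have := fun i => (M i).finite_loc; have := E.finite_E; inferInstance
  init := .inr E.root
  final := {x | x.elim (fun x => x.2 ∈ (M x.1).final) (· ∈ E.final)}
  δ
    | .inl x, a => ((M x.1).δ x.2 a).map fun s => .inl ⟨x.1, s⟩
    | .inr e, a => E.δ e a
  header := Sum.map (sigmaHeader M) fun _ => E.root
  rank := Sum.elim (fun x => (M x.1).rank x.2) fun e => (exists_rank_lt M).choose + E.rank e
  header_header := by
    rintro (x | e)
    · exact congrArg Sum.inl (Sigma.ext rfl (heq_of_eq ((M x.1).header_header x.2)))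
    · rfl
  header_init := rfl
  bound := by
    rintro (⟨i, s⟩ | e) a q hq
    · dsimp only at hq
      rw [TransFormula.boundLocs_map] at hq
      obtain ⟨q, hq, rfl⟩ := hq
      have h := (M i).bound s a q hq
      exact ⟨congrArg Sum.inl (Sigma.ext rfl (heq_of_eq h.1)), h.2⟩
    · obtain ⟨x, rfl, hx⟩ := E.bound e a q hq
      have h := (exists_rank_lt M).choose_spec x.1 x.2
      exact ⟨congrArg Sum.inl hx, Nat.lt_add_right _ h, Nat.lt_add_right _ h⟩
  free := by
    rintro (⟨i, s⟩ | e) a q hq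
    · dsimp only at hq
      rw [TransFormula.freeLocs_map] at hq
      obtain ⟨q, hq, rfl⟩ := hq
      obtain ⟨h1, h2, h3⟩ := (M i).free s a q hq
      refine ⟨congrArg Sum.inl (Sigma.ext rfl (heq_of_eq h1)), fun h => h2 ?_, fun hs => ?_⟩
      · simpa [sigmaHeader] using h
      · exact (h3 hs).imp (fun h => by rw [h]) id
    · obtain ⟨e', rfl, h1, h2⟩ := E.free e a q hq
      refine ⟨rfl, fun h => h1 (Sum.inr_injective h), fun hs => ?_⟩
      exact (h2 hs).imp (fun h => by rw [h]) fun h => Nat.add_lt_add_left h _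

theorem accFrom_join_inl (E : Island AP sf (Σ i, (M i).Loc) (sigmaHeader M)) (ρ : TimedWord AP)
    (js : List ρ.Pos) (i : ι) (s : (M i).Loc) (r : ℝ) :
    (join M E).accFrom ρ js (.inl ⟨i, s⟩) r ↔ (M i).accFrom ρ js s r := by
  induction js generalizing s r with
  | nil => exact Iff.rfl
  | cons j js ih =>
    refine (TransFormula.holds_map (fun s => (.inl ⟨i, s⟩ : (join M E).Loc)) ((M i).δ s _) ..).trans ?_
    exact TransFormula.holds_congr (fun _ _ => Iff.rfl) (fun q _ => ih q r) fun q _ => ih q _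

theorem accFrom_join_inr_cons (E : Island AP sf (Σ i, (M i).Loc) (sigmaHeader M))
    (ρ : TimedWord AP) (j : ρ.Pos) (js : List ρ.Pos) (e : E.E) (r : ℝ) :
    (join M E).accFrom ρ (j :: js) (.inr e) r ↔ (E.δ e (ρ.letter j)).Holds
      {I | ρ.time j - r ∈ I.toSet} ((join M E).accFrom ρ js · r)
        ((join M E).accFrom ρ js · (ρ.time j)) := Iff.rfl

/-- The island with a single location and the given transitions. -/
def Island.single (φ : Letter AP → TransFormula (Σ i, (M i).Loc))
    (hf : ∀ a, (φ a).freeLocs = ∅) (hb : ∀ a, ∀ q ∈ (φ a).boundLocs, sigmaHeader M q = q) :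
    Island AP sf (Σ i, (M i).Loc) (sigmaHeader M) where
  E := Unit
  finite_E := inferInstance
  root := ()
  final := ∅
  rank _ := 0
  δ _ a := (φ a).map .inl
  bound _ a q hq := by
    rw [TransFormula.boundLocs_map] at hq
    obtain ⟨x, hx, rfl⟩ := hq
    exact ⟨x, rfl, hb a x hx⟩
  free _ a q hq := by
    rw [TransFormula.freeLocs_map, hf, Set.image_empty] at hq
    exact hq.elim

end join

/-- At each position, the formula given by the letter expresses the property. -/
structure Realizes (M : RankedATA AP sf) (φ : Letter AP → TransFormula M.Loc) (P : PosProp AP) :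
    Prop where
  free : ∀ a, (φ a).freeLocs = ∅
  bound : ∀ a, ∀ q ∈ (φ a).boundLocs, M.header q = q
  holds : ∀ ρ k G g, (φ (ρ.letter k)).Holds G g
    (fun s => M.accFrom ρ (ρ.after k) s (ρ.time k)) ↔ P ρ k

/-- The property is expressed by some ranked automaton. -/
def Realizable (sf : Bool) (P : PosProp AP) : Prop :=
  ∃ (M : RankedATA AP sf) (φ : Letter AP → TransFormula M.Loc), M.Realizes φ P

theorem Realizes.join {ι : Type} [Finite ι] {M : ι → RankedATA AP sf} {i : ι}
    {φ : Letter AP → TransFormula (M i).Loc} {P : PosProp AP} (h : (M i).Realizes φ P)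
    (E : Island AP sf (Σ i, (M i).Loc) (sigmaHeader M)) :
    (RankedATA.join M E).Realizes (fun a => (φ a).map fun s => .inl ⟨i, s⟩) P where
  free a := (TransFormula.freeLocs_map ..).trans (by rw [h.free]; exact Set.image_empty _)
  bound a q hq := by
    obtain ⟨s, hs, rfl⟩ := (Set.ext_iff.1 (TransFormula.boundLocs_map _ _) q).1 hq
    exact congrArg Sum.inl (Sigma.ext rfl (heq_of_eq (h.bound a s hs)))
  holds ρ k G g := by
    refine (TransFormula.holds_map ..).trans ((TransFormula.holds_congr (fun _ _ => Iff.rfl)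
      (fun _ _ => Iff.rfl) fun s _ => ?_).trans (h.holds ρ k G fun s => g (.inl ⟨i, s⟩)))
    exact accFrom_join_inl M E ρ _ i s _

/-- The island with a single location and no transitions. -/
def Island.trivial {ι : Type} [Finite ι] (M : ι → RankedATA AP sf) :
    Island AP sf (Σ i, (M i).Loc) (sigmaHeader M) :=
  .single M (fun _ => .bot) (fun _ => rfl) nofun

namespace Realizable
variable {P Q : PosProp AP}

theorem congr (hP : Realizable sf P) (h : ∀ ρ k, Q ρ k ↔ P ρ k) : Realizable sf Q := by
  have : Q = P := funext fun ρ => funext fun k => propext (h ρ k)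
  rwa [this]

open Classical in
theorem letter (T : Set (Letter AP)) : Realizable sf fun ρ k => ρ.letter k ∈ T := by
  refine ⟨RankedATA.join (ι := Empty) nofun (.trivial _), fun a => if a ∈ T then .top else .bot,
    fun a => ?_, fun a => ?_, fun ρ k G g => ?_⟩
  · split_ifs <;> rfl
  · split_ifs <;> nofun
  · by_cases h : ρ.letter k ∈ T
    · simp [h, TransFormula.Holds]
    · simp [h, TransFormula.Holds]

theorem exists_joint (hP : Realizable sf P) (hQ : Realizable sf Q) :
    ∃ (M : RankedATA AP sf) (φ ψ : Letter AP → TransFormula M.Loc),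
      M.Realizes φ P ∧ M.Realizes ψ Q := by
  obtain ⟨M, φ, h⟩ := hP
  obtain ⟨N, ψ, h'⟩ := hQ
  let F : Bool → RankedATA AP sf := fun b => b.rec M N
  exact ⟨_, _, _, Realizes.join (M := F) (i := false) h (.trivial F),
    Realizes.join (M := F) (i := true) h' (.trivial F)⟩

theorem and (hP : Realizable sf P) (hQ : Realizable sf Q) :
    Realizable sf fun ρ k => P ρ k ∧ Q ρ k := by
  obtain ⟨M, φ, ψ, h, h'⟩ := hP.exists_joint hQ
  refine ⟨M, fun a => .and (φ a) (ψ a), fun a => ?_, fun a q hq => ?_, fun ρ k G g => ?_⟩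
  · rw [TransFormula.freeLocs, h.free, h'.free, Set.union_empty]
  · exact hq.elim (h.bound a q) (h'.bound a q)
  · exact and_congr (h.holds ρ k G g) (h'.holds ρ k G g)

theorem or (hP : Realizable sf P) (hQ : Realizable sf Q) :
    Realizable sf fun ρ k => P ρ k ∨ Q ρ k := by
  obtain ⟨M, φ, ψ, h, h'⟩ := hP.exists_joint hQ
  refine ⟨M, fun a => .or (φ a) (ψ a), fun a => ?_, fun a q hq => ?_, fun ρ k G g => ?_⟩
  · rw [TransFormula.freeLocs, h.free, h'.free, Set.union_empty]
  · exact hq.elim (h.bound a q) (h'.bound a q)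
  · exact or_congr (h.holds ρ k G g) (h'.holds ρ k G g)

end Realizable

-- The island for a language of observations

section future
variable {ι κ : Type} [Finite ι] [Finite κ] (I : κ → TimeInterval)
  (B : BAut (Set ι × Set κ) sf) {L : Type} (φ : ι → Bool → Letter AP → TransFormula L)

open Classical in
/-- The transition of a state of `B`: guess the observation and a set of successors. -/
noncomputable def futureStep (q : B.Q) (a : Letter AP) : TransFormula (L ⊕ Option B.Q) :=
  have := B.finite_Q
  .bigOr fun c : {c : (Set ι × Set κ) × Set B.Q // B.δ q c.1 c.2 ∧
      ∀ t ∈ c.2, sf = true → t = q ∨ B.rank t < B.rank q} =>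
    .and (.bigAnd fun i => (φ i (decide (i ∈ c.1.1.1)) a).map .inl)
      (.and (.bigAnd fun j => if j ∈ c.1.1.2 then .guard (I j) else .notGuard (I j))
        (.bigAnd fun t : c.1.2 => .loc (.inr (some t.1))))

theorem freeLocs_futureStep (hφ : ∀ i b a, (φ i b a).freeLocs = ∅) {q : B.Q} {a : Letter AP}
    {p : L ⊕ Option B.Q} (hp : p ∈ (futureStep I B φ q a).freeLocs) :
    ∃ t, p = .inr (some t) ∧ (sf = true → t = q ∨ B.rank t < B.rank q) := by
  have := B.finite_Q
  obtain ⟨c, h | h | h⟩ := TransFormula.freeLocs_bigOr hp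
  · obtain ⟨i, h⟩ := TransFormula.freeLocs_bigAnd h
    rw [TransFormula.freeLocs_map, hφ, Set.image_empty] at h
    exact h.elim
  · obtain ⟨i, h⟩ := TransFormula.freeLocs_bigAnd h
    split_ifs at h
    · exact h.elim
    · rw [TransFormula.freeLocs_notGuard] at h
      exact h.elim
  · obtain ⟨t, h⟩ := TransFormula.freeLocs_bigAnd h
    exact ⟨t, h, c.2.2 t t.2⟩

theorem boundLocs_futureStep {q : B.Q} {a : Letter AP} {p : L ⊕ Option B.Q}
    (hp : p ∈ (futureStep I B φ q a).boundLocs) :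
    ∃ i b x, p = .inl x ∧ x ∈ (φ i b a).boundLocs := by
  have := B.finite_Q
  obtain ⟨c, h | h | h⟩ := TransFormula.boundLocs_bigOr hp
  · obtain ⟨i, h⟩ := TransFormula.boundLocs_bigAnd h
    rw [TransFormula.boundLocs_map] at h
    obtain ⟨x, hx, rfl⟩ := h
    exact ⟨i, _, x, rfl, hx⟩
  · obtain ⟨i, h⟩ := TransFormula.boundLocs_bigAnd h
    split_ifs at h
    · exact h.elim
    · rw [TransFormula.boundLocs_notGuard] at h
      exact h.elim
  · obtain ⟨t, h⟩ := TransFormula.boundLocs_bigAnd h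
    exact h.elim

/-- Each bit of the guessed observation is checked by a formula for the property or for its
negation, and by a guard or its negation. Only the true observation survives, and monotonicity of
`B` takes care of the guessed set of successors. -/
theorem holds_futureStep {q : B.Q} {a : Letter AP} {v : ℝ} (hv : 0 ≤ v)
    {g b : L ⊕ Option B.Q → Prop} {X : Set ι}
    (hX : ∀ i c, (φ i c a).Holds {I | v ∈ I.toSet} (fun s => g (.inl s)) (fun s => b (.inl s)) ↔
      (i ∈ X ↔ c = true)) :
    (futureStep I B φ q a).Holds {I | v ∈ I.toSet} g b ↔
      B.δ q (X, {j | v ∈ (I j).toSet}) {t | g (.inr (some t))} := by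
  classical
  have := B.finite_Q
  have hguard : ∀ (G : Set κ), (∀ j, (if j ∈ G then .guard (I j) else .notGuard (I j) :
      TransFormula (L ⊕ Option B.Q)).Holds {I | v ∈ I.toSet} g b) ↔
        G = {j | v ∈ (I j).toSet} := by
    intro G
    rw [Set.ext_iff]
    refine forall_congr' fun j => ?_
    by_cases hj : j ∈ G
    · simp [hj, TransFormula.Holds]
    · simp [hj, TransFormula.holds_notGuard _ hv]
  have hbits : ∀ Y : Set ι, (∀ i, ((φ i (decide (i ∈ Y)) a).map .inl :
      TransFormula (L ⊕ Option B.Q)).Holds {I | v ∈ I.toSet} g b) ↔ Y = X := by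
    intro Y
    rw [Set.ext_iff]
    refine forall_congr' fun i => ?_
    rw [TransFormula.holds_map, hX, decide_eq_true_iff]
    exact Iff.comm
  refine (TransFormula.holds_bigOr ..).trans ?_
  simp only [TransFormula.Holds, TransFormula.holds_bigAnd, hguard, hbits]
  constructor
  · rintro ⟨⟨⟨⟨Y, G⟩, Z⟩, hδ, _⟩, rfl, rfl, hZ⟩
    exact B.mono (fun t ht _ => hZ ⟨t, ht⟩) hδ
  · intro h
    refine ⟨⟨((X, {j | v ∈ (I j).toSet}),
      {t | g (.inr (some t)) ∧ (sf = true → t = q ∨ B.rank t < B.rank q)}),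
      B.mono (fun t ht hr => ⟨ht, hr⟩) h, fun t ht => ht.2⟩, rfl, rfl, fun t => t.2.1⟩

/-- The island that simulates `B` on the observations. -/
noncomputable def futureIsland {hd : L → L} (s₀ : B.Q) (hf : ∀ i b a, (φ i b a).freeLocs = ∅)
    (hb : ∀ i b a, ∀ q ∈ (φ i b a).boundLocs, hd q = q) : Island AP sf L hd where
  -- The additional element is a copy of `s₀` that serves as header: a header may not be entered
  -- without reset, whereas `B` may return to `s₀`.
  E := Option B.Q
  finite_E := have := B.finite_Q; inferInstance
  root := none
  final := {e | e.getD s₀ ∈ B.F}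
  rank e := e.elim (B.exists_rank_le.choose + 1) B.rank
  δ e a := futureStep I B φ (e.getD s₀) a
  bound e a q hq := by
    obtain ⟨i, b, x, rfl, hx⟩ := boundLocs_futureStep I B φ hq
    exact ⟨x, rfl, hb i b a x hx⟩
  free e a p hp := by
    obtain ⟨t, rfl, ht⟩ := freeLocs_futureStep I B φ hf hp
    refine ⟨some t, rfl, nofun, fun hs => ?_⟩
    cases e with
    | none => exact Or.inr (Nat.lt_succ_of_le (B.exists_rank_le.choose_spec t))
    | some q => exact (ht hs).imp (fun h => congrArg some h) id

end future

theorem Realizable.future {ι κ : Type} [Finite ι] [Finite κ] {P : ι → PosProp AP}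
    (I : κ → TimeInterval) {L : List (Set ι × Set κ) → Prop} (hP : ∀ i, Realizable sf (P i))
    (hP' : ∀ i, Realizable sf fun ρ k => ¬ P i ρ k) (hL : Cls sf L) :
    Realizable sf fun ρ k => L ((ρ.after k).map (obs P I ρ k)) := by
  obtain ⟨B, s₀, hB⟩ := hL.exists_bAut
  have h : ∀ x : ι × Bool, Realizable sf fun ρ k => (P x.1 ρ k ↔ x.2 = true) := by
    rintro ⟨i, _ | _⟩
    · exact (hP' i).congr fun ρ k => by simp
    · exact (hP i).congr fun ρ k => by simp
  choose M φ hM using h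
  let φ' : ι → Bool → Letter AP → TransFormula (Σ i, (M i).Loc) := fun i b a =>
    (φ (i, b) a).map fun s => ⟨(i, b), s⟩
  have hf : ∀ i b a, (φ' i b a).freeLocs = ∅ := fun i b a => by
    rw [TransFormula.freeLocs_map, (hM _).free, Set.image_empty]
  have hb : ∀ i b a, ∀ q ∈ (φ' i b a).boundLocs, sigmaHeader M q = q := fun i b a q hq => by
    rw [TransFormula.boundLocs_map] at hq
    obtain ⟨q, hq, rfl⟩ := hq
    exact Sigma.ext rfl (heq_of_eq ((hM _).bound a q hq))
  let E := futureIsland I B φ' s₀ hf hb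
  let A := RankedATA.join M E
  have hφ' : ∀ (ρ : TimedWord AP) (k : ρ.Pos) G (g : A.Loc → Prop) i c,
      (φ' i c (ρ.letter k)).Holds G (fun s => g (.inl s))
        (fun s => A.accFrom ρ (ρ.after k) (.inl s) (ρ.time k)) ↔ (P i ρ k ↔ c = true) := by
    intro ρ k G g i c
    refine (TransFormula.holds_map ..).trans (Iff.trans ?_
      ((hM (i, c)).holds ρ k G fun s => g (.inl ⟨(i, c), s⟩)))
    exact TransFormula.holds_congr (fun _ _ => Iff.rfl) (fun _ _ => Iff.rfl) fun s _ =>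
      accFrom_join_inl M E ρ _ (i, c) s _
  have key : ∀ (ρ : TimedWord AP) (k j : ρ.Pos) (e : Option B.Q), k ≤ j →
      (A.accFrom ρ (ρ.after j) (.inr e) (ρ.time k) ↔
        B.acc (e.getD s₀) ((ρ.after j).map (obs P I ρ k))) := by
    intro ρ k j
    induction j using ρ.after_induction with
    | h0 j h _ =>
      intro e _
      rw [h]
      exact Iff.rfl
    | h1 j i hi h ih =>
      intro e hkj
      have hki : k ≤ i := Fin.le_def.2 (by have := Fin.le_def.1 hkj; omega)
      rw [h, List.map_cons]
      refine (accFrom_join_inr_cons M E ρ i _ e _).trans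
        ((holds_futureStep I B φ' (sub_nonneg.2 (ρ.time_mono hki))
          (X := {i' | P i' ρ i}) fun i' c => hφ' ρ i _ (A.accFrom ρ (ρ.after i) · (ρ.time k)) i' c).trans
            ?_)
      have hset : {t : B.Q | A.accFrom ρ (ρ.after i) (.inr (some t)) (ρ.time k)} =
          {t | B.acc t ((ρ.after i).map (obs P I ρ k))} := Set.ext fun t => ih (some t) hki
      change B.δ _ _ {t : B.Q | A.accFrom ρ (ρ.after i) (.inr (some t)) (ρ.time k)} ↔ _
      rw [hset]
      rfl
  -- The reset on entering the island makes the clock measure the time since `k`.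
  refine ⟨A, fun _ => .reset (.loc (.inr none)), fun _ => rfl, fun _ q hq => ?_,
    fun ρ k G g => ?_⟩
  · rcases hq with hq | hq
    · obtain rfl : q = _ := hq
      rfl
    · exact hq.elim
  · exact (key ρ k k none le_rfl).trans (hB _)

/-- Transition formulae have no negation, so a property and its complement are carried through the
induction together. -/
theorem _root_.Definable.realizable {P : PosProp AP} (hP : Definable sf False P) :
    Realizable sf P ∧ Realizable sf fun ρ k => ¬ P ρ k := by
  induction hP with
  | letter T => exact ⟨.letter T, .letter Tᶜ⟩
  | not _ ih => exact ⟨ih.2, ih.1.congr fun ρ k => not_not⟩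
  | and _ _ ih ih' =>
    exact ⟨ih.1.and ih'.1, (ih.2.or ih'.2).congr fun ρ k => not_and_or⟩
  | future I _ hL ih =>
    exact ⟨.future I (fun i => (ih i).1) (fun i => (ih i).2) hL,
      .future I (fun i => (ih i).1) (fun i => (ih i).2) hL.not⟩
  | start h => exact h.elim

/-- A new initial location reads the first letter and applies the realizing formula there; this
location occurs in no transition. -/
theorem _root_.Definable.exists_rankedATA {P : PosProp AP} (hP : Definable sf False P) :
    ∃ M : RankedATA AP sf, ∀ ρ, M.Accepts ρ ↔ P ρ 0 := by
  obtain ⟨M, φ, h⟩ := hP.realizable.1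
  let F : Unit → RankedATA AP sf := fun _ => M
  let E : Island AP sf (Σ i, (F i).Loc) (sigmaHeader F) :=
    .single F (fun a => (φ a).map fun s => ⟨(), s⟩)
      (fun a => by rw [TransFormula.freeLocs_map, h.free, Set.image_empty]) fun a q hq => by
        rw [TransFormula.boundLocs_map] at hq
        obtain ⟨q, hq, rfl⟩ := hq
        exact Sigma.ext rfl (heq_of_eq (h.bound a q hq))
  refine ⟨RankedATA.join F E, fun ρ => ?_⟩
  rw [OneATA.accepts_iff]
  refine (accFrom_join_inr_cons F E ρ 0 _ () 0).trans ((TransFormula.holds_map ..).trans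
    ((TransFormula.holds_map ..).trans (Iff.trans (TransFormula.holds_congr (fun _ _ => Iff.rfl)
      (fun _ _ => Iff.rfl) fun s _ => ?_) (h.holds ρ 0 _ _))))
  exact accFrom_join_inl F E ρ _ () s _

end RankedATA

/-! ### Expressive equivalence -/

theorem OneATA.exists_formula {AP : Type u} [Finite AP] {sf : Bool} {A : OneATA AP}
    (hA : ∃ P, Definable sf False P ∧ ∀ ρ, A.Accepts ρ ↔ P ρ 0) :
    ∃ φ : RatMTL AP, (sf = true → φ.IsSfr) ∧ A.language = φ.language := by
  obtain ⟨P, hP, h⟩ := hA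
  obtain ⟨φ, hφ, h'⟩ := hP.expressible
  exact ⟨φ, hφ, Set.ext fun ρ => (h ρ).trans (h' ρ 0).symm⟩

theorem RatMTL.exists_rankedATA {AP : Type u} {sf : Bool} {φ : RatMTL AP}
    (hφ : sf = true → φ.IsSfr) : ∃ M : RankedATA AP sf, φ.language = M.language := by
  obtain ⟨Q, hQ, h⟩ := (RatMTL.definable φ hφ).eliminate_start
  obtain ⟨M, hM⟩ := hQ.exists_rankedATA
  exact ⟨M, Set.ext fun ρ => (h ρ).trans (hM ρ).symm⟩

theorem theorem1 {AP : Type*} [Finite AP] :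
    ExprEquiv {A : OneATA AP | A.IsLFR} OneATA.language
        (Set.univ : Set (RatMTL AP)) RatMTL.language ∧
      ExprEquiv {A : OneATA AP | A.IsPO} OneATA.language
        {φ : RatMTL AP | φ.IsSfr} RatMTL.language := by
  refine ⟨⟨fun A hA => ?_, fun φ _ => ?_⟩, ⟨fun A hA => ?_, fun φ hφ => ?_⟩⟩
  · obtain ⟨φ, -, h⟩ := OneATA.exists_formula (OneATA.IsLFR.exists_definable hA)
    exact ⟨φ, trivial, h⟩
  · obtain ⟨M, h⟩ := RatMTL.exists_rankedATA (sf := false) (φ := φ) nofun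
    exact ⟨M.toOneATA, M.isLFR, h⟩
  · obtain ⟨φ, hφ, h⟩ := OneATA.exists_formula (OneATA.IsPO.exists_definable hA)
    exact ⟨φ, hφ rfl, h⟩
  · obtain ⟨M, h⟩ := RatMTL.exists_rankedATA (sf := true) (φ := φ) fun _ => hφ
    exact ⟨M.toOneATA, M.isPO, h⟩
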